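/- Let $d\ge 3$, let $S^{k}$ have surface area $A_k$, and let $G=(V,E)$ be a finite simple graph that is $d$-sparse: it contains no complete bipartite subgraph $K_{a,b}$ with $a,b\ge 1$ and $a+b>d$. For a graph $H$ let $\Sigma_H$ be the set of maps $x:V(H)\to S^{d-1}$ that send adjacent nodes to orthogonal vectors and any at most $d$ nodes to linearly independent vectors. For a finite family $X$ of vectors let $\mathrm{Det}(X)$ be the square root of its Gram determinant, $\mathrm{Det}(\emptyset)=1$, and let $s_{d,n}(x_1,\dots,x_n)=\frac{A_{d-1}^{n-1}A_{d-n-1}}{A_{d-2}^{n}}\cdot\frac1{\mathrm{Det}(x_1,\dots,x_n)}$. For an ordering $p$ of $V$ let $N_p(v)$ be the set of neighbors of $v$ preceding $v$, $d_p(v)=|N_p(v)|$, $x_p(v)=x|_{N_p(v)}$. For $S\subseteq V$, a partial map $z:S\to\mathbb R^d$ and an ordering $p$ that starts with $S$, let $\rho_{z,p}$ be the law of the random extension $x$ of $z$ to $V$ obtained by processing the nodes of $V\setminus S$ in the order $p$ and choosing each $x_v$ uniformly from the unit vectors orthogonal to $x_p(v)$; let $\rho_p=\rho_{\emptyset,p}$.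 Put $\varphi_p=f_p\cdot\rho_p$ with $f_p(x)=\prod_{v\in V}s_{d,d_p(v)}(x_p(v))$, and let $\varphi_z=\varphi_{G,z}$ be the measure on maps $V\setminus S\to\mathbb R^d$ that is the image of the measure with density $\prod_{v\in V\setminus S}s_{d,d_p(v)}(x_p(v))$ with respect to $\rho_{z,p}$, restricted to $x\in\Sigma_G$. Then the following hold. (1) (Swap in subspaces.) Let $L_1,L_2\subseteq\mathbb R^d$ be linear subspaces of dimensions $d_1,d_2\ge2$. Let $\rho_1$ be the law of $(X_1,X_2')$ with $X_1$ uniform on $L_1\cap S^{d-1}$ and $X_2'$ uniform on $L_2\cap X_1^\perp\cap S^{d-1}$, and $\rho_2$ the law of $(X_1',X_2)$ with $X_2$ uniform on $L_2\cap S^{d-1}$ and $X_1'$ uniform on $L_1\cap X_2^\perp\cap S^{d-1}$. On the set of orthogonal pairs $(x_1,x_2)\in L_1\times L_2$ for which the projections $\widehat x_1$ of $x_1$ to $L_2$ and $\widehat x_2$ of $x_2$ to $L_1$ are nonzero, $\rho_1$ and $\rho_2$ are mutually absolutely continuous and $\frac{d\rho_2}{d\rho_1}=\frac{A_{d_1-1}A_{d_2-2}}{A_{d_2-1}A_{d_1-2}}\frac{|\widehat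 x_2|}{|\widehat x_1|}$. (2) (Swap of nodes.) If $r$ is obtained from the ordering $p$ by flipping two consecutive adjacent nodes $u,v$, with $v$ directly after $u$ in $p$, then $\rho_p$ and $\rho_r$ are mutually absolutely continuous and $$\frac{d\rho_r}{d\rho_p}(x)=\frac{A_{d-d_p(u)-1}A_{d-d_p(v)-1}}{A_{d-d_r(u)-1}A_{d-d_r(v)-1}}\cdot\frac{\mathrm{Det}(x_r(u))\,\mathrm{Det}(x_r(v))}{\mathrm{Det}(x_p(u))\,\mathrm{Det}(x_p(v))}.$$ (3) (Order independence.) For every ordering $p$, $\rho_p$ is a probability measure concentrated on $\Sigma_G$, and $\varphi=\varphi_p$ does not depend on $p$. For every $S$ and $z$, $\varphi_z$ does not depend on the ordering starting with $S$; and for $\varphi_{G[S]}$-almost every $z$, $\rho_{z,p}$ is concentrated on $\Sigma_G$ for every such ordering $p$. (4) $\varphi$ is a nonzero Radon measure on $\Sigma_G$ (it vanishes outside $\Sigma_G$). (5) (Markovian conditioning.) The family $(\varphi_z)$ is a conditioning of $\varphi$: $\varphi_\emptyset=\varphi$; for each $S\subseteq V$ and measurable $B$, $\varphi_z(B)$ is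 a measurable function of $z:S\to\mathbb R^d$; and for all $T\subseteq S\subseteq V$, every $z:T\to\mathbb R^d$ and all measurable sets $B$ of maps $S\setminus T\to\mathbb R^d$ and $C$ of maps $V\setminus S\to\mathbb R^d$, $$\varphi_z(B\times C)=\int_B\varphi_{zy}(C)\,d\varphi_{G[S],z}(y).$$ It is Markovian: for every $S\subseteq V$ and $z\in\Sigma_{G[S]}$, $\varphi_z$ is a product of $\sigma$-finite measures over the connected components of $G\setminus S$. (6) If $\varphi$ is finite, then $\varphi/\varphi(\Sigma_G)$ is a probability measure, and the normalized measures $\varphi_z/\varphi_z(\Omega_S)$, where $\Omega_S$ is the set of all maps $V\setminus S\to\mathbb R^d$ (the normalized measure being $0$ if $\varphi_z(\Omega_S)\in\{0,\infty\}$), form a conditioning of it in which the identity of (5) holds with the marginal of the normalized measure of $z$ on maps $S\setminus T\to\mathbb R^d$ in place of $\varphi_{G[S],z}$; this conditioning is Markovian in the sense of (5). -/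

import Mathlib

open MeasureTheory Set
open scoped ENNReal InnerProductSpace

noncomputable section

namespace OrthoHom

/-- The space `ℝ^d` with its Euclidean norm. -/
abbrev Vec (d : ℕ) : Type := EuclideanSpace ℝ (Fin d)

/-! ### Graphs and orderings -/

/-- `G` is `d`-sparse: it contains no complete bipartite graph `K_{a,b}` (`a, b ≥ 1`)
with `a + b > d` as a subgraph. -/
def IsSparse {V : Type*} (d : ℕ) (G : SimpleGraph V) : Prop :=
  ∀ a b : ℕ, 1 ≤ a → 1 ≤ b → d < a + b →
    (completeBipartiteGraph (Fin a) (Fin b)).Free G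

/-- An ordering of the (finitely many) nodes. -/
abbrev NodeOrder (V : Type*) : Type _ := V ≃ Fin (Nat.card V)

/-- The ordering `p` starts with the nodes of `S`. -/
def StartsWith {V : Type*} (p : NodeOrder V) (S : Set V) : Prop :=
  ∀ u ∈ S, ∀ v ∉ S, p u < p v

theorem exists_startsWith {V : Type*} [Finite V] (S : Set V) :
    ∃ p : NodeOrder V, StartsWith p S := by
  classical
  let e : V ≃ Fin (Nat.card V) := Finite.equivFin V
  let f : Fin (Nat.card V) → ℕ := fun i => if e.symm i ∈ S then 0 else 1
  refine ⟨e.trans (Tuple.sort f).symm, fun u hu v hv => ?_⟩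
  by_contra hlt
  have h := Tuple.monotone_sort f (not_lt.mp hlt)
  simp [f, hu, hv] at h

/-- The earlier neighbors `N_p(v)` of `v` in the ordering `p`. -/
def earlier {V : Type*} [Finite V] (G : SimpleGraph V) (p : NodeOrder V) (v : V) : Finset V :=
  (Set.toFinite {w | G.Adj v w ∧ p w < p v}).toFinset

/-! ### Ortho-homomorphisms -/

/-- `x` is an ortho-homomorphism: nodes go to unit vectors, adjacent nodes to orthogonal ones. -/
def IsOrthoHom {V : Type*} {d : ℕ} (G : SimpleGraph V) (x : V → Vec d) : Prop :=
  (∀ v, ‖x v‖ = 1) ∧ ∀ u v, G.Adj u v → ⟪x u, x v⟫_ℝ = 0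

/-- `x` is in general position: any (at most) `d` nodes go to linearly independent vectors. -/
def InGeneralPosition {V : Type*} {d : ℕ} (x : V → Vec d) : Prop :=
  ∀ W : Finset V, W.card ≤ d → LinearIndependent ℝ (fun v : W => x v)

/-- `Σ_{G,d}`: the ortho-homomorphisms of `G` in general position. -/
def orthoVariety {V : Type*} (G : SimpleGraph V) (d : ℕ) : Set (V → Vec d) :=
  {x | IsOrthoHom G x ∧ InGeneralPosition x}

/-! ### Spheres and generalized determinants -/

/-- The surface area `A_k` of the unit sphere `S^k` in `ℝ^(k+1)`. -/
def sphereArea (k : ℕ) : ℝ :=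
  ((volume : Measure (Vec (k + 1))).toSphere univ).toReal

/-- The uniform probability distribution on the unit sphere of a linear subspace `L`
(the rotation invariant surface measure, normalized), as a measure on `ℝ^d`. -/
def uniformSphere {d : ℕ} (L : Submodule ℝ (Vec d)) : Measure (Vec d) :=
  ((Measure.addHaar : Measure L).toSphere univ)⁻¹ •
    (Measure.addHaar : Measure L).toSphere.map
      (fun w : Metric.sphere (0 : L) 1 => ((w : L) : Vec d))

open scoped Classical in
/-- The generalized determinant `Det(x_v : v ∈ N)`, the square root of the Gram determinant. -/
def genDet {V : Type*} {d : ℕ} (x : V → Vec d) (N : Finset V) : ℝ :=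
  Real.sqrt (Matrix.det (Matrix.of fun i j : N => ⟪x i, x j⟫_ℝ))

/-- `s_{d,n}(x_v : v ∈ N)`, where `n = |N|`. -/
def sDensity {V : Type*} {d : ℕ} (x : V → Vec d) (N : Finset V) : ℝ :=
  sphereArea (d - 1) ^ ((N.card : ℤ) - 1) * sphereArea (d - N.card - 1) /
    sphereArea (d - 2) ^ N.card * (1 / genDet x N)

/-! ### The random sequential ortho-homomorphism -/

open scoped Classical in
/-- One step: the value at `v` is replaced by a uniform random unit vector orthogonal to the
values at the earlier neighbors of `v`. -/
def stepLaw {V : Type*} [Finite V] {d : ℕ} (G : SimpleGraph V) (p : NodeOrder V) (v : V)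
    (x : V → Vec d) : Measure (V → Vec d) :=
  (uniformSphere (Submodule.span ℝ (x '' (earlier G p v : Set V)))ᗮ).map
    (fun w => Function.update x v w)

open scoped Classical in
/-- The partial map `z`, with the value `0` as a placeholder at nodes not yet mapped. -/
def extendZero {V : Type*} {d : ℕ} (S : Set V) (z : S → Vec d) : V → Vec d :=
  fun v => if h : v ∈ S then z ⟨v, h⟩ else 0

open scoped Classical in
/-- `ρ_{z,p}`: the distribution of the random sequential extension of `z : S → ℝ^d` to all
nodes; the nodes outside `S` are processed in the order `p` (which should start with `S`). -/
def seqExtension {V : Type*} [Finite V] {d : ℕ} (G : SimpleGraph V) (p : NodeOrder V)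
    (S : Set V) (z : S → Vec d) : Measure (V → Vec d) :=
  (((List.finRange (Nat.card V)).map p.symm).filter (fun v => v ∉ S)).foldl
    (fun μ v => μ.bind (stepLaw G p v)) (Measure.dirac (extendZero S z))

/-- `ρ_p`: the distribution of the random sequential ortho-homomorphism. -/
def seqLaw {V : Type*} [Finite V] (G : SimpleGraph V) (d : ℕ) (p : NodeOrder V) :
    Measure (V → Vec d) :=
  seqExtension G p ∅ (fun v => isEmptyElim v)

/-- The weight `∏_{v ∉ S} s_{d,n}(x_p(v))`; for `S = ∅` this is `f_p`. -/
def weight {V : Type*} [Finite V] {d : ℕ} (G : SimpleGraph V) (p : NodeOrder V) (S : Set V)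
    (x : V → Vec d) : ℝ≥0∞ :=
  ∏ v ∈ (Set.toFinite Sᶜ).toFinset, ENNReal.ofReal (sDensity x (earlier G p v))

/-- `φ_p = f_p · ρ_p`. -/
def orthoMeasure {V : Type*} [Finite V] (G : SimpleGraph V) (d : ℕ) (p : NodeOrder V) :
    Measure (V → Vec d) :=
  (seqLaw G d p).withDensity (weight G p ∅)

/-- `φ_z` computed with the ordering `p`, as a measure on maps `V \ S → ℝ^d`: the law `ρ_{z,p}`,
reweighted by `∏_{v ∉ S} s_{d,n}(x_p(v))` on `Σ_G` (where this weight is finite and positive). -/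
def condMeasureOrd {V : Type*} [Finite V] (G : SimpleGraph V) (d : ℕ) (p : NodeOrder V)
    (S : Set V) (z : S → Vec d) : Measure (↥Sᶜ → Vec d) :=
  (((seqExtension G p S z).withDensity (weight G p S)).restrict (orthoVariety G d)).map
    (fun x (v : ↥Sᶜ) => x v)

/-- `φ_z`, computed with some ordering that starts with `S`. -/
def condMeasure {V : Type*} [Finite V] (G : SimpleGraph V) (d : ℕ)
    (S : Set V) (z : S → Vec d) : Measure (↥Sᶜ → Vec d) :=
  condMeasureOrd G d (exists_startsWith S).choose S z

/-- `φ_{G[S],z}` for `z` defined on `T ⊆ S`: the measure `φ_z` of the induced subgraph `G[S]`,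
on maps `S \ T → ℝ^d`. -/
def inducedMeasure {V : Type*} [Finite V] (G : SimpleGraph V) (d : ℕ)
    (S T : Set V) (z : T → Vec d) : Measure (↥(S \ T) → Vec d) :=
  (condMeasure (G.induce S) d {s : S | (s : V) ∈ T} (fun t => z ⟨t.1.1, t.2⟩)).map
    (fun y (v : ↥(S \ T)) => y ⟨⟨v.1, v.2.1⟩, v.2.2⟩)

/-! ### Conditionings and the Markov property -/

open scoped Classical in
/-- The union `zy : S → Ω` of `z : T → Ω` and `y : S \ T → Ω`. -/
def glue {V Ω : Type*} {S T : Set V} (z : T → Ω) (y : ↥(S \ T) → Ω) : S → Ω :=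
  fun s => if h : (s : V) ∈ T then z ⟨s, h⟩ else y ⟨s, s.2, h⟩

/-- The family `κ` is a conditioning of `φ`, where `base S T z` is the measure on `Ω^{S \ T}`
against which `κ T z` is disintegrated:
`κ T z (B × C) = ∫_B κ S (zy) (C) d(base S T z)(y)` for all `T ⊆ S` and every `z`. -/
structure IsConditioning {V Ω : Type*} [MeasurableSpace Ω] (φ : Measure (V → Ω))
    (κ : ∀ S : Set V, (S → Ω) → Measure (↥Sᶜ → Ω))
    (base : ∀ S T : Set V, (T → Ω) → Measure (↥(S \ T) → Ω)) : Prop where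
  empty : ∀ z : (∅ : Set V) → Ω, κ ∅ z = φ.map (fun x (v : ↥(∅ : Set V)ᶜ) => x v)
  measurable : ∀ (S : Set V) (B : Set (↥Sᶜ → Ω)), MeasurableSet B →
    Measurable (fun z : S → Ω => κ S z B)
  disintegration : ∀ (T S : Set V) (hTS : T ⊆ S) (z : T → Ω)
    (B : Set (↥(S \ T) → Ω)) (C : Set (↥Sᶜ → Ω)), MeasurableSet B → MeasurableSet C →
    κ T z {w | (fun v : ↥(S \ T) => w ⟨v.1, v.2.2⟩) ∈ B ∧
        (fun v : ↥Sᶜ => w ⟨v.1, fun h => v.2 (hTS h)⟩) ∈ C}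
      = ∫⁻ y in B, κ S (glue z y) C ∂(base S T z)

/-- The marginal of `κ T z` on `Ω^{S \ T}`. -/
def marginal {V Ω : Type*} [MeasurableSpace Ω]
    (κ : ∀ S : Set V, (S → Ω) → Measure (↥Sᶜ → Ω)) (S T : Set V) (z : T → Ω) :
    Measure (↥(S \ T) → Ω) :=
  (κ T z).map (fun w (v : ↥(S \ T)) => w ⟨v.1, v.2.2⟩)

/-- The Markov property: for every `S` and every `z` in `D S`, the measure `κ S z` is a product
of (sigma-finite) measures over the connected components of `G \ S`. -/
def IsMarkovian {V Ω : Type*} [Finite V] [MeasurableSpace Ω] (G : SimpleGraph V)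
    (κ : ∀ S : Set V, (S → Ω) → Measure (↥Sᶜ → Ω)) (D : ∀ S : Set V, Set (S → Ω)) : Prop :=
  letI (S : Set V) : Fintype (G.induce Sᶜ).ConnectedComponent := Fintype.ofFinite _
  ∀ S : Set V, ∀ z ∈ D S,
    ∃ μ : ∀ c : (G.induce Sᶜ).ConnectedComponent, Measure (c.supp → Ω),
      (∀ c, SigmaFinite (μ c)) ∧
      (κ S z).map (fun w (c : (G.induce Sᶜ).ConnectedComponent) (v : c.supp) => w v) = Measure.pi μ

/-- Each measure of the family is divided by its total mass (measures of infinite total mass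
become `0`). -/
def normalized {V Ω : Type*} [MeasurableSpace Ω]
    (κ : ∀ S : Set V, (S → Ω) → Measure (↥Sᶜ → Ω)) (S : Set V) (z : S → Ω) :
    Measure (↥Sᶜ → Ω) :=
  (κ S z univ)⁻¹ • κ S z

/-! ### Swapping two consecutive choices -/

/-- The law of `(X, Y)`, where `X` is uniform on the unit sphere of `L`, and `Y` is uniform on the
unit sphere of `M ∩ X^⊥`. -/
def pairLaw {d : ℕ} (L M : Submodule ℝ (Vec d)) : Measure (Vec d × Vec d) :=
  (uniformSphere L).bind fun x =>
    (uniformSphere (M ⊓ (Submodule.span ℝ {x})ᗮ)).map (fun y => (x, y))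

/-- Orthogonal pairs in `L₁ × L₂` for which the projection of `x₁` to `L₂` and the projection of
`x₂` to `L₁` are nonzero. -/
def swapDomain {d : ℕ} (L₁ L₂ : Submodule ℝ (Vec d)) : Set (Vec d × Vec d) :=
  {q | q.1 ∈ L₁ ∧ q.2 ∈ L₂ ∧ ⟪q.1, q.2⟫_ℝ = 0 ∧
    L₂.starProjection q.1 ≠ 0 ∧ L₁.starProjection q.2 ≠ 0}

/-- The ordering obtained from `p` by exchanging the positions of `u` and `v`. -/
def flipOrder {V : Type*} (p : NodeOrder V) (u v : V) : NodeOrder V :=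
  p.trans (Equiv.swap (p u) (p v))

/-- The density `dρ_r/dρ_p` for `r` obtained from `p` by flipping `u` and `v`. -/
def swapDensity {V : Type*} [Finite V] {d : ℕ} (G : SimpleGraph V) (p r : NodeOrder V) (u v : V)
    (x : V → Vec d) : ℝ≥0∞ :=
  ENNReal.ofReal
    ((sphereArea (d - (earlier G p u).card - 1) * sphereArea (d - (earlier G p v).card - 1)) /
      (sphereArea (d - (earlier G r u).card - 1) * sphereArea (d - (earlier G r v).card - 1)) *
      ((genDet x (earlier G r u) * genDet x (earlier G r v)) /
        (genDet x (earlier G p u) * genDet x (earlier G p v))))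

end OrthoHom

end

open OrthoHom

set_option linter.unusedSectionVars false

noncomputable section

namespace OrthoHom

open ProbabilityTheory Module

/-! ### Gaussian description of the uniform distribution on a sphere -/

section Gaussian

variable {E : Type*} [NormedAddCommGroup E] [InnerProductSpace ℝ E] [FiniteDimensional ℝ E]
  [MeasurableSpace E] [BorelSpace E]

/-! The uniform law on the unit sphere of a nonzero subspace L is the law of the direction of P_L g,
where P_L is the orthogonal projection and g is a standard Gaussian vector (`uniformSphere_eq_map`).
The random sequential map thereby becomes an iterated Gaussian integral, `seqInt`. Its integrating
measure is always the same, and only the integrand depends on earlier choices, so Fubini and joint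
measurability are available throughout.

Swap in subspaces. Let Y and Z be independent Gaussian vectors projected to L₁ and L₂. Weight their
joint law by |P_{L₂}Y| |P_{L₁}Z| and a test function of the two directions, and look at the
resulting density of t = ⟨Y,Z⟩. It can be computed by resolving Z along P_{L₂}Y, or by resolving Y
along P_{L₁}Z. The two densities agree almost everywhere and are continuous at t = 0, so they agree
at 0, which is a statement about orthogonal pairs (`lintegral_swap_gaussian`). Integrating out the
norms gives the constants, because a Gaussian vector in dimension k+1 has mean norm √(2π) A_k /
A_{k+1}. The result is `pairLaw_swap_eq_withDensity`.

Order independence. Adding a vector to an independent family multiplies Det by the distance of the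
vector from the span (`genDet_insert`), so the weights s_{d,n} exactly compensate the density of a
swap. For integrands vanishing off general position, exchanging two adjacent consecutive nodes
therefore preserves the weighted integral (`seqInt_swap_of_adj`). For nonadjacent nodes this is
Fubini. Transpositions generate all permutations (`seqInt_perm`).

General position. The laws of any two orderings of the same nodes have the same null sets
(`IsSparse.seqMeasure_absolutelyContinuous`). For at most d nodes the vectors are almost surely
independent, and order independence applies. For more than d nodes sparsity makes the complement
graph connected, and a swap of the last two nodes is composed of swaps of nonadjacent nodes and of
permutations of shorter prefixes. Any set of at most d nodes can then be moved to the front, where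
it is almost surely independent (`IsSparse.ae_genPos`). Dividing the common measure φ by the
positive weights gives the density for a flip of two nodes.

Conditioning. An iterated integral over a concatenated list is an iterated integral of an iterated
integral (`seqInt_append`). Since restrictions of maps in Σ_G lie in Σ_{G[S]}, this is the
disintegration identity.

Markov property. Without the restriction to Σ_G, choices in different components of G \ S are
independent given z (`seqInt_flatMap`). General position is not a product condition, but it is a
condition of nonvanishing analytic functions, so for each fixed z it holds almost surely or almost
never (`IsScalable.zero_one`, `genPos_zero_one`). Accordingly φ_z is the full product or zero, for
every z in Σ_{G[S]} and not merely for almost all of them. -/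

/-- The direction of a vector. -/
def nrm {F : Type*} [NormedAddCommGroup F] [NormedSpace ℝ F] (y : F) : F := ‖y‖⁻¹ • y

theorem norm_nrm {F : Type*} [NormedAddCommGroup F] [NormedSpace ℝ F] {y : F} (hy : y ≠ 0) :
    ‖nrm y‖ = 1 := by
  rw [nrm, norm_smul, norm_inv, norm_norm, inv_mul_cancel₀ (norm_ne_zero_iff.2 hy)]

theorem norm_smul_nrm {F : Type*} [NormedAddCommGroup F] [NormedSpace ℝ F] (y : F) :
    ‖y‖ • nrm y = y := by
  by_cases hy : y = 0
  · simp [hy, nrm]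
  · rw [nrm, smul_smul, mul_inv_cancel₀ (norm_ne_zero_iff.2 hy), one_smul]

@[fun_prop]
theorem measurable_nrm {F : Type*} [NormedAddCommGroup F] [NormedSpace ℝ F] [MeasurableSpace F]
    [BorelSpace F] [SecondCountableTopology F] : Measurable (nrm : F → F) := by
  unfold nrm; fun_prop

theorem continuousAt_nrm {F : Type*} [NormedAddCommGroup F] [NormedSpace ℝ F] {y : F}
    (hy : y ≠ 0) : ContinuousAt (nrm : F → F) y :=
  (continuousAt_id.norm.inv₀ (norm_ne_zero_iff.2 hy)).smul continuousAt_id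

/-- The standard Gaussian density with respect to the volume. -/
def gaussDensity (E : Type*) [NormedAddCommGroup E] [InnerProductSpace ℝ E] (r : ℝ) : ℝ :=
  (2 * Real.pi) ^ (-(finrank ℝ E : ℝ) / 2) * Real.exp (-(r ^ 2) / 2)

theorem gaussDensity_pos (r : ℝ) : 0 < gaussDensity E r := by
  unfold gaussDensity; positivity

@[fun_prop]
theorem measurable_gaussDensity : Measurable (gaussDensity E) := by
  unfold gaussDensity; fun_prop

/-- The Fourier transform of exp(-b‖v‖²) at b = 1/2; the normalizing factor cancels the power of
π/b. -/
theorem integral_gaussDensity_cexp (t : E) :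
    ∫ v : E, (gaussDensity E ‖v‖ : ℂ) * Complex.exp (⟪v, t⟫_ℝ * Complex.I) =
      Complex.exp (-(‖t‖ : ℂ) ^ 2 / 2) := by
  have h := GaussianFourier.integral_cexp_neg_mul_sq_norm_add (V := E) (b := (1 / 2 : ℂ))
    (by norm_num) Complex.I t
  have e : ∀ v : E, (gaussDensity E ‖v‖ : ℂ) * Complex.exp (⟪v, t⟫_ℝ * Complex.I) =
      ((2 * Real.pi) ^ (-(finrank ℝ E : ℝ) / 2) : ℝ) *
        Complex.exp (-(1 / 2 : ℂ) * ‖v‖ ^ 2 + Complex.I * ⟪t, v⟫_ℝ) := by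
    intro v
    rw [gaussDensity, Complex.exp_add, real_inner_comm]
    push_cast
    rw [mul_assoc]
    congr 2
    · congr 1; ring
    · congr 1; ring
  simp_rw [e]
  rw [integral_const_mul, h, ← mul_assoc]
  have e2 : (((2 * Real.pi) ^ (-(finrank ℝ E : ℝ) / 2) : ℝ) : ℂ) *
      ((Real.pi : ℂ) / (1 / 2)) ^ ((finrank ℝ E : ℂ) / 2) = 1 := by
    have : ((Real.pi : ℂ) / (1 / 2)) ^ ((finrank ℝ E : ℂ) / 2) =
        (((2 * Real.pi) ^ ((finrank ℝ E : ℝ) / 2) : ℝ) : ℂ) := by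
      rw [Complex.ofReal_cpow (by positivity)]
      push_cast
      congr 1
      ring
    rw [this, ← Complex.ofReal_mul, ← Real.rpow_add (by positivity)]
    rw [neg_div, neg_add_cancel, Real.rpow_zero, Complex.ofReal_one]
  rw [e2, one_mul, Complex.I_sq]
  congr 1; ring

theorem integral_gaussDensity : ∫ v : E, gaussDensity E ‖v‖ = 1 := by
  have h := integral_gaussDensity_cexp (0 : E)
  simp only [inner_zero_right, Complex.ofReal_zero, zero_mul, Complex.exp_zero, mul_one,
    norm_zero] at h
  rw [integral_complex_ofReal] at h
  simpa using h

theorem integrable_gaussDensity : Integrable (fun v : E => gaussDensity E ‖v‖) := by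
  by_contra h
  have := integral_gaussDensity (E := E)
  rw [integral_undef h] at this
  exact zero_ne_one this

theorem lintegral_gaussDensity : ∫⁻ v : E, ENNReal.ofReal (gaussDensity E ‖v‖) = 1 := by
  rw [← ofReal_integral_eq_lintegral_ofReal integrable_gaussDensity
    (ae_of_all _ fun v => (gaussDensity_pos _).le), integral_gaussDensity, ENNReal.ofReal_one]

/-- Both sides are probability measures with characteristic function exp(-‖t‖²/2). -/
theorem stdGaussian_eq_withDensity :
    stdGaussian E = (volume : Measure E).withDensity
      (fun v => ENNReal.ofReal (gaussDensity E ‖v‖)) := by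
  have hm : Measurable fun v : E => (gaussDensity E ‖v‖).toNNReal := by fun_prop
  have : IsProbabilityMeasure ((volume : Measure E).withDensity
      (fun v => ENNReal.ofReal (gaussDensity E ‖v‖))) :=
    ⟨by rw [withDensity_apply _ .univ, setLIntegral_univ, lintegral_gaussDensity]⟩
  refine Measure.ext_of_charFun (funext fun t => ?_)
  rw [charFun_stdGaussian, charFun_apply]
  have := integral_withDensity_eq_integral_smul (μ := (volume : Measure E)) hm
    (fun v => Complex.exp (⟪v, t⟫_ℝ * Complex.I))
  change _ = ∫ v, _ ∂((volume : Measure E).withDensity fun v =>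
    ((gaussDensity E ‖v‖).toNNReal : ℝ≥0∞))
  rw [this, ← integral_gaussDensity_cexp t]
  refine integral_congr_ae (ae_of_all _ fun v => ?_)
  simp only [NNReal.smul_def, Real.coe_toNNReal _ (gaussDensity_pos ‖v‖).le, Complex.real_smul]

theorem stdGaussian_absolutelyContinuous : stdGaussian E ≪ volume := by
  rw [stdGaussian_eq_withDensity]
  exact withDensity_absolutelyContinuous _ _

theorem lintegral_stdGaussian {f : E → ℝ≥0∞} (hf : Measurable f) :
    ∫⁻ v, f v ∂(stdGaussian E) = ∫⁻ v, f v * ENNReal.ofReal (gaussDensity E ‖v‖) := by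
  rw [stdGaussian_eq_withDensity, lintegral_withDensity_eq_lintegral_mul _ (by fun_prop) hf]
  simp only [Pi.mul_apply, mul_comm]

theorem stdGaussian_submodule {K : Submodule ℝ E} (hK : K ≠ ⊤) : stdGaussian E K = 0 :=
  stdGaussian_absolutelyContinuous (Measure.addHaar_submodule _ _ hK)

/-- Polar coordinates for the direction and the norm. -/
theorem lintegral_nrm_mul_norm [Nontrivial E] (μ : Measure E) [μ.IsAddHaarMeasure]
    {f : E → ℝ≥0∞} {φ : ℝ → ℝ≥0∞} (hf : Measurable f) (hφ : Measurable φ) :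
    ∫⁻ v, f (nrm v) * φ ‖v‖ ∂μ =
      (∫⁻ x, f x ∂μ.toSphere) *
        ∫⁻ r : Ioi (0 : ℝ), φ r ∂(Measure.volumeIoiPow (finrank ℝ E - 1)) := by
  have h := μ.measurePreserving_homeomorphUnitSphereProd
  have e : ∫⁻ v, f (nrm v) * φ ‖v‖ ∂μ =
      ∫⁻ v : ({0}ᶜ : Set E), f (nrm v.1) * φ ‖v.1‖ ∂(μ.comap (↑)) := by
    rw [← restrict_compl_singleton (μ := μ) 0,
      ← lintegral_subtype_comap (measurableSet_singleton (0 : E)).compl]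
    simp
  rw [e, ← lintegral_prod_mul (by fun_prop) (by fun_prop)]
  rw [← h.lintegral_comp (f := fun q => f q.1 * φ q.2) (by fun_prop)]
  refine lintegral_congr fun v => ?_
  simp [nrm]

theorem measurable_starProjection (L : Submodule ℝ E) : Measurable L.starProjection :=
  L.starProjection.continuous.measurable

/-- The projection is self-adjoint, so it can be moved from the random vector to `t`. -/
theorem charFun_map_starProjection (L : Submodule ℝ E) (t : E) :
    charFun ((stdGaussian E).map L.starProjection) t =
      Complex.exp (-(‖L.starProjection t‖ : ℂ) ^ 2 / 2) := by
  rw [charFun_apply, integral_map (measurable_starProjection L).aemeasurable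
    (Measurable.aestronglyMeasurable (by fun_prop))]
  simp_rw [Submodule.inner_starProjection_left_eq_right]
  rw [← charFun_apply, charFun_stdGaussian]

theorem map_orthogonalProjectionOnto (L : Submodule ℝ E) :
    (stdGaussian E).map L.orthogonalProjectionOnto = stdGaussian L := by
  have hm : Measurable L.orthogonalProjectionOnto :=
    L.orthogonalProjectionOnto.continuous.measurable
  have := Measure.isProbabilityMeasure_map (μ := stdGaussian E) hm.aemeasurable
  refine Measure.ext_of_charFun (funext fun t => ?_)
  rw [charFun_apply, integral_map hm.aemeasurable
    (Measurable.aestronglyMeasurable (by fun_prop)), charFun_stdGaussian]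
  simp_rw [Submodule.inner_orthogonalProjectionOnto_eq_of_mem_right]
  rw [← charFun_apply, charFun_stdGaussian]
  simp

theorem lintegral_starProjection (L : Submodule ℝ E) {f : E → ℝ≥0∞} (hf : Measurable f) :
    ∫⁻ g, f (L.starProjection g) ∂(stdGaussian E) = ∫⁻ y : L, f y ∂(stdGaussian L) := by
  rw [← map_orthogonalProjectionOnto, lintegral_map (by fun_prop)
    L.orthogonalProjectionOnto.continuous.measurable]
  rfl

theorem lintegral_uniformSphere {d : ℕ} (L : Submodule ℝ (Vec d)) {f : Vec d → ℝ≥0∞}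
    (hf : Measurable f) :
    ∫⁻ x, f x ∂(uniformSphere L) = ((Measure.addHaar : Measure L).toSphere univ)⁻¹ *
      ∫⁻ w, f ((w : L) : Vec d) ∂(Measure.addHaar : Measure L).toSphere := by
  rw [uniformSphere, lintegral_smul_measure, lintegral_map hf (by fun_prop), smul_eq_mul]

/-- The direction and the norm of a projected Gaussian vector are independent, and the direction
is uniform. -/
theorem lintegral_starProjection_nrm_mul {d : ℕ} {L : Submodule ℝ (Vec d)} (hL : L ≠ ⊥)
    {f : Vec d → ℝ≥0∞} {φ : ℝ → ℝ≥0∞} (hf : Measurable f) (hφ : Measurable φ) :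
    ∫⁻ g, f (nrm (L.starProjection g)) * φ ‖L.starProjection g‖ ∂(stdGaussian (Vec d)) =
      (∫⁻ x, f x ∂(uniformSphere L)) *
        ∫⁻ g, φ ‖L.starProjection g‖ ∂(stdGaussian (Vec d)) := by
  have : Nontrivial L := (Submodule.nontrivial_iff_ne_bot).2 hL
  rw [lintegral_starProjection L (f := fun y => f (nrm y) * φ ‖y‖) (by fun_prop),
    lintegral_starProjection L (f := fun y => φ ‖y‖) (by fun_prop),
    lintegral_uniformSphere L hf]
  rw [lintegral_stdGaussian (by fun_prop), lintegral_stdGaussian (by fun_prop)]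
  have hc := Measure.isAddLeftInvariant_eq_smul (volume : Measure L) (Measure.addHaar : Measure L)
  set c := Measure.addHaarScalarFactor (volume : Measure L) (Measure.addHaar : Measure L)
  rw [hc, lintegral_smul_measure, lintegral_smul_measure]
  have h1 := lintegral_nrm_mul_norm (E := L) Measure.addHaar
    (f := fun y : L => f y) (φ := fun r => φ r * ENNReal.ofReal (gaussDensity L r))
    (by fun_prop) (by fun_prop)
  have h2 := lintegral_nrm_mul_norm (E := L) Measure.addHaar
    (f := fun _ : L => 1) (φ := fun r => φ r * ENNReal.ofReal (gaussDensity L r))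
    (by fun_prop) (by fun_prop)
  simp only [lintegral_const, one_mul] at h2
  have e : ∀ v : L, f (nrm (v : Vec d)) * φ ‖(v : Vec d)‖ * ENNReal.ofReal (gaussDensity L ‖v‖) =
      f ((nrm v : L) : Vec d) * (φ ‖v‖ * ENNReal.ofReal (gaussDensity L ‖v‖)) := by
    intro v
    rw [mul_assoc]
    rfl
  simp_rw [e]
  rw [h1]
  have e2 : ∫⁻ v : L, φ ‖(v : Vec d)‖ * ENNReal.ofReal (gaussDensity L ‖v‖) ∂Measure.addHaar =
    _ := h2
  rw [e2]
  set T := (Measure.addHaar : Measure L).toSphere univ with hT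
  have hT0 : T ≠ 0 := by
    rw [hT, Ne, Measure.measure_univ_eq_zero]; exact Measure.toSphere_ne_zero _
  have hT1 : T ≠ ∞ := measure_ne_top _ _
  set S := ∫⁻ x, f ((x : L) : Vec d) ∂(Measure.addHaar : Measure L).toSphere
  set I := ∫⁻ r : Ioi (0 : ℝ), φ r * ENNReal.ofReal (gaussDensity L r)
    ∂(Measure.volumeIoiPow (finrank ℝ L - 1))
  simp only [ENNReal.smul_def, smul_eq_mul]
  calc (c : ℝ≥0∞) * (S * I) = (T⁻¹ * T) * (c * (S * I)) := by rw [ENNReal.inv_mul_cancel hT0 hT1, one_mul]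
    _ = _ := by ring

theorem lintegral_uniformSphere_eq {d : ℕ} {L : Submodule ℝ (Vec d)} (hL : L ≠ ⊥)
    {f : Vec d → ℝ≥0∞} (hf : Measurable f) :
    ∫⁻ x, f x ∂(uniformSphere L) =
      ∫⁻ g, f (nrm (L.starProjection g)) ∂(stdGaussian (Vec d)) := by
  have := lintegral_starProjection_nrm_mul hL hf (φ := fun _ => 1) measurable_const
  simpa using this.symm

/-- This presents the uniform laws of all nonzero subspaces as images of one fixed measure.
Measurable dependence on `L` then reduces to measurability of the projection. -/
theorem uniformSphere_eq_map {d : ℕ} {L : Submodule ℝ (Vec d)} (hL : L ≠ ⊥) :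
    uniformSphere L = (stdGaussian (Vec d)).map (fun g => nrm (L.starProjection g)) := by
  ext s hs
  rw [← lintegral_indicator_one hs, lintegral_uniformSphere_eq hL (measurable_one.indicator hs),
    ← lintegral_indicator_one hs, lintegral_map (measurable_one.indicator hs) (by fun_prop)]

theorem toSphere_univ_ne_zero [Nontrivial E] : (volume : Measure E).toSphere univ ≠ 0 := by
  rw [Ne, Measure.measure_univ_eq_zero]; exact Measure.toSphere_ne_zero _

theorem sphereArea_pos (k : ℕ) : 0 < sphereArea k :=
  ENNReal.toReal_pos toSphere_univ_ne_zero (measure_ne_top _ _)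

theorem toSphere_univ_eq [Nontrivial E] {k : ℕ} (hk : finrank ℝ E = k + 1) :
    (volume : Measure E).toSphere univ = ENNReal.ofReal (sphereArea k) := by
  rw [sphereArea, ENNReal.ofReal_toReal (measure_ne_top _ _), Measure.toSphere_apply_univ,
    Measure.toSphere_apply_univ, InnerProductSpace.volume_ball, InnerProductSpace.volume_ball, hk]
  simp

/-- In polar coordinates the factor ‖v‖ raises the power of r by one, which turns the radial
integral in dimension k+1 into the one in dimension k+2. The latter is known, because the Gaussian
density there has total mass 1. The factor √(2π) is the ratio of the normalizing constants. -/
theorem lintegral_norm_stdGaussian [Nontrivial E] {k : ℕ} (hk : finrank ℝ E = k + 1) :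
    (∫⁻ v, ENNReal.ofReal ‖v‖ ∂(stdGaussian E)) * ENNReal.ofReal (sphereArea (k + 1)) =
      ENNReal.ofReal (Real.sqrt (2 * Real.pi)) * ENNReal.ofReal (sphereArea k) := by
  have h1 := lintegral_nrm_mul_norm (volume : Measure E) (f := fun _ => 1)
    (φ := fun r => ENNReal.ofReal r * ENNReal.ofReal (gaussDensity E r))
    measurable_const (by fun_prop)
  have h2 := lintegral_nrm_mul_norm (volume : Measure (Vec (k + 2))) (f := fun _ => 1)
    (φ := fun r => ENNReal.ofReal (gaussDensity (Vec (k + 2)) r))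
    measurable_const (by fun_prop)
  simp only [one_mul, lintegral_const] at h1 h2
  rw [lintegral_gaussDensity, toSphere_univ_eq (k := k + 1) (by simp)] at h2
  rw [lintegral_stdGaussian (by fun_prop), h1, toSphere_univ_eq hk]
  have h3 : ∫⁻ r : Ioi (0 : ℝ), ENNReal.ofReal r * ENNReal.ofReal (gaussDensity E r)
        ∂(Measure.volumeIoiPow (finrank ℝ E - 1)) =
      ENNReal.ofReal (Real.sqrt (2 * Real.pi)) *
        ∫⁻ r : Ioi (0 : ℝ), ENNReal.ofReal (gaussDensity (Vec (k + 2)) r)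
        ∂(Measure.volumeIoiPow (finrank ℝ (Vec (k + 2)) - 1)) := by
    rw [Measure.volumeIoiPow, Measure.volumeIoiPow,
      lintegral_withDensity_eq_lintegral_mul _ (by fun_prop) (by fun_prop),
      lintegral_withDensity_eq_lintegral_mul _ (by fun_prop) (by fun_prop),
      ← lintegral_const_mul _ (by fun_prop)]
    refine lintegral_congr fun r => ?_
    have hr : (0 : ℝ) < r := r.2
    simp only [Pi.mul_apply, finrank_euclideanSpace, Fintype.card_fin, hk]
    rw [← ENNReal.ofReal_mul hr.le, ← ENNReal.ofReal_mul (by positivity),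
      ← ENNReal.ofReal_mul (by positivity), ← ENNReal.ofReal_mul (by positivity)]
    congr 1
    have : gaussDensity E r = Real.sqrt (2 * Real.pi) * gaussDensity (Vec (k + 2)) r := by
      simp only [gaussDensity, hk, finrank_euclideanSpace, Fintype.card_fin]
      rw [← mul_assoc, Real.sqrt_eq_rpow, ← Real.rpow_add (by positivity)]
      congr 2
      push_cast; ring
    rw [this, show k + 2 - 1 = k + 1 from rfl, Nat.add_sub_cancel, pow_succ]
    ring
  rw [h3]
  calc _ = ENNReal.ofReal (Real.sqrt (2 * Real.pi)) * ENNReal.ofReal (sphereArea k) *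
      (ENNReal.ofReal (sphereArea (k + 1)) *
        ∫⁻ r : Ioi (0 : ℝ), ENNReal.ofReal (gaussDensity (Vec (k + 2)) r)
        ∂(Measure.volumeIoiPow (finrank ℝ (Vec (k + 2)) - 1))) := by ring
    _ = _ := by rw [← h2, mul_one]

theorem lintegral_norm_starProjection {L : Submodule ℝ E} {k : ℕ} (hk : finrank ℝ L = k + 1) :
    (∫⁻ g, ENNReal.ofReal ‖L.starProjection g‖ ∂(stdGaussian E)) *
        ENNReal.ofReal (sphereArea (k + 1)) =
      ENNReal.ofReal (Real.sqrt (2 * Real.pi)) * ENNReal.ofReal (sphereArea k) := by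
  have : Nontrivial L := Module.nontrivial_of_finrank_pos (R := ℝ) (by omega)
  rw [lintegral_starProjection L (f := fun y => ENNReal.ofReal ‖y‖) (by fun_prop)]
  exact lintegral_norm_stdGaussian hk

theorem inner_starProjection_self (L : Submodule ℝ E) (x : E) :
    ⟪x, L.starProjection x⟫_ℝ = ‖L.starProjection x‖ ^ 2 := by
  rw [← real_inner_self_eq_norm_sq, Submodule.inner_starProjection_left_eq_right,
    Submodule.starProjection_eq_self_iff.2 (L.starProjection_apply_mem _)]

/-- One Gram–Schmidt step. It needs no case distinction: if `x` is orthogonal to `L`, the subtracted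
vector is zero and the intersection is `L` itself. Being explicit in `x`, the formula yields joint
measurability. -/
theorem starProjection_inf_orthogonal_singleton (L : Submodule ℝ E) (x g : E) :
    (L ⊓ (Submodule.span ℝ {x})ᗮ).starProjection g =
      L.starProjection g -
        (⟪L.starProjection x, g⟫_ℝ / ‖L.starProjection x‖ ^ 2) • L.starProjection x := by
  have hx := inner_starProjection_self L x
  apply Submodule.eq_starProjection_of_mem_of_inner_eq_zero
  · refine ⟨sub_mem (L.starProjection_apply_mem _)
      (L.smul_mem _ (L.starProjection_apply_mem _)), ?_⟩
    rw [SetLike.mem_coe, Submodule.mem_orthogonal_singleton_iff_inner_right, inner_sub_right,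
      inner_smul_right, hx, ← Submodule.inner_starProjection_left_eq_right]
    by_cases h : L.starProjection x = 0
    · simp [h]
    · rw [div_mul_cancel₀ _ (pow_ne_zero 2 (norm_ne_zero_iff.2 h)), sub_self]
  · rintro w ⟨hwL, hwx⟩
    rw [SetLike.mem_coe, Submodule.mem_orthogonal_singleton_iff_inner_right] at hwx
    have h1 : ⟪L.starProjection x, w⟫_ℝ = 0 := by
      rw [Submodule.inner_starProjection_left_eq_right,
        Submodule.starProjection_eq_self_iff.2 hwL, hwx]
    rw [← sub_add, inner_add_left, L.starProjection_inner_eq_zero _ _ hwL, inner_smul_left, h1]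
    simp

/-- A projected Gaussian vector splits into independent parts orthogonal and parallel to a given
vector. -/
theorem map_starProjection_eq_map_prod {L : Submodule ℝ E} {a : E} (ha : a ∈ L) (ha0 : a ≠ 0) :
    (stdGaussian E).map L.starProjection =
      ((stdGaussian E).prod (gaussianReal 0 1)).map
        (fun q => (L ⊓ (Submodule.span ℝ {a})ᗮ).starProjection q.1 + q.2 • nrm a) := by
  have hm1 := measurable_starProjection L
  have hm2 : Measurable (fun q : E × ℝ =>
      (L ⊓ (Submodule.span ℝ {a})ᗮ).starProjection q.1 + q.2 • nrm a) := by fun_prop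
  have := Measure.isProbabilityMeasure_map (μ := stdGaussian E) hm1.aemeasurable
  have := Measure.isProbabilityMeasure_map (μ := (stdGaussian E).prod (gaussianReal 0 1))
    hm2.aemeasurable
  refine Measure.ext_of_charFun (funext fun t => ?_)
  rw [charFun_map_starProjection, charFun_apply, integral_map hm2.aemeasurable
    (Measurable.aestronglyMeasurable (by fun_prop))]
  have e : ∀ q : E × ℝ, Complex.exp (⟪(L ⊓ (Submodule.span ℝ {a})ᗮ).starProjection q.1 +
      q.2 • nrm a, t⟫_ℝ * Complex.I) =
      Complex.exp (⟪(L ⊓ (Submodule.span ℝ {a})ᗮ).starProjection q.1, t⟫_ℝ * Complex.I) *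
        Complex.exp (⟪nrm a, t⟫_ℝ * q.2 * Complex.I) := by
    intro q
    rw [← Complex.exp_add, inner_add_left, real_inner_smul_left]
    push_cast
    congr 1; ring
  simp_rw [e]
  rw [integral_prod_mul (f := fun g => Complex.exp
    (⟪(L ⊓ (Submodule.span ℝ {a})ᗮ).starProjection g, t⟫_ℝ * Complex.I))
    (g := fun s : ℝ => Complex.exp (⟪nrm a, t⟫_ℝ * s * Complex.I))]
  have h1 := charFun_map_starProjection (L ⊓ (Submodule.span ℝ {a})ᗮ) t
  rw [charFun_apply, integral_map (measurable_starProjection _).aemeasurable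
    (Measurable.aestronglyMeasurable (by fun_prop))] at h1
  rw [h1]
  have h2 := charFun_gaussianReal (μ := 0) (v := 1) (⟪nrm a, t⟫_ℝ)
  rw [charFun_apply_real] at h2
  rw [h2, ← Complex.exp_add]
  -- Pythagoras in `L` for the line of `a` and its complement; this makes the two characteristic
  -- functions multiply to the right one.
  have hn : ‖L.starProjection t‖ ^ 2 =
      ‖(L ⊓ (Submodule.span ℝ {a})ᗮ).starProjection t‖ ^ 2 + ⟪nrm a, t⟫_ℝ ^ 2 := by
    have h3 := starProjection_inf_orthogonal_singleton L a t
    rw [Submodule.starProjection_eq_self_iff.2 ha] at h3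
    have hna : ‖a‖ ≠ 0 := norm_ne_zero_iff.2 ha0
    have h4 : ⟪L.starProjection t, a⟫_ℝ = ⟪a, t⟫_ℝ := by
      rw [Submodule.inner_starProjection_left_eq_right, Submodule.starProjection_eq_self_iff.2 ha,
        real_inner_comm]
    rw [h3, norm_sub_sq_real, inner_smul_right, h4, norm_smul, nrm, real_inner_smul_left,
      mul_pow, Real.norm_eq_abs, sq_abs]
    field_simp
    ring
  congr 1
  rw [← Complex.ofReal_pow, hn]
  push_cast
  ring

theorem lintegral_starProjection_eq_lintegral_lintegral {L : Submodule ℝ E} {a : E} (ha : a ∈ L)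
    (ha0 : a ≠ 0) {f : E → ℝ≥0∞} (hf : Measurable f) :
    ∫⁻ g, f (L.starProjection g) ∂(stdGaussian E) =
      ∫⁻ g, ∫⁻ s, f ((L ⊓ (Submodule.span ℝ {a})ᗮ).starProjection g + s • nrm a)
        ∂(gaussianReal 0 1) ∂(stdGaussian E) := by
  rw [← lintegral_map hf (measurable_starProjection L), map_starProjection_eq_map_prod ha ha0,
    lintegral_map hf (by fun_prop), lintegral_prod _ (by fun_prop)]

end Gaussian

/-! ### Swapping two orthogonal choices in linear subspaces -/

section Swap

variable {E : Type*} [NormedAddCommGroup E] [InnerProductSpace ℝ E] [FiniteDimensional ℝ E]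
  [MeasurableSpace E] [BorelSpace E]

theorem inf_orthogonal_starProjection (L : Submodule ℝ E) (x : E) :
    L ⊓ (Submodule.span ℝ {L.starProjection x})ᗮ = L ⊓ (Submodule.span ℝ {x})ᗮ := by
  ext w
  simp only [Submodule.mem_inf, Submodule.mem_orthogonal_singleton_iff_inner_right]
  refine and_congr_right fun hw => ?_
  rw [Submodule.inner_starProjection_left_eq_right, Submodule.starProjection_eq_self_iff.2 hw]

theorem starProjection_inf_orthogonal_starProjection (L : Submodule ℝ E) (x g : E) :
    (L ⊓ (Submodule.span ℝ {L.starProjection x})ᗮ).starProjection g =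
      (L ⊓ (Submodule.span ℝ {x})ᗮ).starProjection g := by
  rw [starProjection_inf_orthogonal_singleton, starProjection_inf_orthogonal_singleton,
    Submodule.starProjection_eq_self_iff.2 (L.starProjection_apply_mem x)]

theorem measurable_starProjection_inf {α : Type*} [MeasurableSpace α] (L : Submodule ℝ E)
    {f g : α → E} (hf : Measurable f) (hg : Measurable g) :
    Measurable fun x => (L ⊓ (Submodule.span ℝ {f x})ᗮ).starProjection (g x) := by
  simp_rw [starProjection_inf_orthogonal_singleton]
  have := measurable_starProjection L
  fun_prop

/-- The weight of a pair whose second member is close to being orthogonal to the first one. -/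
def swapIntegrand (L₁ : Submodule ℝ E) (H : E → E → ℝ≥0∞) (y z : E) : ℝ≥0∞ :=
  ENNReal.ofReal ‖L₁.starProjection z‖ * H (nrm y) (nrm z)

open scoped Classical in
/-- The integrand of the disintegration of the law of two projected Gaussian vectors along the
value `t` of their inner product. -/
def sliceIntegrand (L₁ L₂ : Submodule ℝ E) (H : E → E → ℝ≥0∞) (t : ℝ) (g h : E) : ℝ≥0∞ :=
  if L₂.starProjection (L₁.starProjection g) = 0 then 0 else
    gaussianPDF 0 1 (‖L₂.starProjection (L₁.starProjection g)‖⁻¹ * t) *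
      swapIntegrand L₁ H (L₁.starProjection g)
        ((L₂ ⊓ (Submodule.span ℝ {L₁.starProjection g})ᗮ).starProjection h +
          (‖L₂.starProjection (L₁.starProjection g)‖⁻¹ * t) •
            nrm (L₂.starProjection (L₁.starProjection g)))

variable {L₁ L₂ : Submodule ℝ E} {H : E → E → ℝ≥0∞}

theorem measurable_swapIntegrand {α : Type*} [MeasurableSpace α] {f g : α → E}
    (hH : Measurable (Function.uncurry H)) (hf : Measurable f) (hg : Measurable g) :
    Measurable fun x => swapIntegrand L₁ H (f x) (g x) := by
  have m1 := measurable_starProjection L₁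
  have h : Measurable fun x => H (nrm (f x)) (nrm (g x)) :=
    hH.comp (by fun_prop : Measurable fun x => (nrm (f x), nrm (g x)))
  unfold swapIntegrand
  fun_prop

theorem measurable_sliceIntegrand {α : Type*} [MeasurableSpace α] {t : α → ℝ} {f g : α → E}
    (hH : Measurable (Function.uncurry H)) (ht : Measurable t) (hf : Measurable f)
    (hg : Measurable g) : Measurable fun x => sliceIntegrand L₁ L₂ H (t x) (f x) (g x) := by
  have m1 := measurable_starProjection L₁
  have m2 := measurable_starProjection L₂
  have m3 := measurable_starProjection_inf L₂ (m1.comp hf) hg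
  have m4 : Measurable fun x => L₂.starProjection (L₁.starProjection (f x)) := by fun_prop
  unfold sliceIntegrand
  refine Measurable.ite (m4 (measurableSet_singleton 0)) measurable_const (Measurable.mul ?_ ?_)
  · exact (measurable_gaussianPDF 0 1).comp (by fun_prop)
  · refine measurable_swapIntegrand hH (by fun_prop) (m3.add ?_)
    fun_prop

theorem lintegral_eq_mul_lintegral_comp_mul {c : ℝ} (hc : 0 < c) {G : ℝ → ℝ≥0∞}
    (hG : Measurable G) :
    ENNReal.ofReal c * ∫⁻ s, G s = ∫⁻ t, G (c⁻¹ * t) := by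
  conv_lhs => rw [← Real.smul_map_volume_mul_left (inv_ne_zero hc.ne')]
  rw [lintegral_smul_measure, lintegral_map hG (by fun_prop), abs_of_pos (inv_pos.2 hc), smul_eq_mul,
    ← mul_assoc, ← ENNReal.ofReal_mul hc.le, mul_inv_cancel₀ hc.ne', ENNReal.ofReal_one, one_mul]

/-- For fixed `g`, put y = P_{L₁}g and a = P_{L₂}y. Then P_{L₂}h is a Gaussian part orthogonal to y
plus an independent s times the direction of a, and its inner product with y is s‖a‖. The
substitution t = s‖a‖ consumes the weight ‖a‖, so the slice at t has no singular factor left. -/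
theorem lintegral_slice (hH : Measurable (Function.uncurry H)) {f : ℝ → ℝ≥0∞}
    (hf : Measurable f) :
    ∫⁻ g, ∫⁻ h, ENNReal.ofReal ‖L₂.starProjection (L₁.starProjection g)‖ *
        (swapIntegrand L₁ H (L₁.starProjection g) (L₂.starProjection h) *
          f ⟪L₁.starProjection g, L₂.starProjection h⟫_ℝ) ∂(stdGaussian E) ∂(stdGaussian E) =
      ∫⁻ t, f t * ∫⁻ p : E × E, sliceIntegrand L₁ L₂ H t p.1 p.2
        ∂((stdGaussian E).prod (stdGaussian E)) := by
  have hm : ∀ t : ℝ, Measurable fun p : E × E => sliceIntegrand L₁ L₂ H t p.1 p.2 :=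
    fun t => measurable_sliceIntegrand hH measurable_const measurable_fst measurable_snd
  have hR : ∫⁻ t, f t * ∫⁻ p : E × E, sliceIntegrand L₁ L₂ H t p.1 p.2
        ∂((stdGaussian E).prod (stdGaussian E)) =
      ∫⁻ g, ∫⁻ h, (∫⁻ t, f t * sliceIntegrand L₁ L₂ H t g h)
        ∂(stdGaussian E) ∂(stdGaussian E) := by
    have : ∀ t, f t * ∫⁻ p : E × E, sliceIntegrand L₁ L₂ H t p.1 p.2
        ∂((stdGaussian E).prod (stdGaussian E)) = ∫⁻ p : E × E, f t *
          sliceIntegrand L₁ L₂ H t p.1 p.2 ∂((stdGaussian E).prod (stdGaussian E)) := fun t =>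
      (lintegral_const_mul _ (hm t)).symm
    simp_rw [this]
    rw [lintegral_lintegral_swap (f := fun (t : ℝ) (p : E × E) => f t *
      sliceIntegrand L₁ L₂ H t p.1 p.2) ((hf.comp measurable_fst).mul
      (measurable_sliceIntegrand hH measurable_fst (by fun_prop) (by fun_prop))).aemeasurable]
    rw [lintegral_prod]
    refine Measurable.aemeasurable ?_
    refine Measurable.lintegral_prod_right ?_
    exact (hf.comp measurable_snd).mul
      (measurable_sliceIntegrand hH measurable_snd (by fun_prop) (by fun_prop))
  rw [hR]
  refine lintegral_congr fun g => ?_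
  set y := L₁.starProjection g with hy
  set a := L₂.starProjection y with ha
  by_cases ha0 : a = 0
  · simp [sliceIntegrand, ← hy, ← ha, ha0]
  have hapos : 0 < ‖a‖ := norm_pos_iff.2 ha0
  have hψ : Measurable fun z => swapIntegrand L₁ H y z :=
    measurable_swapIntegrand hH measurable_const measurable_id
  have hF : Measurable fun z => swapIntegrand L₁ H y z * f ⟪y, z⟫_ℝ := by fun_prop
  rw [lintegral_const_mul' _ _ ENNReal.ofReal_ne_top,
    lintegral_starProjection_eq_lintegral_lintegral (L₂.starProjection_apply_mem y) ha0 hF]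
  simp_rw [ha, starProjection_inf_orthogonal_starProjection, ← ha]
  rw [← lintegral_const_mul' _ _ ENNReal.ofReal_ne_top]
  refine lintegral_congr fun h => ?_
  have hF2 : Measurable fun s : ℝ =>
      swapIntegrand L₁ H y ((L₂ ⊓ (Submodule.span ℝ {y})ᗮ).starProjection h + s • nrm a) *
        f ⟪y, (L₂ ⊓ (Submodule.span ℝ {y})ᗮ).starProjection h + s • nrm a⟫_ℝ :=
    hF.comp (by fun_prop : Measurable fun s : ℝ =>
      (L₂ ⊓ (Submodule.span ℝ {y})ᗮ).starProjection h + s • nrm a)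
  rw [gaussianReal_of_var_ne_zero 0 one_ne_zero,
    lintegral_withDensity_eq_lintegral_mul _ (measurable_gaussianPDF 0 1)
      hF2,
    lintegral_eq_mul_lintegral_comp_mul hapos]
  · refine lintegral_congr fun t => ?_
    have e : ⟪y, (L₂ ⊓ (Submodule.span ℝ {y})ᗮ).starProjection h + (‖a‖⁻¹ * t) • nrm a⟫_ℝ = t := by
      have h1 := ((L₂ ⊓ (Submodule.span ℝ {y})ᗮ).starProjection_apply_mem h).2
      rw [SetLike.mem_coe, Submodule.mem_orthogonal_singleton_iff_inner_right] at h1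
      have h2 : ⟪y, a⟫_ℝ = ‖a‖ ^ 2 := inner_starProjection_self L₂ y
      rw [inner_add_right, h1, nrm, smul_smul, inner_smul_right, h2]
      field_simp
      ring
    simp only [Pi.mul_apply, sliceIntegrand, ← hy, ← ha, if_neg ha0, e]
    ring
  · exact (measurable_gaussianPDF 0 1).mul hF2

/-- In a slice the coordinate s = t/‖a‖ is unbounded as a approaches 0. The Gaussian density absorbs
its linear growth, which gives a majorant independent of t. -/
theorem gaussianPDF_mul_le (s b : ℝ) (hb : 0 ≤ b) :
    gaussianPDF 0 1 s * ENNReal.ofReal (b + |s|) ≤ ENNReal.ofReal b + 1 := by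
  have h1 : gaussianPDFReal 0 1 s ≤ Real.exp (-(s ^ 2 / 2)) := by
    rw [gaussianPDFReal]
    have : (Real.sqrt (2 * Real.pi * (1 : NNReal)))⁻¹ ≤ 1 := by
      apply inv_le_one_of_one_le₀
      rw [Real.one_le_sqrt]
      have := Real.pi_gt_three
      push_cast; linarith
    calc _ ≤ 1 * Real.exp (-(s - 0) ^ 2 / (2 * (1 : NNReal))) := by gcongr
      _ = _ := by
        rw [one_mul]; congr 1; push_cast; ring
  have h2 : Real.exp (-(s ^ 2 / 2)) * (b + |s|) ≤ b + 1 := by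
    have h3 : Real.exp (-(s ^ 2 / 2)) ≤ 1 := Real.exp_le_one_iff.2 (by nlinarith [sq_nonneg s])
    have h4 : |s| ≤ Real.exp (s ^ 2 / 2) := by
      have := Real.add_one_le_exp (s ^ 2 / 2)
      nlinarith [sq_nonneg (|s| - 1), sq_abs s]
    have h5 : Real.exp (-(s ^ 2 / 2)) * |s| ≤ 1 := by
      rw [Real.exp_neg]
      rw [inv_mul_le_iff₀ (Real.exp_pos _)]
      simpa using h4
    nlinarith
  rw [gaussianPDF, ← ENNReal.ofReal_mul (gaussianPDFReal_nonneg _ _ _), ← ENNReal.ofReal_one,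
    ← ENNReal.ofReal_add hb zero_le_one]
  refine ENNReal.ofReal_le_ofReal (le_trans ?_ h2)
  gcongr

theorem norm_starProjection_add_smul_nrm_le (L M : Submodule ℝ E) (h a : E) (s : ℝ) :
    ‖L.starProjection (M.starProjection h + s • nrm a)‖ ≤ ‖h‖ + |s| := by
  refine (L.norm_starProjection_apply_le _).trans ((norm_add_le _ _).trans ?_)
  refine add_le_add (M.norm_starProjection_apply_le _) ?_
  rw [norm_smul, Real.norm_eq_abs]
  refine mul_le_of_le_one_right (abs_nonneg _) ?_
  by_cases ha : a = 0
  · simp [ha, nrm]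
  · exact (norm_nrm ha).le

/-- The direction of z is discontinuous at z = 0, but wherever P_{L₁}z vanishes the norm factor
tends to 0 while `H` stays bounded. Elsewhere z ≠ 0 and everything is continuous. -/
theorem continuousAt_swapIntegrand {C : NNReal} (hC : ∀ x y, H x y ≤ C)
    (hH : Continuous (Function.uncurry H)) (y z : E) :
    ContinuousAt (swapIntegrand L₁ H y) z := by
  have hcont : Continuous fun z => ENNReal.ofReal ‖L₁.starProjection z‖ :=
    ENNReal.continuous_ofReal.comp (by fun_prop)
  by_cases hz : L₁.starProjection z = 0
  · have h0 : swapIntegrand L₁ H y z = 0 := by simp [swapIntegrand, hz]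
    rw [ContinuousAt, h0]
    refine tendsto_of_tendsto_of_tendsto_of_le_of_le tendsto_const_nhds
      (h := fun z => ENNReal.ofReal ‖L₁.starProjection z‖ * (C : ℝ≥0∞)) ?_
      (fun _ => zero_le) (fun w => mul_le_mul_right (hC _ _) _)
    have := (ENNReal.Tendsto.mul_const (b := (C : ℝ≥0∞)) (hcont.tendsto z)
      (Or.inr ENNReal.coe_ne_top))
    simpa [hz] using this
  · have hz0 : z ≠ 0 := by rintro rfl; simp at hz
    refine ENNReal.Tendsto.mul (hcont.tendsto z) (Or.inl (by simpa using hz)) ?_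
      (Or.inr ENNReal.ofReal_ne_top)
    have : ContinuousAt (fun z => (nrm y, nrm z)) z :=
      continuousAt_const.prodMk (continuousAt_nrm hz0)
    exact (hH.continuousAt).comp this

theorem lintegral_norm_stdGaussian_lt_top :
    ∫⁻ g, ENNReal.ofReal ‖g‖ ∂(stdGaussian E) < ∞ :=
  (IsGaussian.integrable_id (μ := stdGaussian E)).norm.lintegral_lt_top

theorem continuousAt_lintegral_slice {C : NNReal} (hC : ∀ x y, H x y ≤ C)
    (hH : Continuous (Function.uncurry H)) :
    ContinuousAt (fun t => ∫⁻ p : E × E, sliceIntegrand L₁ L₂ H t p.1 p.2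
      ∂((stdGaussian E).prod (stdGaussian E))) 0 := by
  refine tendsto_lintegral_filter_of_dominated_convergence
    (fun p : E × E => (ENNReal.ofReal ‖p.2‖ + 1) * C) ?_ ?_ ?_ ?_
  · exact Filter.Eventually.of_forall fun t =>
      measurable_sliceIntegrand hH.measurable measurable_const measurable_fst measurable_snd
  · refine Filter.Eventually.of_forall fun t => ae_of_all _ fun p => ?_
    unfold sliceIntegrand
    split_ifs
    · exact zero_le
    · rw [swapIntegrand, ← mul_assoc]
      refine mul_le_mul' (le_trans (mul_le_mul_right (ENNReal.ofReal_le_ofReal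
        (norm_starProjection_add_smul_nrm_le _ _ _ _ _)) _)
        (gaussianPDF_mul_le _ _ (norm_nonneg p.2))) (hC _ _)
  · rw [lintegral_mul_const _ (by fun_prop), lintegral_prod _ (by fun_prop)]
    simp only [lintegral_const, measure_univ, mul_one]
    rw [lintegral_add_right _ measurable_const]
    simp only [lintegral_const, measure_univ, mul_one]
    exact ENNReal.mul_ne_top (ENNReal.add_ne_top.2
      ⟨lintegral_norm_stdGaussian_lt_top.ne, ENNReal.one_ne_top⟩) ENNReal.coe_ne_top
  · refine ae_of_all _ fun p => ?_
    unfold sliceIntegrand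
    split_ifs with h
    · exact tendsto_const_nhds
    · refine ENNReal.Tendsto.mul ?_ (Or.inr ?_) ?_ (Or.inr ?_)
      · refine Continuous.tendsto ?_ _
        unfold gaussianPDF gaussianPDFReal
        exact ENNReal.continuous_ofReal.comp (by fun_prop)
      · exact ENNReal.mul_ne_top ENNReal.ofReal_ne_top
          (ne_top_of_le_ne_top ENNReal.coe_ne_top (hC _ _))
      · refine (continuousAt_swapIntegrand hC hH _ _).comp (f := fun t : ℝ => _ + _ • _) ?_
        fun_prop
      · exact ENNReal.ofReal_ne_top

-- The slices at t = 0 of the two disintegrations. Equality holds for almost every t by Fubini, and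
-- continuity at 0 brings it to the null set of orthogonal pairs.
open scoped Classical in
theorem lintegral_swap_gaussian {C : NNReal} (hC : ∀ x y, H x y ≤ C)
    (hH : Continuous (Function.uncurry H)) :
    ∫⁻ g, ∫⁻ h, (if L₂.starProjection (L₁.starProjection g) = 0 then 0 else
        swapIntegrand L₁ H (L₁.starProjection g)
          ((L₂ ⊓ (Submodule.span ℝ {L₁.starProjection g})ᗮ).starProjection h))
        ∂(stdGaussian E) ∂(stdGaussian E) =
      ∫⁻ h, ∫⁻ g, (if L₁.starProjection (L₂.starProjection h) = 0 then 0 else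
        swapIntegrand L₂ (fun x y => H y x) (L₂.starProjection h)
          ((L₁ ⊓ (Submodule.span ℝ {L₂.starProjection h})ᗮ).starProjection g))
        ∂(stdGaussian E) ∂(stdGaussian E) := by
  have hH' : Continuous (Function.uncurry fun x y => H y x) := hH.comp continuous_swap
  have c1 := continuousAt_lintegral_slice (L₁ := L₁) (L₂ := L₂) hC hH
  have c2 := continuousAt_lintegral_slice (L₁ := L₂) (L₂ := L₁) (fun x y => hC y x) hH'
  set J := fun t => ∫⁻ p : E × E, sliceIntegrand L₁ L₂ H t p.1 p.2
    ∂((stdGaussian E).prod (stdGaussian E)) with hJ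
  set J' := fun t => ∫⁻ p : E × E, sliceIntegrand L₂ L₁ (fun x y => H y x) t p.1 p.2
    ∂((stdGaussian E).prod (stdGaussian E)) with hJ'
  have hJm : Measurable J := Measurable.lintegral_prod_right
    (measurable_sliceIntegrand hH.measurable measurable_fst (by fun_prop) (by fun_prop))
  have hJm' : Measurable J' := Measurable.lintegral_prod_right
    (measurable_sliceIntegrand hH'.measurable measurable_fst (by fun_prop) (by fun_prop))
  have hae : J =ᵐ[volume] J' := by
    refine ae_eq_of_forall_setLIntegral_eq_of_sigmaFinite hJm hJm' fun s hs _ => ?_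
    have e1 := lintegral_slice (L₁ := L₁) (L₂ := L₂) hH.measurable
      (measurable_one.indicator hs)
    have e2 := lintegral_slice (L₁ := L₂) (L₂ := L₁) hH'.measurable
      (measurable_one.indicator hs)
    have key : ∀ (K : ℝ → ℝ≥0∞), ∫⁻ t in s, K t = ∫⁻ t, s.indicator 1 t * K t := by
      intro K
      rw [← lintegral_indicator hs]
      refine lintegral_congr fun t => ?_
      by_cases ht : t ∈ s <;> simp [ht]
    rw [key, key]
    -- The weight ‖P_{L₂}Y‖‖P_{L₁}Z‖ is the same for both disintegrations, so only the order of
    -- integration differs.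
    refine e1.symm.trans (Eq.trans ?_ e2)
    rw [lintegral_lintegral_swap]
    · refine lintegral_congr fun h => lintegral_congr fun g => ?_
      simp only [swapIntegrand]
      rw [real_inner_comm]
      ring
    · refine Measurable.aemeasurable ?_
      have m1 := measurable_starProjection L₁
      have m2 := measurable_starProjection L₂
      have m3 := measurable_swapIntegrand (L₁ := L₁) hH.measurable
        (m1.comp measurable_fst) (m2.comp (measurable_snd (α := E) (β := E)))
      have m4 := (measurable_one.indicator hs : Measurable (s.indicator (1 : ℝ → ℝ≥0∞)))
      have m5 := m4.comp (by fun_prop : Measurable fun p : E × E =>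
        ⟪L₁.starProjection p.1, L₂.starProjection p.2⟫_ℝ)
      exact (by fun_prop : Measurable fun p : E × E =>
        ENNReal.ofReal ‖L₂.starProjection (L₁.starProjection p.1)‖).mul (m3.mul m5)
  have h0 : J 0 = J' 0 := by
    -- A difference at 0 would persist in a neighborhood, but a set of full measure is dense.
    by_contra hne
    have hev : ∀ᶠ t in nhds (0 : ℝ), J t ≠ J' t :=
      (c1.tendsto.prodMk_nhds c2.tendsto).eventually
        (isClosed_diagonal.isOpen_compl.mem_nhds (by simpa using hne))
    have hd : Dense {t | J t = J' t} := Measure.dense_of_ae hae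
    obtain ⟨t, ht1, ht2⟩ := (hev.and_frequently
      (mem_closure_iff_frequently.1 (hd.closure_eq ▸ mem_univ (0 : ℝ)))).exists
    exact ht1 ht2
  have hp0 : gaussianPDF 0 1 (0 : ℝ) ≠ 0 := by
    simpa [gaussianPDF] using gaussianPDFReal_pos 0 1 0 one_ne_zero
  have hp1 : gaussianPDF 0 1 (0 : ℝ) ≠ ∞ := ENNReal.ofReal_ne_top
  have final : ∀ (L₁ L₂ : Submodule ℝ E) (H : E → E → ℝ≥0∞),
      Measurable (Function.uncurry H) →
      ∫⁻ p : E × E, sliceIntegrand L₁ L₂ H 0 p.1 p.2 ∂((stdGaussian E).prod (stdGaussian E)) =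
      gaussianPDF 0 1 (0 : ℝ) *
        ∫⁻ g, ∫⁻ h, (if L₂.starProjection (L₁.starProjection g) = 0 then 0 else
        swapIntegrand L₁ H (L₁.starProjection g)
          ((L₂ ⊓ (Submodule.span ℝ {L₁.starProjection g})ᗮ).starProjection h))
        ∂(stdGaussian E) ∂(stdGaussian E) := by
    intro L₁ L₂ H hH
    have e : ∀ g h, sliceIntegrand L₁ L₂ H 0 g h = gaussianPDF 0 1 (0 : ℝ) *
        (if L₂.starProjection (L₁.starProjection g) = 0 then 0 else
        swapIntegrand L₁ H (L₁.starProjection g)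
          ((L₂ ⊓ (Submodule.span ℝ {L₁.starProjection g})ᗮ).starProjection h)) := by
      intro g h
      simp [sliceIntegrand]
    rw [lintegral_prod _ (measurable_sliceIntegrand hH measurable_const measurable_fst
      measurable_snd).aemeasurable]
    simp_rw [e]
    simp_rw [lintegral_const_mul' _ _ hp1]
  have := (final L₁ L₂ H hH.measurable).symm.trans
    (h0.trans (final L₂ L₁ _ hH'.measurable))
  exact (ENNReal.mul_right_inj hp0 hp1).1 this

end Swap

theorem measurable_map_of_uncurry {α β γ : Type*} [MeasurableSpace α] [MeasurableSpace β]
    [MeasurableSpace γ] {μ : Measure β} [SFinite μ] {f : α → β → γ}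
    (hf : Measurable (Function.uncurry f)) : Measurable fun a => μ.map (f a) := by
  refine Measure.measurable_of_measurable_coe _ fun s hs => ?_
  have : ∀ a, μ.map (f a) s = μ (Prod.mk a ⁻¹' (Function.uncurry f ⁻¹' s)) := fun a => by
    have hfa : Measurable (f a) := hf.comp measurable_prodMk_left
    rw [Measure.map_apply hfa hs]
    rfl
  simp_rw [this]
  exact measurable_measure_prodMk_left (hf hs)

/-! ### Pairs of orthogonal random unit vectors and the density of the swap. -/

section PairLaw

variable {d : ℕ} {L M : Submodule ℝ (Vec d)}

theorem finrank_inf_orthogonal_singleton {x : Vec d} {k : ℕ} (hL : finrank ℝ L = k + 1)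
    (hx : L.starProjection x ≠ 0) :
    finrank ℝ (L ⊓ (Submodule.span ℝ {x})ᗮ : Submodule ℝ (Vec d)) = k := by
  have h := Submodule.finrank_add_inf_finrank_orthogonal
    (K₁ := Submodule.span ℝ {L.starProjection x}) (K₂ := L)
    ((Submodule.span_singleton_le_iff_mem _ _).2 (L.starProjection_apply_mem x))
  rw [finrank_span_singleton hx, inf_comm, inf_orthogonal_starProjection] at h
  omega

theorem inf_orthogonal_singleton_ne_bot (x : Vec d) (hL : 2 ≤ finrank ℝ L) :
    L ⊓ (Submodule.span ℝ {x})ᗮ ≠ ⊥ := by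
  obtain ⟨k, hk⟩ := Nat.exists_eq_add_of_le' (le_trans one_le_two hL)
  intro h
  by_cases hx : L.starProjection x = 0
  · rw [← inf_orthogonal_starProjection, hx] at h
    simp only [Submodule.span_zero_singleton, Submodule.bot_orthogonal_eq_top, inf_top_eq] at h
    rw [h, finrank_bot] at hL
    omega
  · have := finrank_inf_orthogonal_singleton hk hx
    rw [h, finrank_bot] at this
    omega

theorem ne_bot_of_two_le_finrank (hL : 2 ≤ finrank ℝ L) : L ≠ ⊥ := by
  rintro rfl
  rw [finrank_bot] at hL
  omega

theorem lintegral_pairLaw (hM : 2 ≤ finrank ℝ M)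
    {F : Vec d × Vec d → ℝ≥0∞} (hF : Measurable F) :
    ∫⁻ q, F q ∂(pairLaw L M) = ∫⁻ x, ∫⁻ y, F (x, y)
      ∂(uniformSphere (M ⊓ (Submodule.span ℝ {x})ᗮ)) ∂(uniformSphere L) := by
  have hk : Measurable fun x : Vec d =>
      (uniformSphere (M ⊓ (Submodule.span ℝ {x})ᗮ)).map (fun y => (x, y)) := by
    -- The kernel is measurable because it is the image of one Gaussian measure under a jointly
    -- measurable map.
    have e : (fun x : Vec d => (uniformSphere (M ⊓ (Submodule.span ℝ {x})ᗮ)).map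
        (fun y => (x, y))) = fun x => (stdGaussian (Vec d)).map
        (fun g => (x, nrm ((M ⊓ (Submodule.span ℝ {x})ᗮ).starProjection g))) := by
      funext x
      rw [uniformSphere_eq_map (inf_orthogonal_singleton_ne_bot x hM),
        Measure.map_map (by fun_prop) (by fun_prop)]
      rfl
    rw [e]
    refine measurable_map_of_uncurry (measurable_fst.prodMk (measurable_nrm.comp ?_))
    exact measurable_starProjection_inf M measurable_fst measurable_snd
  rw [pairLaw, Measure.lintegral_bind hk.aemeasurable hF.aemeasurable]
  refine lintegral_congr fun x => ?_
  rw [lintegral_map hF (by fun_prop)]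

theorem lintegral_uniformSphere_inf (hM : 2 ≤ finrank ℝ M) (x : Vec d)
    {F : Vec d → ℝ≥0∞} (hF : Measurable F) :
    ∫⁻ y, F y ∂(uniformSphere (M ⊓ (Submodule.span ℝ {x})ᗮ)) =
      ∫⁻ g, F (nrm ((M ⊓ (Submodule.span ℝ {x})ᗮ).starProjection g)) ∂(stdGaussian (Vec d)) :=
  lintegral_uniformSphere_eq (inf_orthogonal_singleton_ne_bot x hM) hF

theorem isProbabilityMeasure_uniformSphere (hL : L ≠ ⊥) :
    IsProbabilityMeasure (uniformSphere L) := by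
  rw [uniformSphere_eq_map hL]
  exact Measure.isProbabilityMeasure_map (by fun_prop)

theorem isProbabilityMeasure_pairLaw (hL : L ≠ ⊥) (hM : 2 ≤ finrank ℝ M) :
    IsProbabilityMeasure (pairLaw L M) := by
  have := isProbabilityMeasure_uniformSphere hL
  have h : ∀ x : Vec d, IsProbabilityMeasure (uniformSphere (M ⊓ (Submodule.span ℝ {x})ᗮ)) :=
    fun x => isProbabilityMeasure_uniformSphere (inf_orthogonal_singleton_ne_bot x hM)
  have := lintegral_pairLaw (L := L) hM (F := fun _ => 1) measurable_const
  exact ⟨by simpa using this⟩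

open scoped Classical in
/-- The part of the law of a pair where the projection of the first vector does not vanish,
weighted by the length of the projection of the second one. -/
theorem lintegral_pairLaw_mul_norm {k : ℕ} (hL : L ≠ ⊥) (hM : finrank ℝ M = k + 2)
    {H : Vec d → Vec d → ℝ≥0∞} (hH : Measurable (Function.uncurry H)) :
    ENNReal.ofReal (sphereArea (k + 1)) *
      ∫⁻ g, ∫⁻ h, (if M.starProjection (L.starProjection g) = 0 then 0 else
        swapIntegrand L H (L.starProjection g)
          ((M ⊓ (Submodule.span ℝ {L.starProjection g})ᗮ).starProjection h))
        ∂(stdGaussian (Vec d)) ∂(stdGaussian (Vec d)) =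
    ENNReal.ofReal (Real.sqrt (2 * Real.pi)) * (ENNReal.ofReal (sphereArea k) *
      ∫⁻ q, (if M.starProjection q.1 = 0 then 0 else
        ENNReal.ofReal ‖L.starProjection q.2‖ * H q.1 q.2) ∂(pairLaw L M)) := by
  have m1 := measurable_starProjection L
  have m2 := measurable_starProjection M
  have hM2 : 2 ≤ finrank ℝ M := by omega
  have hmeas : Measurable fun q : Vec d × Vec d => (if M.starProjection q.1 = 0 then 0 else
        ENNReal.ofReal ‖L.starProjection q.2‖ * H q.1 q.2) := by
    refine Measurable.ite ((by fun_prop : Measurable fun q : Vec d × Vec d =>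
      M.starProjection q.1) (measurableSet_singleton 0)) measurable_const (Measurable.mul ?_ hH)
    fun_prop
  rw [lintegral_pairLaw hM2 hmeas]
  set Θ : Vec d → ℝ≥0∞ := fun x => ∫⁻ y, (if M.starProjection x = 0 then 0 else
        ENNReal.ofReal ‖L.starProjection y‖ * H x y)
    ∂(uniformSphere (M ⊓ (Submodule.span ℝ {x})ᗮ)) with hΘ
  have hΘm : Measurable Θ := by
    have e : Θ = fun x => ∫⁻ g, (fun q : Vec d × Vec d => if M.starProjection q.1 = 0 then 0 else
        ENNReal.ofReal ‖L.starProjection q.2‖ * H q.1 q.2)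
          (x, nrm ((M ⊓ (Submodule.span ℝ {x})ᗮ).starProjection g)) ∂(stdGaussian (Vec d)) := by
      funext x
      exact lintegral_uniformSphere_inf hM2 x
        (hmeas.comp (by fun_prop : Measurable fun y : Vec d => (x, y)))
    rw [e]
    refine Measurable.lintegral_prod_right ?_
    exact hmeas.comp (measurable_fst.prodMk (measurable_nrm.comp
      (measurable_starProjection_inf M measurable_fst measurable_snd)))
  rw [show (∫⁻ x, ∫⁻ y, (if M.starProjection x = 0 then 0 else
        ENNReal.ofReal ‖L.starProjection y‖ * H x y)
    ∂(uniformSphere (M ⊓ (Submodule.span ℝ {x})ᗮ)) ∂(uniformSphere L)) =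
    ∫⁻ x, Θ x ∂(uniformSphere L) from rfl, lintegral_uniformSphere_eq hL hΘm, ← mul_assoc,
    ← lintegral_const_mul' _ _ ENNReal.ofReal_ne_top, ← lintegral_const_mul' _ _
      (ENNReal.mul_ne_top ENNReal.ofReal_ne_top ENNReal.ofReal_ne_top)]
  refine lintegral_congr fun g => ?_
  set y := L.starProjection g
  by_cases hy : M.starProjection y = 0
  · have hy' : M.starProjection (nrm y) = 0 := by rw [nrm, map_smul, hy, smul_zero]
    simp [hΘ, hy, hy']
  · have hy0 : y ≠ 0 := by rintro h; simp [h] at hy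
    have hy' : M.starProjection (nrm y) ≠ 0 := by
      rw [nrm, map_smul, smul_ne_zero_iff]
      exact ⟨inv_ne_zero (norm_ne_zero_iff.2 hy0), hy⟩
    have hspan : (Submodule.span ℝ {nrm y}) = Submodule.span ℝ {y} := by
      rw [nrm, Submodule.span_singleton_smul_eq (IsUnit.mk0 _ (inv_ne_zero (norm_ne_zero_iff.2 hy0)))]
    simp only [hΘ, if_neg hy, if_neg hy', hspan]
    set N := M ⊓ (Submodule.span ℝ {y})ᗮ with hN
    have hN0 : N ≠ ⊥ := inf_orthogonal_singleton_ne_bot y hM2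
    have hfin : finrank ℝ N = k + 1 := finrank_inf_orthogonal_singleton hM hy
    have hHy : Measurable fun x => H (nrm y) x :=
      hH.comp (by fun_prop : Measurable fun x : Vec d => (nrm y, x))
    -- Direction and norm of the projection to `N` are independent. The weight is homogeneous of
    -- degree one in the norm, so the norm contributes its mean, which is a ratio of sphere areas.
    have e := lintegral_starProjection_nrm_mul hN0
      (f := fun x => ENNReal.ofReal ‖L.starProjection x‖ * H (nrm y) x)
      (φ := fun r => ENNReal.ofReal r) (by fun_prop) (by fun_prop)
    have e2 : ∀ h, swapIntegrand L H y (N.starProjection h) =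
        ENNReal.ofReal ‖L.starProjection (nrm (N.starProjection h))‖ *
          H (nrm y) (nrm (N.starProjection h)) * ENNReal.ofReal ‖N.starProjection h‖ := by
      intro h
      have : ‖L.starProjection (N.starProjection h)‖ =
          ‖N.starProjection h‖ * ‖L.starProjection (nrm (N.starProjection h))‖ := by
        conv_lhs => rw [← norm_smul_nrm (N.starProjection h)]
        rw [map_smul, norm_smul, norm_norm]
      rw [swapIntegrand, this, ENNReal.ofReal_mul (norm_nonneg _)]
      ring
    refine (congrArg (_ * ·) (lintegral_congr e2)).trans ?_
    rw [e, mul_comm, mul_assoc, lintegral_norm_starProjection hfin, mul_comm]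

-- Both sides of `lintegral_swap_gaussian` are rewritten by `lintegral_pairLaw_mul_norm`; the factor
-- √(2π) occurs on both and is cancelled.
open scoped Classical in
theorem lintegral_pairLaw_swap {L₁ L₂ : Submodule ℝ (Vec d)} {k₁ k₂ : ℕ}
    (h₁ : finrank ℝ L₁ = k₁ + 2) (h₂ : finrank ℝ L₂ = k₂ + 2)
    {H : Vec d → Vec d → ℝ≥0∞} {C : NNReal} (hC : ∀ x y, H x y ≤ C)
    (hH : Continuous (Function.uncurry H)) :
    ENNReal.ofReal (sphereArea k₂ * sphereArea (k₁ + 1)) *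
      ∫⁻ q, (if L₂.starProjection q.1 = 0 then 0 else
        ENNReal.ofReal ‖L₁.starProjection q.2‖ * H q.1 q.2) ∂(pairLaw L₁ L₂) =
    ENNReal.ofReal (sphereArea k₁ * sphereArea (k₂ + 1)) *
      ∫⁻ q, (if L₁.starProjection q.1 = 0 then 0 else
        ENNReal.ofReal ‖L₂.starProjection q.2‖ * H q.2 q.1) ∂(pairLaw L₂ L₁) := by
  have hH' : Continuous (Function.uncurry fun x y => H y x) := hH.comp continuous_swap
  have e1 := lintegral_pairLaw_mul_norm (ne_bot_of_two_le_finrank (by omega : 2 ≤ finrank ℝ L₁)) h₂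
    hH.measurable
  have e2 := lintegral_pairLaw_mul_norm (ne_bot_of_two_le_finrank (by omega : 2 ≤ finrank ℝ L₂)) h₁
    hH'.measurable
  have e3 := lintegral_swap_gaussian (L₁ := L₁) (L₂ := L₂) hC hH
  set I := ∫⁻ h, ∫⁻ g, (if L₁.starProjection (L₂.starProjection h) = 0 then 0 else
        swapIntegrand L₂ (fun x y => H y x) (L₂.starProjection h)
          ((L₁ ⊓ (Submodule.span ℝ {L₂.starProjection h})ᗮ).starProjection g))
        ∂(stdGaussian (Vec d)) ∂(stdGaussian (Vec d))
  set X := ∫⁻ q, (if L₂.starProjection q.1 = 0 then 0 else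
        ENNReal.ofReal ‖L₁.starProjection q.2‖ * H q.1 q.2) ∂(pairLaw L₁ L₂)
  set Y := ∫⁻ q, (if L₁.starProjection q.1 = 0 then 0 else
        ENNReal.ofReal ‖L₂.starProjection q.2‖ * H q.2 q.1) ∂(pairLaw L₂ L₁)
  have hs0 : ENNReal.ofReal (Real.sqrt (2 * Real.pi)) ≠ 0 := by
    simp [Real.pi_pos]
  rw [ENNReal.ofReal_mul (sphereArea_pos _).le, ENNReal.ofReal_mul (sphereArea_pos _).le]
  refine (ENNReal.mul_right_inj hs0 ENNReal.ofReal_ne_top).1 ?_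
  calc _ = ENNReal.ofReal (sphereArea (k₁ + 1)) * (ENNReal.ofReal (Real.sqrt (2 * Real.pi)) *
        (ENNReal.ofReal (sphereArea k₂) * X)) := by ring
    _ = ENNReal.ofReal (sphereArea (k₂ + 1)) *
        (ENNReal.ofReal (sphereArea (k₁ + 1)) * I) := by
      rw [← e1, mul_left_comm]
      congr 2
      convert e3
    _ = _ := by rw [e2]; ring

theorem isClosed_submodule (L : Submodule ℝ (Vec d)) : IsClosed (L : Set (Vec d)) :=
  L.closed_of_finiteDimensional

theorem measurableSet_swapDomain (L₁ L₂ : Submodule ℝ (Vec d)) :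
    MeasurableSet (swapDomain L₁ L₂) := by
  have m1 : Measurable fun q : Vec d × Vec d => L₂.starProjection q.1 :=
    (measurable_starProjection L₂).comp measurable_fst
  have m2 : Measurable fun q : Vec d × Vec d => L₁.starProjection q.2 :=
    (measurable_starProjection L₁).comp measurable_snd
  have m3 : Measurable fun q : Vec d × Vec d => ⟪q.1, q.2⟫_ℝ := by fun_prop
  exact (measurable_fst (isClosed_submodule L₁).measurableSet).inter
    ((measurable_snd (isClosed_submodule L₂).measurableSet).inter
    ((m3 (measurableSet_singleton 0)).inter
    ((m1 (measurableSet_singleton 0)).compl.inter (m2 (measurableSet_singleton 0)).compl)))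

/-- The density of the swap. -/
def swapRatio (L₁ L₂ : Submodule ℝ (Vec d)) (q : Vec d × Vec d) : ℝ :=
  (sphereArea (finrank ℝ L₁ - 1) * sphereArea (finrank ℝ L₂ - 2)) /
    (sphereArea (finrank ℝ L₂ - 1) * sphereArea (finrank ℝ L₁ - 2)) *
    (‖L₁.starProjection q.2‖ / ‖L₂.starProjection q.1‖)

theorem measurable_swapRatio (L₁ L₂ : Submodule ℝ (Vec d)) : Measurable (swapRatio L₁ L₂) := by
  have m1 := measurable_starProjection L₁
  have m2 := measurable_starProjection L₂
  unfold swapRatio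
  fun_prop

theorem swapRatio_pos {L₁ L₂ : Submodule ℝ (Vec d)} {q : Vec d × Vec d}
    (hq : q ∈ swapDomain L₁ L₂) : 0 < swapRatio L₁ L₂ q := by
  have h1 := norm_pos_iff.2 hq.2.2.2.1
  have h2 := norm_pos_iff.2 hq.2.2.2.2
  exact mul_pos (div_pos (mul_pos (sphereArea_pos _) (sphereArea_pos _))
    (mul_pos (sphereArea_pos _) (sphereArea_pos _))) (div_pos h2 h1)

-- The identity for bounded continuous test functions says that the two laws, weighted by `w₁` and
-- `w₂`, are the same finite measure. On the swap domain `w₂` is positive and finite, so it can be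
-- divided out, and the density is `w₁ / w₂`.
open scoped Classical in
theorem pairLaw_swap_eq_withDensity {L₁ L₂ : Submodule ℝ (Vec d)} (h₁ : 2 ≤ finrank ℝ L₁)
    (h₂ : 2 ≤ finrank ℝ L₂) :
    ((pairLaw L₂ L₁).map Prod.swap).restrict (swapDomain L₁ L₂) =
      ((pairLaw L₁ L₂).restrict (swapDomain L₁ L₂)).withDensity
        (fun q => ENNReal.ofReal (swapRatio L₁ L₂ q)) := by
  have m1 := measurable_starProjection L₁
  have m2 := measurable_starProjection L₂
  have hD := measurableSet_swapDomain L₁ L₂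
  obtain ⟨k₁, hk₁⟩ := Nat.exists_eq_add_of_le' h₁
  obtain ⟨k₂, hk₂⟩ := Nat.exists_eq_add_of_le' h₂
  have := isProbabilityMeasure_pairLaw (ne_bot_of_two_le_finrank h₁) h₂
  have := isProbabilityMeasure_pairLaw (ne_bot_of_two_le_finrank h₂) h₁
  set c₁ := ENNReal.ofReal (sphereArea k₂ * sphereArea (k₁ + 1)) with hc₁
  set c₂ := ENNReal.ofReal (sphereArea k₁ * sphereArea (k₂ + 1)) with hc₂
  set w₁ : Vec d × Vec d → ℝ≥0∞ := fun q => c₁ * (if L₂.starProjection q.1 = 0 then 0 else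
    ENNReal.ofReal ‖L₁.starProjection q.2‖) with hw₁
  set w₂ : Vec d × Vec d → ℝ≥0∞ := fun q => c₂ * (if L₁.starProjection q.2 = 0 then 0 else
    ENNReal.ofReal ‖L₂.starProjection q.1‖) with hw₂
  have hw₁m : Measurable w₁ := by
    refine measurable_const.mul (Measurable.ite ((by fun_prop : Measurable
      fun q : Vec d × Vec d => L₂.starProjection q.1) (measurableSet_singleton 0))
      measurable_const ?_)
    fun_prop
  have hw₂m : Measurable w₂ := by
    refine measurable_const.mul (Measurable.ite ((by fun_prop : Measurable
      fun q : Vec d × Vec d => L₁.starProjection q.2) (measurableSet_singleton 0))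
      measurable_const ?_)
    fun_prop
  have main : (pairLaw L₁ L₂).withDensity w₁ =
      ((pairLaw L₂ L₁).map Prod.swap).withDensity w₂ := by
    -- The second vector has norm at most 1, so `w₁` is bounded by `c₁`.
    have hfin : IsFiniteMeasure ((pairLaw L₁ L₂).withDensity w₁) := by
      refine isFiniteMeasure_withDensity ?_
      have h2 : ∫⁻ q, w₁ q ∂(pairLaw L₁ L₂) ≤ ∫⁻ q, c₁ ∂(pairLaw L₁ L₂) := by
        rw [lintegral_pairLaw h₂ hw₁m,
          lintegral_pairLaw h₂ measurable_const]
        refine lintegral_mono fun x => ?_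
        have hw₁x : Measurable fun y => w₁ (x, y) :=
          hw₁m.comp (by fun_prop : Measurable fun y : Vec d => (x, y))
        rw [lintegral_uniformSphere_inf h₂ x hw₁x,
          lintegral_uniformSphere_inf h₂ x measurable_const]
        refine lintegral_mono fun g => ?_
        refine mul_le_of_le_one_right' ?_
        split_ifs
        · exact zero_le
        · rw [ENNReal.ofReal_le_one]
          refine (L₁.norm_starProjection_apply_le _).trans ?_
          set z := (L₂ ⊓ (Submodule.span ℝ {x})ᗮ).starProjection g
          by_cases hz : z = 0
          · simp [hz, nrm]
          · exact (norm_nrm hz).le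
      refine ne_top_of_le_ne_top ?_ h2
      simp [hc₁]
    refine ext_of_forall_lintegral_eq_of_IsFiniteMeasure fun f => ?_
    have hfm : Measurable fun q => (f q : ℝ≥0∞) :=
      (ENNReal.continuous_coe.comp f.continuous).measurable
    rw [lintegral_withDensity_eq_lintegral_mul _ hw₁m hfm,
      lintegral_withDensity_eq_lintegral_mul _ hw₂m hfm,
      lintegral_map (hw₂m.mul hfm) measurable_swap]
    have := lintegral_pairLaw_swap hk₁ hk₂ (H := fun x y => (f (x, y) : ℝ≥0∞))
      (C := nndist f 0)
      (fun x y => ENNReal.coe_le_coe.2 (BoundedContinuousFunction.NNReal.upper_bound f _))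
      (ENNReal.continuous_coe.comp (f.continuous.comp (by fun_prop)))
    rw [← lintegral_const_mul' _ _ ENNReal.ofReal_ne_top,
      ← lintegral_const_mul' _ _ ENNReal.ofReal_ne_top] at this
    refine Eq.trans (lintegral_congr fun q => ?_) (this.trans (lintegral_congr fun q => ?_))
    · simp only [hw₁, Pi.mul_apply]
      split_ifs <;> simp [mul_assoc, hc₁]
    · simp only [hw₂, Pi.mul_apply, Prod.swap]
      split_ifs <;> simp [mul_assoc, hc₂]
  ext s hs
  rw [Measure.restrict_apply hs, withDensity_apply _ hs, Measure.restrict_restrict hs]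
  have hc₂0 : c₂ ≠ 0 := by
    simp [hc₂, mul_pos (sphereArea_pos k₁) (sphereArea_pos (k₂ + 1))]
  have hpos : ∀ q ∈ swapDomain L₁ L₂, w₂ q ≠ 0 ∧ w₂ q ≠ ∞ := by
    intro q hq
    simp only [hw₂, if_neg hq.2.2.2.2]
    refine ⟨mul_ne_zero hc₂0 ?_, ENNReal.mul_ne_top ENNReal.ofReal_ne_top ENNReal.ofReal_ne_top⟩
    simpa using hq.2.2.2.1
  have hsD := hs.inter hD
  have hw₂i : Measurable fun q => (w₂ q)⁻¹ := hw₂m.inv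
  have e1 : ((pairLaw L₂ L₁).map Prod.swap) (s ∩ swapDomain L₁ L₂) =
      ∫⁻ q in s ∩ swapDomain L₁ L₂, (w₂ q)⁻¹
        ∂(((pairLaw L₂ L₁).map Prod.swap).withDensity w₂) := by
    rw [setLIntegral_withDensity_eq_setLIntegral_mul _ hw₂m hw₂i hsD, ← setLIntegral_one]
    refine setLIntegral_congr_fun hsD fun q hq => ?_
    simp only [Pi.mul_apply]
    rw [ENNReal.mul_inv_cancel (hpos q hq.2).1 (hpos q hq.2).2]
  rw [e1, ← main, setLIntegral_withDensity_eq_setLIntegral_mul _ hw₁m hw₂i hsD]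
  refine setLIntegral_congr_fun hsD fun q hq => ?_
  simp only [Pi.mul_apply, hw₁, hw₂, if_neg hq.2.2.2.2.1, if_neg hq.2.2.2.2.2, hc₁, hc₂]
  have n1 := norm_pos_iff.2 hq.2.2.2.2.1
  have n2 := norm_pos_iff.2 hq.2.2.2.2.2
  have a1 := sphereArea_pos k₁
  have a2 := sphereArea_pos k₂
  have a3 := sphereArea_pos (k₁ + 1)
  have a4 := sphereArea_pos (k₂ + 1)
  rw [← ENNReal.ofReal_mul (by positivity), ← ENNReal.ofReal_mul (by positivity),
    ← ENNReal.ofReal_inv_of_pos (by positivity), ← ENNReal.ofReal_mul (by positivity)]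
  congr 1
  rw [swapRatio, hk₁, hk₂, show k₁ + 2 - 1 = k₁ + 1 from rfl, show k₂ + 2 - 1 = k₂ + 1 from rfl,
    Nat.add_sub_cancel, Nat.add_sub_cancel]
  field_simp

theorem pairLaw_swap_absolutelyContinuous {L₁ L₂ : Submodule ℝ (Vec d)} (h₁ : 2 ≤ finrank ℝ L₁)
    (h₂ : 2 ≤ finrank ℝ L₂) :
    (pairLaw L₁ L₂).restrict (swapDomain L₁ L₂) ≪
      ((pairLaw L₂ L₁).map Prod.swap).restrict (swapDomain L₁ L₂) := by
  rw [pairLaw_swap_eq_withDensity h₁ h₂]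
  refine withDensity_absolutelyContinuous'
    (measurable_swapRatio L₁ L₂).ennreal_ofReal.aemeasurable ?_
  filter_upwards [ae_restrict_mem (measurableSet_swapDomain L₁ L₂)] with q hq
  simpa using swapRatio_pos hq

end PairLaw

/-! ### Sparse graphs -/

theorem IsSparse.card_add_card_le {V : Type*} {d : ℕ} {G : SimpleGraph V} (hG : IsSparse d G)
    {A B : Finset V} (hA : A.Nonempty) (hB : B.Nonempty)
    (h : ∀ a ∈ A, ∀ b ∈ B, G.Adj a b) : A.card + B.card ≤ d := by
  by_contra! hlt
  refine hG _ _ hA.card_pos hB.card_pos hlt ⟨⟨⟨Sum.elim (fun i => (A.equivFin.symm i : V))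
    (fun i => (B.equivFin.symm i : V)), ?_⟩, ?_⟩⟩
  · rintro (i | i) (j | j) hij
    · simp at hij
    · exact h _ (Subtype.mem _) _ (Subtype.mem _)
    · exact (h _ (Subtype.mem _) _ (Subtype.mem _)).symm
    · simp at hij
  · have hne : ∀ i j, (A.equivFin.symm i : V) ≠ (B.equivFin.symm j : V) := fun i j =>
      (h _ (Subtype.mem _) _ (Subtype.mem _)).ne
    rintro (i | i) (j | j) hij
    · simpa using hij
    · exact absurd hij (hne _ _)
    · exact absurd hij.symm (hne _ _)
    · simpa using hij

/-- The case of stars. Earlier neighbors never span the whole space, so the next unit vector can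
always be chosen. Much of the argument uses sparsity only in this form, as the hypothesis `hdeg`. -/
theorem IsSparse.card_lt {V : Type*} {d : ℕ} {G : SimpleGraph V} (hG : IsSparse d G) (hd : 0 < d)
    {v : V} {N : Finset V} (h : ∀ w ∈ N, G.Adj v w) : N.card < d := by
  rcases N.eq_empty_or_nonempty with rfl | hN
  · simpa using hd
  · have := hG.card_add_card_le (A := {v}) (B := N) (Finset.singleton_nonempty v) hN
      (by simpa using h)
    rw [Finset.card_singleton] at this
    omega

theorem IsSparse.comap {V W : Type*} {d : ℕ} {G : SimpleGraph V} (hG : IsSparse d G)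
    (f : W ↪ V) : IsSparse d (G.comap f) := by
  intro a b ha hb hab h
  exact hG a b ha hb hab (h.trans ⟨(SimpleGraph.Embedding.comap f G).toCopy⟩)

/-! ### The sequential choice as an iterated Gaussian integral -/

section Sequential

variable {V : Type*} [Finite V] {d : ℕ} (G : SimpleGraph V)

/-- The neighbors of `v` in `P`. -/
def nbrs (P : Set V) (v : V) : Finset V := (Set.toFinite {w | G.Adj v w ∧ w ∈ P}).toFinset

variable {G} in
@[simp] theorem mem_nbrs {P : Set V} {v w : V} : w ∈ nbrs G P v ↔ G.Adj v w ∧ w ∈ P := by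
  simp [nbrs]

theorem nbrs_subset (P : Set V) (v : V) : (nbrs G P v : Set V) ⊆ P := fun _ h =>
  (mem_nbrs.1 h).2

/-- A unit vector orthogonal to the vectors at `N`, uniformly random if `g` is Gaussian. -/
def pick (x : V → Vec d) (N : Finset V) (g : Vec d) : Vec d :=
  nrm ((Submodule.span ℝ (x '' (N : Set V)))ᗮ.starProjection g)

theorem pick_congr {x y : V → Vec d} {N : Finset V} (h : ∀ v ∈ N, x v = y v) (g : Vec d) :
    pick x N g = pick y N g := by
  have e : x '' (N : Set V) = y '' (N : Set V) := Set.image_congr h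
  simp only [pick, e]

open scoped Classical in
theorem orthogonal_span_insert (x : V → Vec d) (N : Finset V) (v : V) :
    (Submodule.span ℝ (x '' (insert v N : Finset V)))ᗮ =
      (Submodule.span ℝ (x '' (N : Set V)))ᗮ ⊓ (Submodule.span ℝ {x v})ᗮ := by
  rw [Finset.coe_insert, Set.image_insert_eq, Submodule.span_insert, inf_comm,
    Submodule.inf_orthogonal]

open scoped Classical in
theorem starProjection_orthogonal_span_insert (x : V → Vec d) (N : Finset V) (v : V) (g : Vec d) :
    (Submodule.span ℝ (x '' (insert v N : Finset V)))ᗮ.starProjection g =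
      ((Submodule.span ℝ (x '' (N : Set V)))ᗮ ⊓
        (Submodule.span ℝ {x v})ᗮ).starProjection g := by
  congr! 2
  exact orthogonal_span_insert x N v

/-- The rank of the span may vary with `a`, so no fixed basis is available. Adding one vector at a
time works, because the Gram–Schmidt formula remains valid for dependent vectors. -/
theorem measurable_starProjection_orthogonal_span {α : Type*} [MeasurableSpace α]
    {x : α → V → Vec d} (hx : Measurable x) (N : Finset V) {g : α → Vec d} (hg : Measurable g) :
    Measurable fun a => (Submodule.span ℝ (x a '' (N : Set V)))ᗮ.starProjection (g a) := by
  classical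
  induction N using Finset.induction_on generalizing g with
  | empty =>
    convert hg using 2 with a
    exact Submodule.starProjection_eq_self_iff.2 (by simp)
  | insert v N _ ih =>
    simp_rw [starProjection_orthogonal_span_insert, starProjection_inf_orthogonal_singleton]
    have h1 := ih hg
    have h2 := ih ((measurable_pi_apply v).comp hx)
    exact h1.sub (((h2.inner hg).div (h2.norm.pow_const 2)).smul h2)

theorem measurable_pick {α : Type*} [MeasurableSpace α] {x : α → V → Vec d} (hx : Measurable x)
    (N : Finset V) {g : α → Vec d} (hg : Measurable g) :
    Measurable fun a => pick (x a) N (g a) :=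
  measurable_nrm.comp (measurable_starProjection_orthogonal_span hx N hg)

open scoped Classical in
/-- The result of a random choice at the node `v`. -/
def choose (x : V → Vec d) (N : Finset V) (v : V) (g : Vec d) : V → Vec d :=
  Function.update x v (pick x N g)

theorem choose_self (x : V → Vec d) (N : Finset V) (v : V) (g : Vec d) :
    choose x N v g v = pick x N g := by simp [choose]

theorem choose_of_ne (x : V → Vec d) (N : Finset V) {v w : V} (h : w ≠ v) (g : Vec d) :
    choose x N v g w = x w := by simp [choose, h]

theorem measurable_choose {α : Type*} [MeasurableSpace α] {x : α → V → Vec d} (hx : Measurable x)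
    (N : Finset V) (v : V) {g : α → Vec d} (hg : Measurable g) :
    Measurable fun a => choose (x a) N v (g a) := by
  rw [measurable_pi_iff]
  intro w
  by_cases h : w = v
  · subst h
    simp_rw [choose_self]
    exact measurable_pick hx N hg
  · simp_rw [choose_of_ne _ _ h]
    exact (measurable_pi_apply w).comp hx

theorem measurable_choose_right (x : V → Vec d) (N : Finset V) (v : V) :
    Measurable (choose x N v) :=
  measurable_choose measurable_const _ _ measurable_id

/-- The iterated integral of `F` over the choices at the nodes in the list (processed from its
head), given `x` on `P`, where the choice at a node with earlier neighbors `N` has weight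
`s x N`. -/
def seqInt (s : (V → Vec d) → Finset V → ℝ≥0∞) :
    Set V → List V → ((V → Vec d) → ℝ≥0∞) → (V → Vec d) → ℝ≥0∞
  | _, [], F, x => F x
  | P, v :: l, F, x => s x (nbrs G P v) *
      ∫⁻ g, seqInt s (insert v P) l F (choose x (nbrs G P v) v g) ∂(stdGaussian (Vec d))

/-- A weight function which depends measurably on the values at `N` only. -/
structure IsWeight (s : (V → Vec d) → Finset V → ℝ≥0∞) : Prop where
  measurable : ∀ N, Measurable fun x => s x N
  congr : ∀ x y N, (∀ v ∈ N, x v = y v) → s x N = s y N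

theorem isWeight_one : IsWeight (fun (_ : V → Vec d) _ => 1) :=
  ⟨fun _ => measurable_const, fun _ _ _ _ => rfl⟩

variable {G} {s : (V → Vec d) → Finset V → ℝ≥0∞}

theorem measurable_seqInt (hs : IsWeight s) {F : (V → Vec d) → ℝ≥0∞} (hF : Measurable F)
    (P : Set V) (l : List V) : Measurable (seqInt G s P l F) := by
  induction l generalizing P with
  | nil => exact hF
  | cons v l ih =>
    refine (hs.measurable _).mul (Measurable.lintegral_prod_right ?_)
    exact (ih _).comp (measurable_choose measurable_fst _ _ measurable_snd)

theorem measurable_seqInt_choose (hs : IsWeight s) {F : (V → Vec d) → ℝ≥0∞} (hF : Measurable F)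
    (P : Set V) (l : List V) (x : V → Vec d) (N : Finset V) (v : V) :
    Measurable fun g => seqInt G s P l F (choose x N v g) :=
  (measurable_seqInt hs hF P l).comp (measurable_choose measurable_const _ _ measurable_id)

theorem seqInt_append (P : Set V) (l₁ l₂ : List V) (F : (V → Vec d) → ℝ≥0∞) :
    seqInt G s P (l₁ ++ l₂) F = seqInt G s P l₁ (seqInt G s (P ∪ {v | v ∈ l₁}) l₂ F) := by
  induction l₁ generalizing P with
  | nil => funext x; simp [seqInt]
  | cons v l ih =>
    funext x
    have : insert v P ∪ {w | w ∈ l} = P ∪ {w | w ∈ v :: l} := by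
      ext w; simp; tauto
    simp only [List.cons_append, seqInt, ih, this]

/-- The integrals agree if the integrands agree wherever the process can lead from `x`. -/
theorem seqInt_congr_fun {P : Set V} {l : List V} {F F' : (V → Vec d) → ℝ≥0∞} {x : V → Vec d}
    (h : ∀ y, (∀ v, v ∉ l → y v = x v) → F y = F' y) :
    seqInt G s P l F x = seqInt G s P l F' x := by
  induction l generalizing P x with
  | nil => exact h x fun _ _ => rfl
  | cons v l ih =>
    simp only [seqInt]
    congr 1
    refine lintegral_congr fun g => ih fun y hy => h y fun w hw => ?_
    rw [List.mem_cons, not_or] at hw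
    rw [hy w hw.2, choose_of_ne _ _ hw.1]

theorem seqInt_const_mul (hs : IsWeight s) {P : Set V} {l : List V} {F : (V → Vec d) → ℝ≥0∞}
    (hF : Measurable F) (c : ℝ≥0∞) (x : V → Vec d) :
    seqInt G s P l (fun y => c * F y) x = c * seqInt G s P l F x := by
  induction l generalizing P x with
  | nil => rfl
  | cons v l ih =>
    simp only [seqInt, ih]
    rw [lintegral_const_mul _ (measurable_seqInt_choose hs hF _ _ _ _ _), mul_left_comm]

theorem seqInt_mul_left (hs : IsWeight s) {P : Set V} {l : List V}
    {F K : (V → Vec d) → ℝ≥0∞} (hF : Measurable F) {x : V → Vec d}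
    (hK : ∀ y, (∀ v, v ∉ l → y v = x v) → K y = K x) :
    seqInt G s P l (fun y => K y * F y) x = K x * seqInt G s P l F x := by
  rw [← seqInt_const_mul hs hF]
  exact seqInt_congr_fun fun y hy => by rw [hK y hy]

theorem seqInt_one_of_const {P : Set V} {l : List V} {F : (V → Vec d) → ℝ≥0∞} {x : V → Vec d}
    (h : ∀ y, (∀ v, v ∉ l → y v = x v) → F y = F x) :
    seqInt G (fun _ _ => 1) P l F x = F x := by
  rw [seqInt_congr_fun (F' := fun _ => F x) h]
  clear h
  generalize F x = c
  induction l generalizing P x with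
  | nil => rfl
  | cons v l ih => simp [seqInt, ih]

variable (G) in
/-- The product of the weights of the choices at the nodes in the list. -/
def seqWeight (s : (V → Vec d) → Finset V → ℝ≥0∞) : Set V → List V → (V → Vec d) → ℝ≥0∞
  | _, [], _ => 1
  | P, v :: l, x => s x (nbrs G P v) * seqWeight s (insert v P) l x

theorem measurable_seqWeight (hs : IsWeight s) (P : Set V) (l : List V) :
    Measurable (seqWeight G s P l) := by
  induction l generalizing P with
  | nil => exact measurable_const
  | cons v l ih => exact (hs.measurable _).mul (ih _)

/-- The weight of the choice at v depends only on nodes in `P` at that stage. Later choices leave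
these values unchanged, so the weight can be carried inside all later integrals and collected into
one density. -/
theorem seqInt_eq_seqInt_one (hs : IsWeight s) {P : Set V} {l : List V} (hl : l.Nodup)
    (hP : ∀ v ∈ l, v ∉ P) {F : (V → Vec d) → ℝ≥0∞} (hF : Measurable F) (x : V → Vec d) :
    seqInt G s P l F x =
      seqInt G (fun _ _ => 1) P l (fun y => seqWeight G s P l y * F y) x := by
  induction l generalizing P x with
  | nil => simp [seqInt, seqWeight]
  | cons v l ih =>
    rw [List.nodup_cons] at hl
    have hP' : ∀ w ∈ l, w ∉ insert v P := by
      rintro w hw (rfl | hwP)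
      · exact hl.1 hw
      · exact hP w (List.mem_cons_of_mem _ hw) hwP
    have hm : Measurable fun y => seqWeight G s (insert v P) l y * F y :=
      (measurable_seqWeight hs _ _).mul hF
    simp only [seqInt, seqWeight, one_mul, ih hl.2 hP']
    rw [← lintegral_const_mul _ (measurable_seqInt_choose isWeight_one hm _ _ _ _ _)]
    refine lintegral_congr fun g => ?_
    rw [← seqInt_const_mul isWeight_one hm]
    refine seqInt_congr_fun fun y hy => ?_
    rw [mul_assoc]
    congr 1
    refine hs.congr _ _ _ fun w hw => ?_
    have hwP := (mem_nbrs.1 hw).2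
    have hwv : w ≠ v := by
      rintro rfl
      exact (mem_nbrs.1 hw).1.ne rfl
    rw [hy w fun hwl => hP w (List.mem_cons_of_mem _ hwl) hwP, choose_of_ne _ _ hwv]

variable (G) in
/-- The law of the result of the sequential random choices. -/
def seqMeasure : Set V → List V → (V → Vec d) → Measure (V → Vec d)
  | _, [], x => Measure.dirac x
  | P, v :: l, x => ((stdGaussian (Vec d)).map (choose x (nbrs G P v) v)).bind
      (seqMeasure (insert v P) l)

theorem measurable_map_choose (N : Finset V) (v : V) :
    Measurable fun x : V → Vec d => (stdGaussian (Vec d)).map (choose x N v) :=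
  measurable_map_of_uncurry (measurable_choose measurable_fst _ _ measurable_snd)

theorem measurable_seqMeasure (P : Set V) (l : List V) :
    Measurable (seqMeasure G P l : (V → Vec d) → Measure (V → Vec d)) := by
  induction l generalizing P with
  | nil => exact Measure.measurable_dirac
  | cons v l ih => exact (Measure.measurable_bind' (ih _)).comp (measurable_map_choose _ _)

theorem lintegral_seqMeasure {P : Set V} {l : List V} {F : (V → Vec d) → ℝ≥0∞}
    (hF : Measurable F) (x : V → Vec d) :
    ∫⁻ y, F y ∂(seqMeasure G P l x) = seqInt G (fun _ _ => 1) P l F x := by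
  induction l generalizing P x with
  | nil => exact lintegral_dirac' _ hF
  | cons v l ih =>
    rw [seqMeasure, Measure.lintegral_bind (measurable_seqMeasure _ _).aemeasurable
      hF.aemeasurable]
    simp_rw [ih]
    rw [lintegral_map (measurable_seqInt isWeight_one hF _ _)
      (measurable_choose_right _ _ _), seqInt, one_mul]

instance isProbabilityMeasure_seqMeasure (P : Set V) (l : List V) (x : V → Vec d) :
    IsProbabilityMeasure (seqMeasure G P l x) := by
  refine ⟨?_⟩
  have := lintegral_seqMeasure (G := G) (P := P) (l := l) (F := fun _ => 1) measurable_const x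
  rw [seqInt_one_of_const fun _ _ => rfl] at this
  simpa using this

end Sequential

/-! ### Gram determinants -/

/-- The Schur complement of the Gram matrix of `w` is the squared distance of `y` from the span: the
coordinates `c` of the projection of `y` solve the normal equations. -/
theorem det_gram_sumElim {n : Type*} [Fintype n] [DecidableEq n] {d : ℕ} {w : n → Vec d}
    (hw : LinearIndependent ℝ w) (y : Vec d) :
    (Matrix.gram ℝ (Sum.elim w fun _ : Unit => y)).det =
      (Matrix.gram ℝ w).det * ‖(Submodule.span ℝ (range w))ᗮ.starProjection y‖ ^ 2 := by
  set K := Submodule.span ℝ (range w) with hK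
  have hdet : IsUnit (Matrix.gram ℝ w).det :=
    isUnit_iff_ne_zero.2 (Matrix.det_gram_ne_zero_iff_linearIndependent.2 hw)
  let _ := Matrix.invertibleOfIsUnitDet _ hdet
  have hb : Matrix.gram ℝ (Sum.elim w fun _ : Unit => y) =
      Matrix.fromBlocks (Matrix.gram ℝ w) (Matrix.of fun i _ => ⟪w i, y⟫_ℝ)
        (Matrix.of fun _ j => ⟪y, w j⟫_ℝ) (Matrix.of fun _ _ => ⟪y, y⟫_ℝ) := by
    ext (i | i) (j | j) <;> rfl
  rw [hb, Matrix.det_fromBlocks₁₁]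
  congr 1
  rw [Matrix.det_unique]
  obtain ⟨c, hc⟩ := (Submodule.mem_span_range_iff_exists_fun ℝ).1 (K.starProjection_apply_mem y)
  have hGc : (Matrix.gram ℝ w).mulVec c = fun i => ⟪w i, y⟫_ℝ := by
    funext i
    have h1 : ⟪w i, y⟫_ℝ = ⟪w i, K.starProjection y⟫_ℝ := by
      rw [← Submodule.inner_starProjection_left_eq_right,
        Submodule.starProjection_eq_self_iff.2 (Submodule.subset_span (mem_range_self i))]
    rw [h1, ← hc, inner_sum]
    simp only [Matrix.mulVec, dotProduct, Matrix.gram_apply, inner_smul_right]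
    exact Finset.sum_congr rfl fun j _ => mul_comm _ _
  have hinv : (⅟(Matrix.gram ℝ w)).mulVec (fun i => ⟪w i, y⟫_ℝ) = c := by
    rw [← hGc, Matrix.mulVec_mulVec, invOf_mul_self, Matrix.one_mulVec]
  have hmul : (Matrix.of (fun (_ : Unit) j => ⟪y, w j⟫_ℝ) * ⅟(Matrix.gram ℝ w) *
      Matrix.of fun i (_ : Unit) => ⟪w i, y⟫_ℝ) default default = ‖K.starProjection y‖ ^ 2 := by
    rw [Matrix.mul_assoc, Matrix.mul_apply]
    have : ∀ j, (⅟(Matrix.gram ℝ w) * Matrix.of fun i (_ : Unit) => ⟪w i, y⟫_ℝ) j default =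
        c j := fun j => by
      rw [← hinv]; rfl
    simp_rw [this, Matrix.of_apply]
    rw [← inner_starProjection_self, ← hc, inner_sum]
    exact Finset.sum_congr rfl fun j _ => by rw [inner_smul_right, mul_comm]
  rw [Matrix.sub_apply, hmul, Matrix.of_apply, real_inner_self_eq_norm_sq,
    Submodule.norm_sq_eq_add_norm_sq_starProjection y K]
  ring

section GenDet

variable {V : Type*} {d : ℕ}

theorem gram_det_nonneg (x : V → Vec d) (N : Finset V) [DecidableEq N] :
    0 ≤ (Matrix.gram ℝ fun i : N => x i).det :=
  (Matrix.posSemidef_gram ℝ _).det_nonneg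

theorem genDet_eq (x : V → Vec d) (N : Finset V) [DecidableEq N] :
    genDet x N = Real.sqrt (Matrix.gram ℝ fun i : N => x i).det := by
  unfold genDet
  congr!

theorem genDet_pos {x : V → Vec d} {N : Finset V} (h : LinearIndepOn ℝ x N) :
    0 < genDet x N := by
  classical
  rw [genDet_eq, Real.sqrt_pos]
  exact lt_of_le_of_ne (gram_det_nonneg x N)
    (Ne.symm (Matrix.det_gram_ne_zero_iff_linearIndependent.2 h))

theorem linearIndepOn_iff_gram_det_ne_zero {x : V → Vec d} {N : Finset V} [DecidableEq N] :
    LinearIndepOn ℝ x (N : Set V) ↔ (Matrix.gram ℝ fun i : N => x i).det ≠ 0 :=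
  (Matrix.det_gram_ne_zero_iff_linearIndependent (v := fun i : N => x i)).symm

theorem continuous_gram_det (N : Finset V) [DecidableEq N] :
    Continuous fun x : V → Vec d => (Matrix.gram ℝ fun i : N => x i).det := by
  refine Continuous.matrix_det ?_
  refine continuous_matrix fun i j => ?_
  simp only [Matrix.gram_apply]
  fun_prop

theorem continuous_genDet (N : Finset V) : Continuous fun x : V → Vec d => genDet x N := by
  classical
  simp_rw [genDet_eq]
  exact (continuous_gram_det N).sqrt

theorem isOpen_linearIndepOn (N : Finset V) :
    IsOpen {x : V → Vec d | LinearIndepOn ℝ x (N : Set V)} := by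
  classical
  simp_rw [linearIndepOn_iff_gram_det_ne_zero]
  exact isOpen_ne_fun (continuous_gram_det N) continuous_const

theorem genDet_congr {x y : V → Vec d} {N : Finset V} (h : ∀ v ∈ N, x v = y v) :
    genDet x N = genDet y N := by
  unfold genDet
  congr 3
  ext i j
  rw [h i i.2, h j j.2]

-- Base times height. This is where the norms of projections in the swap density meet the
-- determinants in the weights.
open scoped Classical in
theorem genDet_insert {x : V → Vec d} {N : Finset V} {u : V} (hu : u ∉ N)
    (h : LinearIndepOn ℝ x N) :
    genDet x (insert u N) =
      genDet x N * ‖(Submodule.span ℝ (x '' (N : Set V)))ᗮ.starProjection (x u)‖ := by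
  have h2 := det_gram_sumElim (w := fun i : N => x i) h (x u)
  set e : N ⊕ Unit ≃ (insert u N : Finset V) :=
    ((Finset.subtypeInsertEquivOption hu).trans (Equiv.optionEquivSumPUnit _)).symm with he
  have h3 : (Matrix.gram ℝ fun i : (insert u N : Finset V) => x i).submatrix e e =
      Matrix.gram ℝ (Sum.elim (fun i : N => x i) fun _ : Unit => x u) := by
    ext (i | i) (j | j) <;> rfl
  have h4 := Matrix.det_submatrix_equiv_self e
    (Matrix.gram ℝ fun i : (insert u N : Finset V) => x i)
  have hr : range (fun i : N => x i) = x '' (N : Set V) := by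
    rw [Set.image_eq_range]; rfl
  rw [genDet_eq, genDet_eq, ← h4, h3, h2, Real.sqrt_mul (gram_det_nonneg x N),
    Real.sqrt_sq (norm_nonneg _)]
  simp only [hr]

theorem finrank_orthogonal_span {x : V → Vec d} {N : Finset V} (h : LinearIndepOn ℝ x N) :
    finrank ℝ (Submodule.span ℝ (x '' (N : Set V)))ᗮ = d - N.card := by
  have h1 := Submodule.finrank_add_finrank_orthogonal (Submodule.span ℝ (x '' (N : Set V)))
  have h2 := finrank_span_eq_card (R := ℝ) (b := fun i : N => x i) h
  have hr : range (fun i : N => x i) = x '' (N : Set V) := by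
    rw [Set.image_eq_range]; rfl
  rw [hr, Fintype.card_coe] at h2
  rw [h2, finrank_euclideanSpace_fin] at h1
  omega

theorem orthogonal_span_ne_bot (x : V → Vec d) {N : Finset V} (h : N.card < d) :
    (Submodule.span ℝ (x '' (N : Set V)))ᗮ ≠ ⊥ := by
  classical
  intro hbot
  have h1 := Submodule.finrank_add_finrank_orthogonal (Submodule.span ℝ (x '' (N : Set V)))
  rw [hbot, finrank_bot, finrank_euclideanSpace_fin, add_zero, ← Finset.coe_image] at h1
  have h2 := (finrank_span_finset_le_card (R := ℝ) (N.image x)).trans Finset.card_image_le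
  exact absurd (h1 ▸ h2) (not_le.2 h)

/-- The weight of a choice. -/
def sWeight (x : V → Vec d) (N : Finset V) : ℝ≥0∞ := ENNReal.ofReal (sDensity x N)

theorem sDensity_pos {x : V → Vec d} {N : Finset V} (h : LinearIndepOn ℝ x N) :
    0 < sDensity x N :=
  mul_pos (div_pos (mul_pos (zpow_pos (sphereArea_pos _) _) (sphereArea_pos _))
    (pow_pos (sphereArea_pos _) _)) (one_div_pos.2 (genDet_pos h))

theorem isWeight_sWeight [Finite V] : IsWeight (sWeight : (V → Vec d) → Finset V → ℝ≥0∞) where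
  measurable N := by
    have := (continuous_genDet (d := d) N).measurable
    unfold sWeight sDensity
    fun_prop
  congr x y N h := by rw [sWeight, sWeight, sDensity, sDensity, genDet_congr h]

end GenDet

theorem measurableSet_linearIndepOn {V : Type*} [Finite V] {d : ℕ} (N : Finset V) :
    MeasurableSet {x : V → Vec d | LinearIndepOn ℝ x (N : Set V)} :=
  (isOpen_linearIndepOn N).measurableSet

/-! ### Independence of the order -/

section Order

variable {V : Type*} [Finite V] {d : ℕ} {G : SimpleGraph V}

/-- `F` vanishes where the nodes of `Q` are not in general position. -/
def IsSupp (Q : Set V) (F : (V → Vec d) → ℝ≥0∞) : Prop :=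
  ∀ x, F x ≠ 0 → ∀ W : Finset V, (W : Set V) ⊆ Q → W.card ≤ d → LinearIndepOn ℝ x W

theorem seqInt_eq_zero {s : (V → Vec d) → Finset V → ℝ≥0∞} {P : Set V} {l : List V}
    {F : (V → Vec d) → ℝ≥0∞} {x : V → Vec d}
    (h : ∀ y, (∀ v, v ∉ l → y v = x v) → F y = 0) : seqInt G s P l F x = 0 := by
  rw [seqInt_congr_fun (F' := fun _ => 0) h]
  clear h
  induction l generalizing P x with
  | nil => rfl
  | cons v l ih => simp [seqInt, ih]

theorem linearIndepOn_congr {x y : V → Vec d} {N : Finset V} (h : ∀ v ∈ N, x v = y v) :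
    LinearIndepOn ℝ x N ↔ LinearIndepOn ℝ y N := by
  have : (fun i : (N : Set V) => x i) = fun i : (N : Set V) => y i :=
    funext fun i => h i i.2
  unfold LinearIndepOn
  rw [this]

theorem IsSupp.seqInt_eq_zero {s : (V → Vec d) → Finset V → ℝ≥0∞} {Q P : Set V} {l : List V}
    {F : (V → Vec d) → ℝ≥0∞} (hF : IsSupp Q F) {x : V → Vec d} {W : Finset V}
    (hW : (W : Set V) ⊆ Q) (hd : W.card ≤ d) (hl : ∀ v ∈ W, v ∉ l)
    (hx : ¬ LinearIndepOn ℝ x W) : seqInt G s P l F x = 0 := by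
  refine OrthoHom.seqInt_eq_zero fun y hy => ?_
  by_contra h0
  exact hx ((linearIndepOn_congr fun v hv => hy v (hl v hv)).1 (hF y h0 W hW hd))

theorem ae_pairLaw {L M : Submodule ℝ (Vec d)} (hL : L ≠ ⊥) (hM : 2 ≤ finrank ℝ M) :
    ∀ᵐ q ∂(pairLaw L M), q.1 ∈ L ∧ q.2 ∈ M ∧ ⟪q.1, q.2⟫_ℝ = 0 := by
  have hS : MeasurableSet {q : Vec d × Vec d | q.1 ∈ L ∧ q.2 ∈ M ∧ ⟪q.1, q.2⟫_ℝ = 0} := by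
    have m3 : Measurable fun q : Vec d × Vec d => ⟪q.1, q.2⟫_ℝ := by fun_prop
    exact (measurable_fst (isClosed_submodule L).measurableSet).inter
      ((measurable_snd (isClosed_submodule M).measurableSet).inter
      (m3 (measurableSet_singleton 0)))
  rw [ae_iff]
  change pairLaw L M {q | q.1 ∈ L ∧ q.2 ∈ M ∧ ⟪q.1, q.2⟫_ℝ = 0}ᶜ = 0
  rw [← lintegral_indicator_one hS.compl]
  have hm := (measurable_one.indicator hS.compl : Measurable
    ({q : Vec d × Vec d | q.1 ∈ L ∧ q.2 ∈ M ∧ ⟪q.1, q.2⟫_ℝ = 0}ᶜ.indicator (1 : Vec d × Vec d → ℝ≥0∞)))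
  refine (lintegral_pairLaw hM hm).trans ?_
  have hLm : ∀ᵐ x ∂(uniformSphere L), x ∈ L := by
    rw [uniformSphere_eq_map hL]
    refine (ae_map_iff (by fun_prop) (isClosed_submodule L).measurableSet).2
      (ae_of_all _ fun g => ?_)
    exact L.smul_mem _ (L.starProjection_apply_mem g)
  rw [lintegral_congr_ae (g := fun _ => 0)]
  · simp
  filter_upwards [hLm] with x hx
  have hmx : Measurable fun y : Vec d =>
      {q : Vec d × Vec d | q.1 ∈ L ∧ q.2 ∈ M ∧ ⟪q.1, q.2⟫_ℝ = 0}ᶜ.indicator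
        (1 : Vec d × Vec d → ℝ≥0∞) (x, y) :=
    hm.comp (by fun_prop : Measurable fun y : Vec d => (x, y))
  rw [lintegral_uniformSphere_inf hM x hmx]
  rw [lintegral_congr (g := fun _ => 0)]
  · simp
  intro g
  have h := (M ⊓ (Submodule.span ℝ {x})ᗮ).smul_mem
    ‖(M ⊓ (Submodule.span ℝ {x})ᗮ).starProjection g‖⁻¹
    ((M ⊓ (Submodule.span ℝ {x})ᗮ).starProjection_apply_mem g)
  have h2 := h.2
  rw [SetLike.mem_coe, Submodule.mem_orthogonal_singleton_iff_inner_right] at h2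
  rw [Set.indicator_of_notMem]
  rw [Set.notMem_compl_iff]
  exact ⟨hx, h.1, h2⟩

end Order

/-! ### Exchanging consecutive nodes in the iterated integral. -/

section Swap

variable {V : Type*} [Finite V] {d : ℕ} {G : SimpleGraph V}

theorem nbrs_insert_of_not_adj {P : Set V} {u v : V} (h : ¬ G.Adj v u) :
    nbrs G (insert u P) v = nbrs G P v := by
  ext w
  simp only [mem_nbrs, Set.mem_insert_iff]
  constructor
  · rintro ⟨h1, rfl | h2⟩
    · exact absurd h1 h
    · exact ⟨h1, h2⟩
  · exact fun h1 => ⟨h1.1, Or.inr h1.2⟩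

open scoped Classical in
theorem nbrs_insert_of_adj {P : Set V} {u v : V} (h : G.Adj v u) :
    nbrs G (insert u P) v = insert u (nbrs G P v) := by
  ext w
  simp only [mem_nbrs, Set.mem_insert_iff, Finset.mem_insert]
  constructor
  · rintro ⟨h1, rfl | h2⟩
    · exact Or.inl rfl
    · exact Or.inr ⟨h1, h2⟩
  · rintro (rfl | h1)
    · exact ⟨h, Or.inl rfl⟩
    · exact ⟨h1.1, Or.inr h1.2⟩

-- Neither node is an earlier neighbor of the other, so the subspaces and the weights do not depend
-- on which is chosen first, and Fubini applies.
open scoped Classical in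
theorem seqInt_swap_of_not_adj {s : (V → Vec d) → Finset V → ℝ≥0∞} (hs : IsWeight s)
    {P : Set V} {u v : V} (l : List V) {F : (V → Vec d) → ℝ≥0∞} (hF : Measurable F)
    (huv : u ≠ v) (h : ¬ G.Adj u v) (hu : u ∉ P) (hv : v ∉ P) (x : V → Vec d) :
    seqInt G s P (u :: v :: l) F x = seqInt G s P (v :: u :: l) F x := by
  simp only [seqInt, nbrs_insert_of_not_adj h, nbrs_insert_of_not_adj fun h' => h h'.symm,
    Set.insert_comm u v P]
  set A := nbrs G P u
  set B := nbrs G P v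
  set K := seqInt G s (insert v (insert u P)) l F
  have hK : Measurable K := measurable_seqInt hs hF _ _
  have hA : ∀ g, ∀ w ∈ A, choose x B v g w = x w := fun g w hw =>
    choose_of_ne _ _ (by rintro rfl; exact hv (mem_nbrs.1 hw).2) _
  have hB : ∀ g, ∀ w ∈ B, choose x A u g w = x w := fun g w hw =>
    choose_of_ne _ _ (by rintro rfl; exact hu (mem_nbrs.1 hw).2) _
  have hcomm : ∀ g g', choose (choose x A u g) B v g' = choose (choose x B v g') A u g := by
    intro g g'
    simp only [choose]
    rw [Function.update_comm huv]
    congr 1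
    · exact congrArg _ (pick_congr (hB g) g')
    · exact (pick_congr (hA g') g).symm
  have m : Measurable fun p : Vec d × Vec d => K (choose (choose x A u p.1) B v p.2) :=
    hK.comp (measurable_choose (measurable_choose measurable_const _ _ measurable_fst) _ _
      measurable_snd)
  have m' : Measurable fun p : Vec d × Vec d => K (choose (choose x B v p.1) A u p.2) :=
    hK.comp (measurable_choose (measurable_choose measurable_const _ _ measurable_fst) _ _
      measurable_snd)
  have e1 : ∀ g, s (choose x A u g) B = s x B := fun g => hs.congr _ _ _ (hB g)
  have e2 : ∀ g, s (choose x B v g) A = s x A := fun g => hs.congr _ _ _ (hA g)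
  simp_rw [e1, e2]
  rw [lintegral_const_mul _ (Measurable.lintegral_prod_right m),
    lintegral_const_mul _ (Measurable.lintegral_prod_right m'),
    lintegral_lintegral_swap m.aemeasurable, mul_left_comm]
  simp_rw [hcomm]

-- Two consecutive adjacent choices form a random pair as in the swap of subspaces, with the
-- orthogonal complements of the earlier neighbors of `u` and of `v` as the two subspaces.
open scoped Classical in
theorem choose_pairs {x : V → Vec d} {A B : Finset V} {u v : V} (hu : u ∉ B)
    (hA : A.card < d) (hB : 2 ≤ finrank ℝ (Submodule.span ℝ (x '' (B : Set V)))ᗮ)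
    {Φ : (V → Vec d) → (V → Vec d) → ℝ≥0∞} (hΦ : Measurable (Function.uncurry Φ)) :
    ∫⁻ g, ∫⁻ h, Φ (choose x A u g) (choose (choose x A u g) (insert u B) v h)
        ∂(stdGaussian (Vec d)) ∂(stdGaussian (Vec d)) =
      ∫⁻ q, Φ (Function.update x u q.1) (Function.update (Function.update x u q.1) v q.2)
        ∂(pairLaw (Submodule.span ℝ (x '' (A : Set V)))ᗮ
          (Submodule.span ℝ (x '' (B : Set V)))ᗮ) := by
  have hupd : Measurable fun q : Vec d × Vec d => (Function.update x u q.1,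
      Function.update (Function.update x u q.1) v q.2) := by
    have h1 : Measurable fun q : Vec d × Vec d => Function.update x u q.1 :=
      (measurable_update x).comp measurable_fst
    exact h1.prodMk (measurable_update'.comp (h1.prodMk measurable_snd))
  have hm := hΦ.comp hupd
  have e : ∀ x₁, (∀ w ∈ B, Function.update x u x₁ w = x w) := fun x₁ w hw => by
    rw [Function.update_of_ne]
    rintro rfl
    exact hu hw
  rw [show (fun q : Vec d × Vec d => Φ (Function.update x u q.1)
    (Function.update (Function.update x u q.1) v q.2)) = Function.uncurry Φ ∘ fun q =>
      (Function.update x u q.1, Function.update (Function.update x u q.1) v q.2) from rfl,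
    lintegral_pairLaw hB hm]
  have hin : ∀ x₁ : Vec d, ∫⁻ y, (Function.uncurry Φ ∘ fun q : Vec d × Vec d =>
      (Function.update x u q.1, Function.update (Function.update x u q.1) v q.2)) (x₁, y)
        ∂(uniformSphere ((Submodule.span ℝ (x '' (B : Set V)))ᗮ ⊓ (Submodule.span ℝ {x₁})ᗮ)) =
      ∫⁻ h, (Function.uncurry Φ ∘ fun q : Vec d × Vec d =>
      (Function.update x u q.1, Function.update (Function.update x u q.1) v q.2))
        (x₁, nrm (((Submodule.span ℝ (x '' (B : Set V)))ᗮ ⊓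
          (Submodule.span ℝ {x₁})ᗮ).starProjection h)) ∂(stdGaussian (Vec d)) := fun x₁ =>
    lintegral_uniformSphere_inf hB x₁ (hm.comp measurable_prodMk_left)
  simp_rw [hin]
  rw [lintegral_uniformSphere_eq (orthogonal_span_ne_bot x hA)]
  · refine lintegral_congr fun g => lintegral_congr fun h => ?_
    simp only [Function.comp_apply, Function.uncurry]
    have hp : pick (choose x A u g) (insert u B) h =
        nrm (((Submodule.span ℝ (x '' (B : Set V)))ᗮ ⊓
          (Submodule.span ℝ {nrm ((Submodule.span ℝ (x '' (A : Set V)))ᗮ.starProjection g)})ᗮ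
          ).starProjection h) := by
      have e' : choose x A u g '' (B : Set V) = x '' (B : Set V) := Set.image_congr (e _)
      rw [pick, starProjection_orthogonal_span_insert, choose_self]
      simp only [e', pick]
    simp only [choose] at hp ⊢
    rw [hp]
    rfl
  · refine Measurable.lintegral_prod_right ?_
    exact hm.comp (measurable_fst.prodMk (measurable_nrm.comp
      (measurable_starProjection_inf _ measurable_fst measurable_snd)))

/-- The total number of earlier neighbors of the two nodes is n+m+1 in either order, so the powers
of A_{d-1} and A_{d-2} cancel. What remains is the density of the swap in subspaces of dimensions
d-n and d-m. -/
theorem sDensity_swap {n m : ℕ} (hn : n + 2 ≤ d) (hm : m + 2 ≤ d) {p q a b : ℝ}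
    (hp : 0 < p) (hq : 0 < q) (ha : 0 < a) (hb : 0 < b) :
    (sphereArea (d - 1) ^ ((n : ℤ) - 1) * sphereArea (d - n - 1) / sphereArea (d - 2) ^ n *
        (1 / p)) *
      (sphereArea (d - 1) ^ (((m + 1 : ℕ) : ℤ) - 1) * sphereArea (d - (m + 1) - 1) /
        sphereArea (d - 2) ^ (m + 1) * (1 / (q * a))) =
    (sphereArea (d - 1) ^ ((m : ℤ) - 1) * sphereArea (d - m - 1) / sphereArea (d - 2) ^ m *
        (1 / q)) *
      (sphereArea (d - 1) ^ (((n + 1 : ℕ) : ℤ) - 1) * sphereArea (d - (n + 1) - 1) /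
        sphereArea (d - 2) ^ (n + 1) * (1 / (p * b))) *
      ((sphereArea (d - n - 1) * sphereArea (d - m - 2)) /
        (sphereArea (d - m - 1) * sphereArea (d - n - 2)) * (b / a)) := by
  have h0 := sphereArea_pos (d - 1)
  have h1 := sphereArea_pos (d - 2)
  have h2 := sphereArea_pos (d - n - 1)
  have h3 := sphereArea_pos (d - m - 1)
  have h4 := sphereArea_pos (d - n - 2)
  have h5 := sphereArea_pos (d - m - 2)
  rw [show d - (m + 1) - 1 = d - m - 2 by omega, show d - (n + 1) - 1 = d - n - 2 by omega,
    zpow_sub_one₀ h0.ne', zpow_sub_one₀ h0.ne', zpow_sub_one₀ h0.ne', zpow_sub_one₀ h0.ne',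
    zpow_natCast, zpow_natCast, zpow_natCast, zpow_natCast, pow_succ, pow_succ, pow_succ,
    pow_succ]
  field_simp

-- The density of the swap of the two choices is the inverse of the change in the weights. The
-- subspace swap controls only pairs with nonzero projections; for the other pairs the integrand
-- vanishes by `hsupp`.
open scoped Classical in
theorem seqInt_swap_of_adj (hdeg : ∀ (v : V) (N : Finset V), (∀ w ∈ N, G.Adj v w) → N.card < d)
    {Q P : Set V} {u v : V} {l : List V} {F : (V → Vec d) → ℝ≥0∞} (hF : Measurable F)
    (hsupp : IsSupp Q F) (hPQ : P ⊆ Q) (huQ : u ∈ Q) (hvQ : v ∈ Q) (h : G.Adj u v)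
    (hu : u ∉ P) (hv : v ∉ P) (hul : u ∉ l) (hvl : v ∉ l) (hPl : ∀ w ∈ l, w ∉ P)
    (x : V → Vec d) :
    seqInt G sWeight P (u :: v :: l) F x = seqInt G sWeight P (v :: u :: l) F x := by
  have hs := isWeight_sWeight (V := V) (d := d)
  simp only [seqInt, nbrs_insert_of_adj h, nbrs_insert_of_adj h.symm]
  rw [show insert u (insert v P) = insert v (insert u P) from Set.insert_comm _ _ _]
  set A := nbrs G P u with hAdef
  set B := nbrs G P v with hBdef
  set K := seqInt G sWeight (insert v (insert u P)) l F with hKdef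
  have hK : Measurable K := measurable_seqInt hs hF _ _
  have hAP : (A : Set V) ⊆ P := nbrs_subset G P u
  have hBP : (B : Set V) ⊆ P := nbrs_subset G P v
  have huA : u ∉ A := fun h' => hu (hAP h')
  have hvA : v ∉ A := fun h' => hv (hAP h')
  have huB : u ∉ B := fun h' => hu (hBP h')
  have hvB : v ∉ B := fun h' => hv (hBP h')
  have hA' : (insert v A).card < d := hdeg u _ fun w hw => by
    rcases Finset.mem_insert.1 hw with rfl | hw
    · exact h
    · exact (mem_nbrs.1 hw).1
  have hB' : (insert u B).card < d := hdeg v _ fun w hw => by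
    rcases Finset.mem_insert.1 hw with rfl | hw
    · exact h.symm
    · exact (mem_nbrs.1 hw).1
  rw [Finset.card_insert_of_notMem hvA] at hA'
  rw [Finset.card_insert_of_notMem huB] at hB'
  have hK0 : ∀ (y : V → Vec d) (W : Finset V), (W : Set V) ⊆ insert v (insert u P) →
      W.card ≤ d → ¬ LinearIndepOn ℝ y W → K y = 0 := by
    intro y W hW hWd hy
    refine hsupp.seqInt_eq_zero (hW.trans ?_) hWd (fun w hw hwl => ?_) hy
    · exact Set.insert_subset hvQ (Set.insert_subset huQ hPQ)
    · rcases hW hw with rfl | rfl | hwP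
      · exact hvl hwl
      · exact hul hwl
      · exact hPl w hwl hwP
  have hoff : ∀ (N : Finset V), (N : Set V) ⊆ P → N.card ≤ d → ¬ LinearIndepOn ℝ x N →
      ∀ y, (∀ w, w ≠ u → w ≠ v → y w = x w) → K y = 0 := by
    intro N hN hNd hx y hy
    refine hK0 y N (hN.trans ((Set.subset_insert _ _).trans (Set.subset_insert _ _))) hNd
      fun hyN => hx ((linearIndepOn_congr fun w hw => ?_).1 hyN)
    exact hy w (fun e => hu (e ▸ hN hw)) (fun e => hv (e ▸ hN hw))
  -- If the earlier neighbors of `u` or of `v` are already dependent, general position is lost for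
  -- good and both integrals are 0.
  have hzero : (∀ y, (∀ w, w ≠ u → w ≠ v → y w = x w) → K y = 0) →
      (sWeight x A * ∫⁻ g, sWeight (choose x A u g) (insert u B) *
        ∫⁻ g', K (choose (choose x A u g) (insert u B) v g') ∂(stdGaussian (Vec d))
        ∂(stdGaussian (Vec d))) =
      sWeight x B * ∫⁻ g, sWeight (choose x B v g) (insert v A) *
        ∫⁻ g', K (choose (choose x B v g) (insert v A) u g') ∂(stdGaussian (Vec d))
        ∂(stdGaussian (Vec d)) := by
    intro h0
    have z1 : ∀ g g', K (choose (choose x A u g) (insert u B) v g') = 0 := fun g g' =>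
      h0 _ fun w hwu hwv => by rw [choose_of_ne _ _ hwv, choose_of_ne _ _ hwu]
    have z2 : ∀ g g', K (choose (choose x B v g) (insert v A) u g') = 0 := fun g g' =>
      h0 _ fun w hwu hwv => by rw [choose_of_ne _ _ hwu, choose_of_ne _ _ hwv]
    simp [z1, z2]
  by_cases hLA : LinearIndepOn ℝ x (A : Set V)
  swap
  · exact hzero (hoff A hAP (by omega) hLA)
  by_cases hLB : LinearIndepOn ℝ x (B : Set V)
  swap
  · exact hzero (hoff B hBP (by omega) hLB)
  clear hzero hoff
  have fA := finrank_orthogonal_span hLA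
  have fB := finrank_orthogonal_span hLB
  -- `A` together with `v` still has fewer than d nodes, so two dimensions remain; likewise for `B`
  -- together with `u`.
  have fA2 : 2 ≤ finrank ℝ (Submodule.span ℝ (x '' (A : Set V)))ᗮ := by omega
  have fB2 : 2 ≤ finrank ℝ (Submodule.span ℝ (x '' (B : Set V)))ᗮ := by omega
  have mK : ∀ N : Finset V, Measurable (Function.uncurry fun y z : V → Vec d =>
      sWeight y N * K z) := fun N =>
    ((hs.measurable N).comp measurable_fst).mul (hK.comp measurable_snd)
  have i1 := choose_pairs (A := A) (v := v) huB (by omega) fB2 (mK (insert u B))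
  have i2 := choose_pairs (A := B) (v := u) hvA (by omega) fA2 (mK (insert v A))
  have c1 : ∀ g, sWeight (choose x A u g) (insert u B) *
        ∫⁻ g', K (choose (choose x A u g) (insert u B) v g') ∂(stdGaussian (Vec d)) =
      ∫⁻ g', sWeight (choose x A u g) (insert u B) *
        K (choose (choose x A u g) (insert u B) v g') ∂(stdGaussian (Vec d)) := fun g =>
    (lintegral_const_mul' _ _ ENNReal.ofReal_ne_top).symm
  have c2 : ∀ g, sWeight (choose x B v g) (insert v A) *
        ∫⁻ g', K (choose (choose x B v g) (insert v A) u g') ∂(stdGaussian (Vec d)) =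
      ∫⁻ g', sWeight (choose x B v g) (insert v A) *
        K (choose (choose x B v g) (insert v A) u g') ∂(stdGaussian (Vec d)) := fun g =>
    (lintegral_const_mul' _ _ ENNReal.ofReal_ne_top).symm
  simp_rw [c1, c2]
  rw [i1, i2]
  set L₁ := (Submodule.span ℝ (x '' (A : Set V)))ᗮ with hL₁
  set L₂ := (Submodule.span ℝ (x '' (B : Set V)))ᗮ with hL₂
  have huv : u ≠ v := h.ne
  have hcomm : ∀ a b : Vec d, Function.update (Function.update x v b) u a =
      Function.update (Function.update x u a) v b := fun a b => Function.update_comm huv.symm _ _ _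
  have hupd : Measurable fun q : Vec d × Vec d =>
      Function.update (Function.update x u q.1) v q.2 :=
    measurable_update'.comp (((measurable_update x).comp measurable_fst).prodMk measurable_snd)
  have hupd1 : Measurable fun q : Vec d × Vec d => Function.update x u q.1 :=
    (measurable_update x).comp measurable_fst
  have hupd2 : Measurable fun q : Vec d × Vec d => Function.update x v q.2 :=
    (measurable_update x).comp measurable_snd
  set f₁ : Vec d × Vec d → ℝ≥0∞ := fun q => sWeight (Function.update x u q.1) (insert u B) *
    K (Function.update (Function.update x u q.1) v q.2) with hf₁
  set f₂ : Vec d × Vec d → ℝ≥0∞ := fun q => sWeight (Function.update x v q.2) (insert v A) *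
    K (Function.update (Function.update x u q.1) v q.2) with hf₂
  have hf₁m : Measurable f₁ := ((hs.measurable _).comp hupd1).mul (hK.comp hupd)
  have hf₂m : Measurable f₂ := ((hs.measurable _).comp hupd2).mul (hK.comp hupd)
  have hD := measurableSet_swapDomain L₁ L₂
  have hi2 : ∫⁻ q, sWeight (Function.update x v q.1) (insert v A) *
      K (Function.update (Function.update x v q.1) u q.2) ∂(pairLaw L₂ L₁) =
      ∫⁻ q, f₂ q ∂((pairLaw L₂ L₁).map Prod.swap) := by
    rw [lintegral_map hf₂m measurable_swap]
    refine lintegral_congr fun q => ?_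
    simp only [hf₂, Prod.fst_swap, Prod.snd_swap, hcomm]
  rw [hi2]
  -- A vanishing projection means that the vector at `u` lies in the span of `B`, or the vector at
  -- `v` in the span of `A`. Then a set of fewer than d nodes is dependent.
  have hKD : ∀ q : Vec d × Vec d, q.1 ∈ L₁ → q.2 ∈ L₂ → ⟪q.1, q.2⟫_ℝ = 0 →
      q ∉ swapDomain L₁ L₂ → K (Function.update (Function.update x u q.1) v q.2) = 0 := by
    intro q hq1 hq2 hq3 hqD
    have hnot : L₂.starProjection q.1 = 0 ∨ L₁.starProjection q.2 = 0 := by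
      by_contra! hcon
      exact hqD ⟨hq1, hq2, hq3, hcon.1, hcon.2⟩
    rcases hnot with h0 | h0
    · rw [Submodule.starProjection_apply_eq_zero_iff, hL₂, Submodule.orthogonal_orthogonal] at h0
      refine hK0 _ (insert u B) ?_ (by rw [Finset.card_insert_of_notMem huB]; omega) ?_
      · rw [Finset.coe_insert]
        exact (Set.insert_subset_insert hBP).trans (Set.subset_insert _ _)
      · rw [Finset.coe_insert, linearIndepOn_insert huB]
        rintro ⟨-, hsp⟩
        apply hsp
        have e : (Function.update (Function.update x u q.1) v q.2) '' (B : Set V) =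
            x '' (B : Set V) := Set.image_congr fun w hw => by
          rw [Function.update_of_ne (fun e => hvB (by rwa [← e])),
            Function.update_of_ne (fun e => huB (by rwa [← e]))]
        rwa [e, Function.update_of_ne huv, Function.update_self]
    · rw [Submodule.starProjection_apply_eq_zero_iff, hL₁, Submodule.orthogonal_orthogonal] at h0
      refine hK0 _ (insert v A) ?_ (by rw [Finset.card_insert_of_notMem hvA]; omega) ?_
      · rw [Finset.coe_insert]
        exact Set.insert_subset_insert (hAP.trans (Set.subset_insert _ _))
      · rw [Finset.coe_insert, linearIndepOn_insert hvA]
        rintro ⟨-, hsp⟩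
        apply hsp
        have e : (Function.update (Function.update x u q.1) v q.2) '' (A : Set V) =
            x '' (A : Set V) := Set.image_congr fun w hw => by
          rw [Function.update_of_ne (fun e => hvA (by rwa [← e])),
            Function.update_of_ne (fun e => huA (by rwa [← e]))]
        rwa [e, Function.update_self]
  have hr1 : ∫⁻ q, f₁ q ∂(pairLaw L₁ L₂) = ∫⁻ q in swapDomain L₁ L₂, f₁ q ∂(pairLaw L₁ L₂) := by
    rw [← lintegral_indicator hD]
    refine lintegral_congr_ae ?_
    filter_upwards [ae_pairLaw (ne_bot_of_two_le_finrank fA2) fB2] with q hq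
    by_cases hqD : q ∈ swapDomain L₁ L₂
    · rw [Set.indicator_of_mem hqD]
    · rw [Set.indicator_of_notMem hqD, hf₁]
      simp only [hKD q hq.1 hq.2.1 hq.2.2 hqD, mul_zero]
  have hr2 : ∫⁻ q, f₂ q ∂((pairLaw L₂ L₁).map Prod.swap) =
      ∫⁻ q in swapDomain L₁ L₂, f₂ q ∂((pairLaw L₂ L₁).map Prod.swap) := by
    rw [← lintegral_indicator hD, lintegral_map hf₂m measurable_swap,
      lintegral_map (hf₂m.indicator hD) measurable_swap]
    refine lintegral_congr_ae ?_
    filter_upwards [ae_pairLaw (ne_bot_of_two_le_finrank fB2) fA2] with q hq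
    by_cases hqD : q.swap ∈ swapDomain L₁ L₂
    · rw [Set.indicator_of_mem hqD]
    · rw [Set.indicator_of_notMem hqD, hf₂]
      simp only [hKD q.swap hq.2.1 hq.1 (by rw [real_inner_comm]; exact hq.2.2) hqD, mul_zero]
  rw [hr1, hr2, pairLaw_swap_eq_withDensity fA2 fB2,
    lintegral_withDensity_eq_lintegral_mul _ (measurable_swapRatio L₁ L₂).ennreal_ofReal hf₂m,
    ← lintegral_const_mul _ hf₁m,
    ← lintegral_const_mul _ ((measurable_swapRatio L₁ L₂).ennreal_ofReal.mul hf₂m)]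
  refine setLIntegral_congr_fun hD fun q hq => ?_
  simp only [Pi.mul_apply, hf₁, hf₂]
  have e1 : ∀ w ∈ B, Function.update x u q.1 w = x w := fun w hw =>
    Function.update_of_ne (fun e => huB (by rwa [← e])) _ _
  have e2 : ∀ w ∈ A, Function.update x v q.2 w = x w := fun w hw =>
    Function.update_of_ne (fun e => hvA (by rwa [← e])) _ _
  have g1 : genDet (Function.update x u q.1) (insert u B) =
      genDet x B * ‖L₂.starProjection q.1‖ := by
    rw [genDet_insert huB ((linearIndepOn_congr e1).2 hLB), genDet_congr e1,
      Function.update_self]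
    have e : Function.update x u q.1 '' (B : Set V) = x '' (B : Set V) := Set.image_congr e1
    simp only [e, hL₂]
  have g2 : genDet (Function.update x v q.2) (insert v A) =
      genDet x A * ‖L₁.starProjection q.2‖ := by
    rw [genDet_insert hvA ((linearIndepOn_congr e2).2 hLA), genDet_congr e2,
      Function.update_self]
    have e : Function.update x v q.2 '' (A : Set V) = x '' (A : Set V) := Set.image_congr e2
    simp only [e, hL₁]
  have key : sWeight x A * sWeight (Function.update x u q.1) (insert u B) =
      sWeight x B * sWeight (Function.update x v q.2) (insert v A) *
        ENNReal.ofReal (swapRatio L₁ L₂ q) := by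
    have n1 := norm_pos_iff.2 hq.2.2.2.1
    have n2 := norm_pos_iff.2 hq.2.2.2.2
    have p1 := genDet_pos hLA
    have p2 := genDet_pos hLB
    have nn : ∀ (y : V → Vec d) (N : Finset V), 0 ≤ sDensity y N := fun y N =>
      mul_nonneg (div_nonneg (mul_nonneg (zpow_nonneg (sphereArea_pos _).le _)
        (sphereArea_pos _).le) (pow_nonneg (sphereArea_pos _).le _))
        (one_div_nonneg.2 (Real.sqrt_nonneg _))
    rw [sWeight, sWeight, sWeight, sWeight, ← ENNReal.ofReal_mul (nn _ _),
      ← ENNReal.ofReal_mul (nn _ _), ← ENNReal.ofReal_mul (mul_nonneg (nn _ _) (nn _ _))]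
    congr 1
    simp only [sDensity, g1, g2, Finset.card_insert_of_notMem huB,
      Finset.card_insert_of_notMem hvA, swapRatio, fA, fB]
    exact sDensity_swap (by omega) (by omega) p1 p2 n1 n2
  calc _ = sWeight x A * sWeight (Function.update x u q.1) (insert u B) *
        K (Function.update (Function.update x u q.1) v q.2) := by ring
    _ = _ := by rw [key]; ring

/-- The weighted iterated integral does not depend on the order of the nodes. -/
theorem seqInt_perm (hdeg : ∀ (v : V) (N : Finset V), (∀ w ∈ N, G.Adj v w) → N.card < d)
    {Q : Set V} {F : (V → Vec d) → ℝ≥0∞} (hF : Measurable F) (hsupp : IsSupp Q F)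
    {l l' : List V} (h : l.Perm l') {P : Set V} (hPQ : P ⊆ Q) (hl : l.Nodup)
    (hlQ : ∀ v ∈ l, v ∈ Q) (hP : ∀ v ∈ l, v ∉ P) (x : V → Vec d) :
    seqInt G sWeight P l F x = seqInt G sWeight P l' F x := by
  induction h generalizing P x with
  | nil => rfl
  | cons v hp ih =>
    rw [List.nodup_cons] at hl
    simp only [seqInt]
    congr 1
    refine lintegral_congr fun g => ih (Set.insert_subset (hlQ _ (by simp)) hPQ) hl.2
      (fun w hw => hlQ w (List.mem_cons_of_mem _ hw)) ?_ _
    rintro w hw (rfl | hwP)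
    · exact hl.1 hw
    · exact hP w (List.mem_cons_of_mem _ hw) hwP
  | swap v u l =>
    -- The only case with content: one transposition at the head of the list, settled according to
    -- adjacency.
    simp only [List.nodup_cons, List.mem_cons, not_or] at hl
    have hu : u ∉ P := hP u (by simp)
    have hv : v ∉ P := hP v (by simp)
    by_cases hadj : G.Adj u v
    · exact seqInt_swap_of_adj hdeg hF hsupp hPQ (hlQ u (by simp)) (hlQ v (by simp)) hadj hu hv
        hl.1.2 hl.2.1 (fun w hw => hP w (by simp [hw])) x
    · exact seqInt_swap_of_not_adj isWeight_sWeight l hF hl.1.1 hadj hu hv x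
  | trans h₁ h₂ ih₁ ih₂ =>
    exact (ih₁ hPQ hl hlQ hP x).trans (ih₂ hPQ (h₁.nodup_iff.1 hl)
      (fun v hv => hlQ v (h₁.mem_iff.2 hv)) (fun v hv => hP v (h₁.mem_iff.2 hv)) x)

end Swap

/-! ### Almost sure general position of the sequential choice. -/

section GeneralPosition

variable {V : Type*} [Finite V] {d : ℕ} {G : SimpleGraph V}

theorem bind_apply_eq_zero_iff {α β : Type*} [MeasurableSpace α] [MeasurableSpace β]
    {μ : Measure α} {κ : α → Measure β} (hκ : Measurable κ) {S : Set β} (hS : MeasurableSet S) :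
    μ.bind κ S = 0 ↔ ∀ᵐ a ∂μ, κ a S = 0 := by
  rw [Measure.bind_apply hS hκ.aemeasurable]
  exact lintegral_eq_zero_iff ((Measure.measurable_coe hS).comp hκ)

theorem absolutelyContinuous_bind {α β : Type*} [MeasurableSpace α] [MeasurableSpace β]
    {μ ν : Measure α} (h : μ ≪ ν) {κ : α → Measure β} (hκ : Measurable κ) :
    μ.bind κ ≪ ν.bind κ := by
  refine Measure.AbsolutelyContinuous.mk fun S hS h0 => ?_
  rw [bind_apply_eq_zero_iff hκ hS] at h0 ⊢
  exact h.ae_le h0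

theorem seqMeasure_apply {P : Set V} {l : List V} {S : Set (V → Vec d)} (hS : MeasurableSet S)
    (x : V → Vec d) :
    seqMeasure G P l x S = seqInt G (fun _ _ => 1) P l (S.indicator 1) x := by
  rw [← lintegral_seqMeasure (measurable_one.indicator hS), lintegral_indicator_one hS]

theorem seqMeasure_append (P : Set V) (l₁ l₂ : List V) (x : V → Vec d) :
    seqMeasure G P (l₁ ++ l₂) x =
      (seqMeasure G P l₁ x).bind (seqMeasure G (P ∪ {v | v ∈ l₁}) l₂) := by
  ext S hS
  rw [Measure.bind_apply hS (measurable_seqMeasure _ _).aemeasurable, seqMeasure_apply hS,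
    seqInt_append, ← lintegral_seqMeasure
      (measurable_seqInt isWeight_one (measurable_one.indicator hS) _ _)]
  simp_rw [seqMeasure_apply hS]

theorem seqMeasure_append_absolutelyContinuous {P : Set V} {l l' : List V} (h : l.Perm l')
    (m : List V) {x : V → Vec d} (hac : seqMeasure G P l x ≪ seqMeasure G P l' x) :
    seqMeasure G P (l ++ m) x ≪ seqMeasure G P (l' ++ m) x := by
  have e : {v | v ∈ l} = {v | v ∈ l'} := Set.ext fun v => h.mem_iff
  rw [seqMeasure_append, seqMeasure_append, e]
  exact absolutelyContinuous_bind hac (measurable_seqMeasure _ _)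

theorem ae_eq_of_notMem (P : Set V) (l : List V) (x : V → Vec d) :
    ∀ᵐ y ∂(seqMeasure G P l x), ∀ v, v ∉ l → y v = x v := by
  refine ae_all_iff.2 fun v => ?_
  by_cases hv : v ∈ l
  · simp [hv]
  have hS : MeasurableSet {y : V → Vec d | y v = x v} :=
    measurable_pi_apply v (measurableSet_singleton _)
  simp only [hv, not_false_eq_true, true_imp_iff]
  change seqMeasure G P l x {y | y v = x v}ᶜ = 0
  rw [seqMeasure_apply hS.compl, seqInt_one_of_const]
  · simp
  · intro y hy
    simp [Set.indicator, hy v hv]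

/-- The maps that send any at most `d` nodes of `Q` to linearly independent vectors. -/
def genPos (Q : Set V) : Set (V → Vec d) :=
  {y | ∀ W : Finset V, (W : Set V) ⊆ Q → W.card ≤ d → LinearIndepOn ℝ y W}

theorem measurableSet_genPos (Q : Set V) : MeasurableSet (genPos Q : Set (V → Vec d)) := by
  simp only [genPos, Set.ofPred_forall]
  exact MeasurableSet.iInter fun W => MeasurableSet.iInter fun _ => MeasurableSet.iInter fun _ =>
    measurableSet_linearIndepOn W

theorem isSupp_indicator_genPos (Q : Set V) {F : (V → Vec d) → ℝ≥0∞} :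
    IsSupp Q ((genPos Q).indicator F) := by
  intro y hy W hW hWd
  by_contra hcon
  refine hy (Set.indicator_of_notMem (fun h : y ∈ genPos Q => hcon (h W hW hWd)) _)

theorem seqWeight_ne_zero {P : Set V} {l : List V} {y : V → Vec d}
    (h : ∀ (v : V) (N : Finset V), (N : Set V) ⊆ P ∪ {w | w ∈ l} → (∀ w ∈ N, G.Adj v w) →
      LinearIndepOn ℝ y N) : seqWeight G sWeight P l y ≠ 0 := by
  induction l generalizing P with
  | nil => simp [seqWeight]
  | cons v l ih =>
    rw [seqWeight]
    refine mul_ne_zero ?_ (ih fun u N hN hu => h u N (hN.trans ?_) hu)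
    · exact (ENNReal.ofReal_pos.2 (sDensity_pos (h v _ ((nbrs_subset G P v).trans
        subset_union_left) fun w hw => (mem_nbrs.1 hw).1))).ne'
    · intro w hw
      simp only [Set.mem_union, Set.mem_insert_iff, Set.mem_ofPred_eq, List.mem_cons] at hw ⊢
      tauto

/-- On maps in general position the weighted measures of the two orders coincide, and the weights do
not vanish there. If the first law is known to live on general position, its null sets are thus
controlled by those of the second. -/
theorem seqMeasure_absolutelyContinuous_of_genPos
    (hdeg : ∀ (v : V) (N : Finset V), (∀ w ∈ N, G.Adj v w) → N.card < d)
    {l l' : List V} (h : l.Perm l') (hl : l.Nodup) {x : V → Vec d}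
    (hgp : ∀ᵐ y ∂(seqMeasure G ∅ l x), y ∈ genPos {v | v ∈ l}) :
    seqMeasure G ∅ l x ≪ seqMeasure G ∅ l' x := by
  refine Measure.AbsolutelyContinuous.mk fun E hE h0 => ?_
  have hm := measurableSet_genPos (d := d) {v | v ∈ l}
  set F : (V → Vec d) → ℝ≥0∞ := (genPos {v | v ∈ l}).indicator (E.indicator 1) with hF
  have hFm : Measurable F := (measurable_one.indicator hE).indicator hm
  have hwm : ∀ m : List V, Measurable fun y => seqWeight G sWeight ∅ m y * F y := fun m =>
    (measurable_seqWeight isWeight_sWeight _ _).mul hFm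
  have key := seqInt_perm hdeg hFm (isSupp_indicator_genPos _) h (Set.empty_subset _) hl
    (fun v hv => hv) (by simp) x
  have hl' := h.nodup_iff.1 hl
  rw [seqInt_eq_seqInt_one isWeight_sWeight hl (by simp) hFm,
    seqInt_eq_seqInt_one isWeight_sWeight hl' (by simp) hFm,
    ← lintegral_seqMeasure (hwm _), ← lintegral_seqMeasure (hwm _)] at key
  have hz : ∫⁻ y, seqWeight G sWeight ∅ l' y * F y ∂(seqMeasure G ∅ l' x) = 0 := by
    rw [lintegral_congr_ae (g := fun _ => 0), lintegral_zero]
    filter_upwards [measure_eq_zero_iff_ae_notMem.1 h0] with y hy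
    simp [hF, hy]
  rw [hz, lintegral_eq_zero_iff (hwm _)] at key
  rw [measure_eq_zero_iff_ae_notMem]
  filter_upwards [key, hgp] with y hy hyg hyE
  refine mul_ne_zero (seqWeight_ne_zero fun v N hN hv => hyg N (by simpa using hN)
    (hdeg v N hv).le) ?_ hy
  simp [hF, hyg, hyE]

/-- The Gaussian vectors whose projection falls into the span of `W` form a proper subspace, hence a
null set. It is proper because a nonzero vector orthogonal to all of `W`, which exists as `W` has
fewer than d nodes, is fixed by the projection and lies outside the span. -/
theorem ae_linearIndepOn_choose {y : V → Vec d} {N W : Finset V} {v : V} (hNW : N ⊆ W)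
    (hv : v ∉ W) (hW : W.card < d) (hy : LinearIndepOn ℝ y W) :
    ∀ᵐ g ∂(stdGaussian (Vec d)), LinearIndepOn ℝ (choose y N v g) (insert v (W : Set V)) := by
  set S := Submodule.span ℝ (y '' (W : Set V)) with hS
  set L := (Submodule.span ℝ (y '' (N : Set V)))ᗮ with hL
  have hK : S.comap (L.starProjection : Vec d →ₗ[ℝ] Vec d) ≠ ⊤ := by
    obtain ⟨z, hz, hz0⟩ := Submodule.exists_mem_ne_zero_of_ne_bot (orthogonal_span_ne_bot y hW)
    intro htop
    have hzL : z ∈ L := Submodule.orthogonal_le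
      (Submodule.span_mono (Set.image_mono (by exact_mod_cast hNW))) hz
    have hzS : z ∈ S := by
      have h1 : z ∈ S.comap (L.starProjection : Vec d →ₗ[ℝ] Vec d) := htop ▸ Submodule.mem_top
      rw [Submodule.mem_comap] at h1
      change L.starProjection z ∈ S at h1
      rwa [Submodule.starProjection_eq_self_iff.2 hzL] at h1
    exact hz0 ((Submodule.disjoint_def.1 S.orthogonal_disjoint) z hzS hz)
  filter_upwards [measure_eq_zero_iff_ae_notMem.1 (stdGaussian_submodule hK)] with g hg
  have e : ∀ w ∈ W, choose y N v g w = y w := fun w hw =>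
    choose_of_ne _ _ (by rintro rfl; exact hv hw) _
  rw [linearIndepOn_insert (by exact_mod_cast hv)]
  refine ⟨(linearIndepOn_congr e).2 hy, fun hmem => hg ?_⟩
  rw [Set.image_congr (fun w hw => e w hw), choose_self] at hmem
  change L.starProjection g ∈ S
  rw [← norm_smul_nrm (L.starProjection g)]
  exact S.smul_mem _ hmem

theorem ae_linearIndepOn_of_length_le {l : List V} (hl : l.Nodup) (hd : l.length ≤ d)
    (x : V → Vec d) :
    ∀ᵐ y ∂(seqMeasure G ∅ l x), LinearIndepOn ℝ y {v | v ∈ l} := by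
  classical
  induction l using List.reverseRecOn with
  | nil => simp
  | append_singleton l v ih =>
    rw [List.length_append, List.length_singleton] at hd
    rw [List.nodup_append] at hl
    have hv : v ∉ l := fun h => hl.2.2 v h v (by simp) rfl
    have hcard : l.toFinset.card < d := (List.toFinset_card_le l).trans_lt (by omega)
    have e : {w | w ∈ l ++ [v]} = ((insert v l.toFinset : Finset V) : Set V) := by
      ext w; simp; tauto
    have e' : {w | w ∈ l} = (l.toFinset : Set V) := by
      ext w; simp
    have hmS := measurableSet_linearIndepOn (d := d) (insert v l.toFinset)
    rw [e, ae_iff]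
    change seqMeasure G ∅ (l ++ [v]) x {y | LinearIndepOn ℝ y _}ᶜ = 0
    rw [seqMeasure_append, bind_apply_eq_zero_iff (measurable_seqMeasure _ _) hmS.compl]
    filter_upwards [ih hl.1 (by omega)] with y hy
    rw [e'] at hy
    rw [seqMeasure_apply hmS.compl]
    simp only [seqInt, one_mul]
    rw [lintegral_congr_ae (g := fun _ => 0), lintegral_zero]
    filter_upwards [ae_linearIndepOn_choose (N := nbrs G (∅ ∪ {v | v ∈ l}) v) (v := v) (fun w hw => by
      simpa using (mem_nbrs.1 hw).2) (by simpa using hv) hcard hy] with g hg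
    rw [Set.indicator_of_notMem]
    rw [Set.notMem_compl_iff, Finset.coe_insert]
    exact hg

theorem mem_genPos_of_linearIndepOn {y : V → Vec d} {Q : Set V} (h : LinearIndepOn ℝ y Q) :
    y ∈ genPos Q := fun _ hW _ => h.mono hW

theorem ae_linearIndepOn_append {l m : List V} (hl : l.Nodup) (hlm : (l ++ m).Nodup)
    (hd : l.length ≤ d) (x : V → Vec d) :
    ∀ᵐ y ∂(seqMeasure G ∅ (l ++ m) x), LinearIndepOn ℝ y {v | v ∈ l} := by
  classical
  have e' : {w | w ∈ l} = (l.toFinset : Set V) := by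
    ext w; simp
  have h1 := ae_linearIndepOn_of_length_le (G := G) hl hd x
  have hmS := measurableSet_linearIndepOn (d := d) l.toFinset
  rw [ae_iff]
  change seqMeasure G ∅ (l ++ m) x {y | LinearIndepOn ℝ y {v | v ∈ l}}ᶜ = 0
  rw [e'] at h1 ⊢
  rw [seqMeasure_append, bind_apply_eq_zero_iff (measurable_seqMeasure _ _) hmS.compl]
  filter_upwards [h1] with y hy
  rw [measure_eq_zero_iff_ae_notMem]
  filter_upwards [ae_eq_of_notMem (∅ ∪ {v | v ∈ l}) m y] with y' hy'
  rw [Set.notMem_compl_iff]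
  refine (linearIndepOn_congr fun w hw => hy' w fun hwm => ?_).2 hy
  rw [List.mem_toFinset] at hw
  exact (List.nodup_append.1 hlm).2.2 w hw w hwm rfl

/-- Any `W` with at most d nodes can be put at the beginning of the order, where independence is
almost sure; absolute continuity carries this back to the given order. -/
theorem ae_genPos_of_absolutelyContinuous {l : List V} (hl : l.Nodup) {x : V → Vec d}
    (h : ∀ l', l.Perm l' → seqMeasure G ∅ l x ≪ seqMeasure G ∅ l' x) :
    ∀ᵐ y ∂(seqMeasure G ∅ l x), y ∈ genPos {v | v ∈ l} := by
  classical
  refine ae_all_iff.2 fun W => ?_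
  by_cases hW : (W : Set V) ⊆ {v | v ∈ l}
  swap
  · simp [hW]
  by_cases hWd : W.card ≤ d
  swap
  · simp [hWd]
  have hp : l.Perm (W.toList ++ l.filter (· ∉ W)) := by
    rw [List.perm_ext_iff_of_nodup hl]
    · intro a
      have := @hW a
      simp only [Set.mem_ofPred_eq, Finset.mem_coe] at this
      simp only [List.mem_append, Finset.mem_toList, List.mem_filter, decide_eq_true_eq]
      tauto
    · refine List.nodup_append.2 ⟨W.nodup_toList, hl.filter _, fun a ha b hb => ?_⟩
      rintro rfl
      simp only [List.mem_filter, decide_eq_true_eq] at hb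
      exact hb.2 (Finset.mem_toList.1 ha)
  have h1 := ae_linearIndepOn_append (G := G) (d := d) W.nodup_toList (hp.nodup_iff.1 hl)
    (by simpa using hWd) x
  filter_upwards [(h _ hp).ae_le h1] with y hy _ _
  simpa using hy

theorem seqMeasure_swap_of_not_adj (m : List V) {u v : V} (huv : u ≠ v) (h : ¬ G.Adj u v)
    (hu : u ∉ m) (hv : v ∉ m) (x : V → Vec d) :
    seqMeasure G ∅ (m ++ [u, v]) x = seqMeasure G ∅ (m ++ [v, u]) x := by
  ext S hS
  have hm := (measurable_one.indicator hS : Measurable (S.indicator (1 : (V → Vec d) → ℝ≥0∞)))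
  rw [seqMeasure_apply hS, seqMeasure_apply hS, seqInt_append, seqInt_append]
  congr 1
  funext y
  exact seqInt_swap_of_not_adj isWeight_one [] hm huv h (by simpa using hu) (by simpa using hv) y

/-- In a sparse graph, the complement of any subgraph with more than `d` nodes is connected. -/
theorem IsSparse.reflTransGen (hG : IsSparse d G) {l : List V} (hl : l.Nodup)
    (hd : d < l.length) {a b : V} (ha : a ∈ l) (hb : b ∈ l) :
    Relation.ReflTransGen (fun u w => u ∈ l ∧ w ∈ l ∧ ¬ G.Adj u w) a b := by
  classical
  by_contra hab
  set R : V → V → Prop := fun u w => u ∈ l ∧ w ∈ l ∧ ¬ G.Adj u w with hR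
  have h1 := hG.card_add_card_le (A := l.toFinset.filter fun w => Relation.ReflTransGen R a w)
    (B := l.toFinset.filter fun w => ¬ Relation.ReflTransGen R a w)
    ⟨a, by simp [ha, Relation.ReflTransGen.refl]⟩ ⟨b, by simp [hb, hab]⟩ ?_
  · rw [Finset.card_filter_add_card_filter_not, List.toFinset_card_of_nodup hl] at h1
    omega
  · intro u hu w hw
    simp only [Finset.mem_filter, List.mem_toFinset] at hu hw
    by_contra hadj
    exact hw.2 (hu.2.tail ⟨hu.1, hw.1, hadj⟩)

/-- Induction on the number of nodes. The induction hypothesis permutes everything before the last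
node freely (`pre`), so it remains to exchange the last two nodes (`swap`). Up to d nodes this
follows from independence of the vectors; beyond d nodes it is done along a path of consecutive
nonadjacent nodes. -/
theorem IsSparse.seqMeasure_absolutelyContinuous (hG : IsSparse d G) (hd : 0 < d) {l l' : List V}
    (h : l.Perm l') (hl : l.Nodup) (x : V → Vec d) :
    seqMeasure G ∅ l x ≪ seqMeasure G ∅ l' x := by
  classical
  have hdeg : ∀ (v : V) (N : Finset V), (∀ w ∈ N, G.Adj v w) → N.card < d :=
    fun v N hN => hG.card_lt hd hN
  obtain ⟨n, hn⟩ : ∃ n, l.length = n := ⟨_, rfl⟩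
  induction n generalizing l l' with
  | zero =>
    rw [List.length_eq_zero_iff] at hn
    subst hn
    rw [List.nil_perm.1 h]
  | succ n ih =>
    have pre : ∀ {m m' : List V} (k : List V), m.Perm m' → m.Nodup → m.length = n →
        seqMeasure G ∅ (m ++ k) x ≪ seqMeasure G ∅ (m' ++ k) x := fun k hm hnd hlen =>
      seqMeasure_append_absolutelyContinuous hm k (ih hm hnd hlen)
    have swap : ∀ (u v : V) (m : List V), (m ++ [u, v]).Perm l →
        seqMeasure G ∅ (m ++ [u, v]) x ≪ seqMeasure G ∅ (m ++ [v, u]) x := by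
      by_cases hld : l.length ≤ d
      · intro u v m hm
        have hnd := hm.nodup_iff.2 hl
        refine seqMeasure_absolutelyContinuous_of_genPos hdeg
          (List.Perm.append_left m (List.Perm.swap _ _ _)) hnd ?_
        filter_upwards [ae_linearIndepOn_of_length_le (G := G) (d := d) hnd
          (hm.length_eq ▸ hld) x] with y hy
        exact mem_genPos_of_linearIndepOn hy
      · intro u v m hm
        have hu : u ∈ l := hm.mem_iff.1 (by simp)
        have hv : v ∈ l := hm.mem_iff.1 (by simp)
        have hpath := hG.reflTransGen hl (not_le.1 hld) hu hv
        -- Induction along the path from `u` to `v`, with `w` the successor of `u`. Writing the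
        -- order as a word, the endings become: m u v → m' u w v → m' u v w → m' v u w → m' v w u →
        -- m v u. The second arrow is the induction hypothesis for the path from `w`, the fourth is
        -- the swap of the nonadjacent `u` and `w`, and the others permute all but the last node.
        induction hpath using Relation.ReflTransGen.head_induction_on generalizing m with
        | refl => exact Measure.AbsolutelyContinuous.rfl
        | @head u w huw hwv ihp =>
          have hnd := hm.nodup_iff.2 hl
          have hlen := hm.length_eq
          rw [hn, List.length_append, List.length_cons, List.length_singleton] at hlen
          have hnd' := hnd
          simp only [List.nodup_append, List.nodup_cons, List.mem_cons, List.not_mem_nil, or_false,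
            not_false_eq_true, List.nodup_nil, and_true] at hnd'
          obtain ⟨hmn, huv, hdis⟩ := hnd'
          have hum : u ∉ m := fun h' => hdis u h' u (Or.inl rfl) rfl
          have hvm : v ∉ m := fun h' => hdis v h' v (Or.inr rfl) rfl
          by_cases hw : w = v
          · subst hw
            rw [seqMeasure_swap_of_not_adj m huv huw.2.2 hum hvm]
          by_cases hwu : w = u
          · subst hwu
            exact ihp m hm hu
          have hwm : w ∈ m := by
            have := hm.mem_iff.2 huw.2.1
            simp only [List.mem_append, List.mem_cons, List.not_mem_nil, or_false] at this
            tauto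
          have hmp : m.Perm (m.erase w ++ [w]) :=
            (List.perm_cons_erase hwm).trans (List.perm_append_singleton _ _).symm
          set m' := m.erase w with hm'
          have hm'n : m'.Nodup := hmn.erase w
          have hm'm : ∀ a ∈ m', a ∈ m := fun a ha => List.mem_of_mem_erase ha
          have hwm' : w ∉ m' := fun h' => (hmn.mem_erase_iff.1 h').1 rfl
          have len : m'.length + 1 = m.length := by
            rw [hmp.length_eq, List.length_append, List.length_singleton]
          have s1 : seqMeasure G ∅ (m ++ [u, v]) x ≪ seqMeasure G ∅ (m' ++ [u, w, v]) x := by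
            have := pre (m := m ++ [u]) (m' := m' ++ [u, w]) [v]
              ((hmp.append_right [u]).trans (by
                rw [List.append_assoc]
                exact List.Perm.append_left m' (List.Perm.swap _ _ _)))
              (List.Sublist.nodup (by simp) hnd) (by simp; omega)
            simpa using this
          have perm2 : ((m' ++ [u]) ++ [w, v]).Perm l := by
            refine List.Perm.trans ?_ hm
            rw [List.append_assoc]
            refine List.Perm.trans ?_ (hmp.append_right [u, v]).symm
            rw [List.append_assoc]
            exact List.Perm.append_left m' (List.Perm.swap _ _ _)
          have s2 := ihp (m' ++ [u]) perm2 huw.2.1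
          have nd2 := perm2.nodup_iff.2 hl
          have s3 : seqMeasure G ∅ ((m' ++ [u]) ++ [v, w]) x ≪
              seqMeasure G ∅ ((m' ++ [v]) ++ [u, w]) x := by
            have := pre (m := m' ++ [u, v]) (m' := m' ++ [v, u]) [w]
              (List.Perm.append_left m' (List.Perm.swap _ _ _))
              (List.Sublist.nodup (by simp) nd2) (by simp; omega)
            simpa using this
          have s4 : seqMeasure G ∅ ((m' ++ [v]) ++ [u, w]) x =
              seqMeasure G ∅ ((m' ++ [v]) ++ [w, u]) x := by
            refine seqMeasure_swap_of_not_adj _ (Ne.symm hwu) huw.2.2 ?_ ?_ x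
            · simp only [List.mem_append, List.mem_singleton, not_or]
              exact ⟨fun h' => hum (hm'm u h'), huv⟩
            · simp only [List.mem_append, List.mem_singleton, not_or]
              exact ⟨hwm', hw⟩
          have s5 : seqMeasure G ∅ ((m' ++ [v]) ++ [w, u]) x ≪
              seqMeasure G ∅ (m ++ [v, u]) x := by
            have hp5 : (m' ++ [v, w]).Perm (m ++ [v]) := by
              refine List.Perm.trans ?_ (hmp.append_right [v]).symm
              rw [List.append_assoc]
              exact List.Perm.append_left m' (List.Perm.swap _ _ _)
            have hnd5 : (m ++ [v]).Nodup :=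
              List.Sublist.nodup (by simp) hnd
            have := pre (m := m' ++ [v, w]) (m' := m ++ [v]) [u] hp5
              (hp5.nodup_iff.2 hnd5) (by simp; omega)
            simpa using this
          have s1' : seqMeasure G ∅ (m ++ [u, v]) x ≪
            seqMeasure G ∅ ((m' ++ [u]) ++ [w, v]) x := by simpa using s1
          exact s1'.trans (s2.trans (s3.trans (s4 ▸ s5)))
    -- If the last nodes a and b of the two lists differ, b is moved next to a by `pre`, the two are
    -- exchanged by `swap`, and the nodes before b are rearranged by `pre`.
    rcases List.eq_nil_or_concat l with rfl | ⟨m, a, rfl⟩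
    · simp at hn
    rcases List.eq_nil_or_concat l' with rfl | ⟨m', b, rfl⟩
    · simpa using h.length_eq
    simp only [List.concat_eq_append, List.length_append, List.length_singleton] at hn h hl swap ⊢
    have hmn : m.Nodup := List.Sublist.nodup (by simp) hl
    have hm'n : m'.Nodup := List.Sublist.nodup (by simp) (h.nodup_iff.1 hl)
    have hlen := h.length_eq
    simp only [List.length_append, List.length_singleton] at hlen
    have ham : a ∉ m := fun h' => (List.nodup_append.1 hl).2.2 a h' a (by simp) rfl
    by_cases hab : a = b
    · subst hab
      exact pre [a] ((List.perm_append_right_iff _).1 h) hmn (by omega)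
    have hbm : b ∈ m := by
      have : b ∈ m ++ [a] := h.mem_iff.2 (by simp)
      simpa [Ne.symm hab] using this
    have hmp : m.Perm (m.erase b ++ [b]) :=
      (List.perm_cons_erase hbm).trans (List.perm_append_singleton _ _).symm
    set k := m.erase b
    have hm'p : (k ++ [a]).Perm m' := by
      rw [← List.perm_append_right_iff [b]]
      refine List.Perm.trans ?_ h
      rw [List.append_assoc]
      refine List.Perm.trans ?_ (hmp.append_right [a]).symm
      rw [List.append_assoc]
      exact List.Perm.append_left k (List.Perm.swap _ _ _)
    have s1 := pre [a] hmp hmn (by omega)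
    have s2 := swap b a k (by
      have := (hmp.append_right [a]).symm
      rwa [List.append_assoc] at this)
    have s3 := pre [b] hm'p (hm'p.nodup_iff.2 hm'n) (by rw [hm'p.length_eq]; omega)
    rw [List.append_assoc] at s1 s3
    exact s1.trans (s2.trans s3)

/-- The random sequential choice leads to vectors in general position. -/
theorem IsSparse.ae_genPos (hG : IsSparse d G) (hd : 0 < d) {l : List V} (hl : l.Nodup)
    (x : V → Vec d) : ∀ᵐ y ∂(seqMeasure G ∅ l x), y ∈ genPos {v | v ∈ l} :=
  ae_genPos_of_absolutelyContinuous hl fun _ h => hG.seqMeasure_absolutelyContinuous hd h hl x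

end GeneralPosition

/-! ### A zero-one law for analytic conditions. -/

section ZeroOne

open scoped ContDiff Topology

theorem ae_ne_zero_of_contDiff {f : ℝ → ℝ} (hf : ContDiff ℝ ω f) {a : ℝ} (ha : f a ≠ 0) :
    ∀ᵐ t : ℝ, f t ≠ 0 := by
  have h := AnalyticOnNhd.preimage_zero_mem_codiscrete hf.analyticOnNhd ha
  have := ae_restrict_le_codiscreteWithin (μ := volume) MeasurableSet.univ h
  rw [Measure.restrict_univ] at this
  filter_upwards [this] with t ht using by simpa using ht

/-- Restrict to lines through `a`, on each of which the function is nonzero almost everywhere. By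
Fubini some t ≠ 0 has f(a + tv) ≠ 0 for almost every v, and scaling by t preserves null sets. -/
theorem ae_ne_zero_of_contDiff_of_finiteDimensional {E : Type*} [NormedAddCommGroup E]
    [InnerProductSpace ℝ E] [FiniteDimensional ℝ E] [MeasurableSpace E] [BorelSpace E] {f : E → ℝ}
    (hf : ContDiff ℝ ω f) {a : E} (ha : f a ≠ 0) : ∀ᵐ v : E, f v ≠ 0 := by
  set h : E → ℝ := fun v => f (a + v) with hh
  have hhc : ContDiff ℝ ω h := by fun_prop
  have h0 : h 0 ≠ 0 := by simpa [hh] using ha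
  have hmeas : MeasurableSet {v | h v ≠ 0} :=
    (isOpen_ne_fun hhc.continuous continuous_const).measurableSet
  have h1 : ∀ᵐ v : E, ∀ᵐ t : ℝ, h (t • v) ≠ 0 := by
    refine ae_of_all _ fun v => ?_
    refine ae_ne_zero_of_contDiff (f := fun t => h (t • v)) (by fun_prop) (a := 0) ?_
    simpa using h0
  have hms : MeasurableSet {q : E × ℝ | h (q.2 • q.1) ≠ 0} :=
    (isOpen_ne_fun (hhc.continuous.comp (continuous_snd.smul continuous_fst))
      continuous_const).measurableSet
  rw [Measure.ae_ae_comm hms] at h1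
  have h2 : ∀ᵐ t : ℝ, t ≠ 0 := by simp [ae_iff]
  obtain ⟨t, ht, ht0⟩ := (h1.and h2).exists
  have h3 : (volume : Measure E) {v | h v = 0} = 0 := by
    have := Measure.addHaar_preimage_smul (volume : Measure E) ht0 {v | h v = 0}
    have hz : (volume : Measure E) ((t • ·) ⁻¹' {v | h v = 0}) = 0 := by
      rw [ae_iff] at ht
      simpa using ht
    rw [hz] at this
    have hne : ENNReal.ofReal |(t ^ finrank ℝ E)⁻¹| ≠ 0 := by
      rw [Ne, ENNReal.ofReal_eq_zero, not_le]
      positivity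
    exact (mul_eq_zero.1 this.symm).resolve_left hne
  have h4 : (volume : Measure E) ((fun v => a + v) ⁻¹' {v | f v = 0}) = 0 := h3
  rw [measure_preimage_add] at h4
  rw [ae_iff]
  simpa using h4

variable {V : Type*} [Fintype V] {d : ℕ} {G : SimpleGraph V}

theorem contDiff_det {E n : Type*} [NormedAddCommGroup E] [NormedSpace ℝ E] [Fintype n]
    [DecidableEq n] {A : E → Matrix n n ℝ} (hA : ∀ i j, ContDiff ℝ ω fun x => A x i j) :
    ContDiff ℝ ω fun x => (A x).det := by
  simp_rw [Matrix.det_apply]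
  refine ContDiff.sum fun σ _ => ContDiff.const_smul _ ?_
  exact contDiff_prod fun i _ => hA _ _

theorem contDiff_adjugate {E n : Type*} [NormedAddCommGroup E] [NormedSpace ℝ E] [Fintype n]
    [DecidableEq n] {A : E → Matrix n n ℝ} (hA : ∀ i j, ContDiff ℝ ω fun x => A x i j) (i j : n) :
    ContDiff ℝ ω fun x => (A x).adjugate i j := by
  simp_rw [Matrix.adjugate_apply]
  refine contDiff_det fun k l => ?_
  by_cases h : k = j
  · subst h
    simpa using contDiff_const
  · simpa [Matrix.updateRow_apply, h] using hA k l

open scoped Classical in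
/-- The Gram determinant. -/
def gramDet (x : V → Vec d) (N : Finset V) : ℝ := (Matrix.gram ℝ fun i : N => x i).det

theorem gramDet_ne_zero {x : V → Vec d} {N : Finset V} :
    gramDet x N ≠ 0 ↔ LinearIndepOn ℝ x (N : Set V) := by
  classical
  exact linearIndepOn_iff_gram_det_ne_zero.symm

theorem contDiff_gram (N : Finset V) (i j : N) :
    ContDiff ℝ ω fun x : V → Vec d => Matrix.gram ℝ (fun i : N => x i) i j := by
  simp only [Matrix.gram_apply]
  exact (contDiff_apply ℝ (Vec d) (i : V)).inner ℝ (contDiff_apply ℝ (Vec d) (j : V))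

theorem contDiff_gramDet (N : Finset V) : ContDiff ℝ ω fun x : V → Vec d => gramDet x N := by
  classical
  exact contDiff_det (contDiff_gram N)

/-- Cramer's rule: multiplying by the Gram determinant clears the denominators of the projection.
The right-hand side is polynomial in `x`, and the identity persists for dependent vectors, where
both sides are 0. -/
theorem gramDet_smul_starProjection (x : V → Vec d) (N : Finset V) [DecidableEq N] (g : Vec d) :
    gramDet x N • (Submodule.span ℝ (x '' (N : Set V)))ᗮ.starProjection g =
      gramDet x N • g - ∑ i : N, ∑ j : N,
        ((Matrix.gram ℝ fun i : N => x i).adjugate i j * ⟪x j, g⟫_ℝ) • x i := by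
  rw [← map_smul, Submodule.starProjection_orthogonal_val]
  congr 1
  apply Submodule.eq_starProjection_of_mem_of_inner_eq_zero
  · refine Submodule.sum_mem _ fun i _ => Submodule.sum_mem _ fun j _ =>
      Submodule.smul_mem _ _ (Submodule.subset_span (Set.mem_image_of_mem x i.2))
  · intro w hw
    rw [real_inner_comm]
    refine Submodule.span_induction ?_ (by simp) (fun a b _ _ ha hb => by
      rw [inner_add_left, ha, hb, add_zero]) (fun c a _ ha => by
      rw [inner_smul_left, ha, mul_zero]) hw
    rintro _ ⟨k, hk, rfl⟩
    have hk' : k ∈ N := hk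
    have h := (Matrix.gram ℝ fun i : N => x i).mul_adjugate
    have hkj : ∀ j : N, ∑ i : N, ⟪x k, x i⟫_ℝ * (Matrix.gram ℝ fun i : N => x i).adjugate i j =
        gramDet x N * if (⟨k, hk'⟩ : N) = j then 1 else 0 := by
      intro j
      have := congrFun (congrFun h ⟨k, hk'⟩) j
      rw [Matrix.mul_apply, Matrix.smul_apply, Matrix.one_apply, smul_eq_mul] at this
      rw [gramDet]
      convert this using 1
      · refine Finset.sum_congr rfl fun i _ => ?_
        rw [Matrix.gram_apply]
      · congr!
    rw [inner_sub_right, inner_sum, inner_smul_right]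
    simp_rw [inner_sum, inner_smul_right]
    rw [Finset.sum_comm]
    have : ∀ j : N, ∑ i : N, (Matrix.gram ℝ fun i : N => x i).adjugate i j * ⟪x j, g⟫_ℝ *
        ⟪x k, x i⟫_ℝ = (gramDet x N * if (⟨k, hk'⟩ : N) = j then 1 else 0) * ⟪x j, g⟫_ℝ := by
      intro j
      rw [← hkj j, Finset.sum_mul]
      exact Finset.sum_congr rfl fun i _ => by ring
    simp_rw [this]
    simp

theorem contDiff_gramDet_smul_starProjection (N : Finset V) (g : Vec d) :
    ContDiff ℝ ω fun x : V → Vec d =>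
      gramDet x N • (Submodule.span ℝ (x '' (N : Set V)))ᗮ.starProjection g := by
  classical
  simp_rw [gramDet_smul_starProjection]
  refine ((contDiff_gramDet N).smul contDiff_const).sub ?_
  refine ContDiff.sum fun i _ => ContDiff.sum fun j _ => ?_
  have h : ContDiff ℝ ω fun x : V → Vec d => ⟪x j, g⟫_ℝ :=
    (contDiff_apply ℝ (Vec d) (j : V)).inner ℝ contDiff_const
  exact ((contDiff_adjugate (contDiff_gram N) i j).mul h).smul (contDiff_apply ℝ (Vec d) (i : V))

open scoped Classical in
/-- The function is analytic, and its zero set is invariant under scaling any of the vectors. -/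
structure IsScalable (f : (V → Vec d) → ℝ) : Prop where
  contDiff : ContDiff ℝ ω f
  smul : ∀ (x : V → Vec d) (v : V) (c : ℝ), c ≠ 0 →
    (f (Function.update x v (c • x v)) = 0 ↔ f x = 0)

theorem IsScalable.measurableSet {f : (V → Vec d) → ℝ} (hf : IsScalable f) :
    MeasurableSet {x | f x = 0} :=
  (isClosed_eq hf.contDiff.continuous continuous_const).measurableSet

open scoped Classical in
theorem IsScalable.update_smul {f : (V → Vec d) → ℝ} (hf : IsScalable f)
    (x : V → Vec d) (v : V)
    (y : Vec d) {c : ℝ} (hc : c ≠ 0) :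
    f (Function.update x v (c • y)) = 0 ↔ f (Function.update x v y) = 0 := by
  have := hf.smul (Function.update x v y) v c hc
  simp only [Function.update_self, Function.update_idem] at this
  convert this

open scoped Classical in
theorem linearIndepOn_update_smul {x : V → Vec d} {W : Set V} (v : V) {c : ℝ} (hc : c ≠ 0) :
    LinearIndepOn ℝ (Function.update x v (c • x v)) W ↔ LinearIndepOn ℝ x W := by
  have h : ∀ (x : V → Vec d) (c : ℝ), c ≠ 0 → LinearIndepOn ℝ x W →
      LinearIndepOn ℝ (Function.update x v (c • x v)) W := by
    intro x c hc hx
    have := LinearIndependent.units_smul hx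
      (fun w : W => if (w : V) = v then Units.mk0 c hc else 1)
    have e : (fun w : W => Function.update x v (c • x v) w) =
        (fun w : W => if (w : V) = v then Units.mk0 c hc else 1) • fun w : W => x w := by
      funext w
      by_cases hw : (w : V) = v
      · simp [hw, Units.smul_def]
      · simp [hw]
    rw [LinearIndepOn, e]
    exact this
  refine ⟨fun hx => ?_, h x c hc⟩
  have := h _ c⁻¹ (inv_ne_zero hc) hx
  simpa [smul_smul, inv_mul_cancel₀ hc] using this

theorem isScalable_gramDet (N : Finset V) : IsScalable fun x : V → Vec d => gramDet x N where
  contDiff := contDiff_gramDet N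
  smul x v c hc := not_iff_not.1 (by
    rw [← Ne, ← Ne, gramDet_ne_zero, gramDet_ne_zero, linearIndepOn_update_smul v hc])

theorem span_image_eq_of_smul {x y : V → Vec d} {N : Finset V}
    (h : ∀ w ∈ N, ∃ c : ℝ, c ≠ 0 ∧ y w = c • x w) :
    Submodule.span ℝ (y '' (N : Set V)) = Submodule.span ℝ (x '' (N : Set V)) := by
  apply le_antisymm
  · rw [Submodule.span_le]
    rintro _ ⟨w, hw, rfl⟩
    obtain ⟨c, -, hy⟩ := h w hw
    rw [SetLike.mem_coe, hy]
    exact Submodule.smul_mem _ _ (Submodule.subset_span (Set.mem_image_of_mem x hw))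
  · rw [Submodule.span_le]
    rintro _ ⟨w, hw, rfl⟩
    obtain ⟨c, hc, hy⟩ := h w hw
    rw [SetLike.mem_coe, show x w = c⁻¹ • y w by rw [hy, smul_smul, inv_mul_cancel₀ hc, one_smul]]
    exact Submodule.smul_mem _ _ (Submodule.subset_span (Set.mem_image_of_mem y hw))

-- This closes the class under one random choice with `g` fixed. The projection depends only on the
-- span of `M`, which rescaling preserves, and the factor `gramDet` affects the zero set only
-- through whether it vanishes.
open scoped Classical in
theorem IsScalable.comp_update {f : (V → Vec d) → ℝ} (hf : IsScalable f)
    {M : Finset V} {v : V} (hv : v ∉ M) (g : Vec d) :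
    IsScalable fun x : V → Vec d => f (Function.update x v
      (gramDet x M • (Submodule.span ℝ (x '' (M : Set V)))ᗮ.starProjection g)) where
  contDiff := by
    refine hf.contDiff.comp (contDiff_pi.2 fun w => ?_)
    by_cases h : w = v
    · subst h
      simpa using contDiff_gramDet_smul_starProjection M g
    · simpa [h] using contDiff_apply ℝ (Vec d) w
  smul x u c hc := by
    set x' := Function.update x u (c • x u) with hx'
    have e : Submodule.span ℝ (x' '' (M : Set V)) = Submodule.span ℝ (x '' (M : Set V)) := by
      refine span_image_eq_of_smul fun w _ => ?_
      by_cases h : w = u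
      · subst h
        exact ⟨c, hc, by simp [hx']⟩
      · exact ⟨1, one_ne_zero, by simp [hx', h]⟩
    simp only [e]
    set p := (Submodule.span ℝ (x '' (M : Set V)))ᗮ.starProjection g
    have hu : ∀ y : Vec d, f (Function.update x' v y) = 0 ↔ f (Function.update x v y) = 0 := by
      intro y
      by_cases huv : u = v
      · subst huv
        simp [hx']
      · have h1 : Function.update x' v y =
            Function.update (Function.update x v y) u (c • Function.update x v y u) := by
          rw [Function.update_of_ne huv, hx', Function.update_comm huv]
        rw [h1]
        convert hf.smul (Function.update x v y) u c hc
    rw [hu]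
    have hd := (isScalable_gramDet (d := d) M).smul x u c hc
    have hd' : gramDet x' M = 0 ↔ gramDet x M = 0 := by convert hd
    by_cases h0 : gramDet x M = 0
    · rw [h0, hd'.2 h0]
    · rw [hf.update_smul x v p h0, hf.update_smul x v p (fun h => h0 (hd'.1 h))]

theorem linearIndepOn_insert_notMem {x : V → Vec d} {M : Set V} {w : V} (hw : w ∉ M)
    (hM : LinearIndepOn ℝ x M) (h : ¬ LinearIndepOn ℝ x (insert w M)) :
    x w ∈ Submodule.span ℝ (x '' M) := by
  by_contra hcon
  exact h ((linearIndepOn_insert hw).2 ⟨hM, hcon⟩)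

/-- Zero-one law: an analytic condition holds almost surely or almost never. -/
theorem IsScalable.zero_one (P : Set V) (l : List V) (x : V → Vec d) {f : (V → Vec d) → ℝ}
    (hf : IsScalable f) :
    (∀ᵐ y ∂(seqMeasure G P l x), f y = 0) ∨ ∀ᵐ y ∂(seqMeasure G P l x), f y ≠ 0 := by
  classical
  induction l using List.reverseRecOn generalizing f with
  | nil =>
    simp only [seqMeasure]
    by_cases h : f x = 0
    · exact Or.inl ((ae_dirac_iff hf.measurableSet).2 h)
    · exact Or.inr ((ae_dirac_iff (p := fun y => f y ≠ 0) hf.measurableSet.compl).2 h)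
  | append_singleton l v ih =>
    set N := nbrs G (P ∪ {v | v ∈ l}) v with hN
    have hvN : v ∉ N := fun h => (mem_nbrs.1 h).1.ne rfl
    set μ := seqMeasure G P l x with hμ
    -- `N` may be dependent, and then its Gram determinant is useless as a denominator. By the
    -- induction hypothesis applied to Gram determinants, a maximal almost surely independent subset
    -- `M` almost surely has the same span as `N`.
    obtain ⟨M, hM, hmax⟩ := Finset.exists_max_image
      (Finset.filter (fun M : Finset V => ∀ᵐ y ∂μ, LinearIndepOn ℝ y (M : Set V)) N.powerset)
      Finset.card
      ⟨∅, by simp⟩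
    rw [Finset.mem_filter, Finset.mem_powerset] at hM
    have hdep : ∀ w ∈ N, w ∉ M → ∀ᵐ y ∂μ, ¬ LinearIndepOn ℝ y (insert w (M : Set V)) := by
      intro w hw hwM
      rcases ih (isScalable_gramDet (d := d) (insert w M)) with h | h
      · filter_upwards [h] with y hy hli
        rw [← Finset.coe_insert] at hli
        exact gramDet_ne_zero.2 hli hy
      · have := hmax (insert w M) (Finset.mem_filter.2 ⟨Finset.mem_powerset.2
          (Finset.insert_subset hw hM.1), by
            filter_upwards [h] with y hy using gramDet_ne_zero.1 hy⟩)
        rw [Finset.card_insert_of_notMem hwM] at this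
        omega
    have hspan : ∀ᵐ y ∂μ, LinearIndepOn ℝ y (M : Set V) ∧
        Submodule.span ℝ (y '' (N : Set V)) = Submodule.span ℝ (y '' (M : Set V)) := by
      have hall : ∀ᵐ y ∂μ, ∀ w, w ∈ N → w ∉ M →
          ¬ LinearIndepOn ℝ y (insert w (M : Set V)) := by
        refine ae_all_iff.2 fun w => ?_
        by_cases hw : w ∈ N
        · by_cases hwM : w ∈ M
          · simp [hwM]
          · filter_upwards [hdep w hw hwM] with y hy _ _ using hy
        · simp [hw]
      filter_upwards [hM.2, hall] with y hy hy'
      refine ⟨hy, le_antisymm ?_ (Submodule.span_mono (Set.image_mono (by exact_mod_cast hM.1)))⟩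
      rw [Submodule.span_le]
      rintro _ ⟨w, hw, rfl⟩
      by_cases hwM : w ∈ M
      · exact Submodule.subset_span (Set.mem_image_of_mem y hwM)
      · exact linearIndepOn_insert_notMem (by exact_mod_cast hwM) hy (hy' w hw hwM)
    have hvM : v ∉ M := fun h => hvN (hM.1 h)
    -- Zero sets ignore scaling, so the non-analytic normalization to length 1 is replaced by the
    -- factor that makes the choice polynomial.
    have hchoose : ∀ y : V → Vec d, LinearIndepOn ℝ y (M : Set V) →
        Submodule.span ℝ (y '' (N : Set V)) = Submodule.span ℝ (y '' (M : Set V)) → ∀ g,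
        (f (choose y N v g) = 0 ↔ f (Function.update y v (gramDet y M •
          (Submodule.span ℝ (y '' (M : Set V)))ᗮ.starProjection g)) = 0) := by
      intro y hy hs g
      have hp : pick y N g =
          nrm ((Submodule.span ℝ (y '' (M : Set V)))ᗮ.starProjection g) := by
        simp only [pick, hs]
      rw [choose, hp]
      set p := (Submodule.span ℝ (y '' (M : Set V)))ᗮ.starProjection g
      rw [hf.update_smul y v p (gramDet_ne_zero.2 hy)]
      by_cases hp0 : p = 0
      · simp [hp0, nrm]
      · rw [nrm]
        convert hf.update_smul y v p (inv_ne_zero (norm_ne_zero_iff.2 hp0))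
    have hstep : ∀ (S : Set (V → Vec d)), MeasurableSet S →
        (seqMeasure G P (l ++ [v]) x S = 0 ↔ ∀ᵐ y ∂μ, ∀ᵐ g ∂(stdGaussian (Vec d)),
          choose y N v g ∉ S) := by
      intro S hS
      rw [seqMeasure_append, bind_apply_eq_zero_iff (measurable_seqMeasure _ _) hS]
      refine Filter.eventually_congr (ae_of_all _ fun y => ?_)
      rw [seqMeasure_apply hS]
      simp only [seqInt, one_mul]
      have hm : Measurable fun g => (S.indicator 1 (choose y N v g) : ℝ≥0∞) :=
        (measurable_one.indicator hS).comp (measurable_choose_right _ _ _)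
      rw [← hN, lintegral_eq_zero_iff hm]
      refine Filter.eventually_congr (ae_of_all _ fun g => ?_)
      simp [Set.indicator_apply_eq_zero]
    have key : ∀ g, (∀ᵐ y ∂μ, f (Function.update y v (gramDet y M •
          (Submodule.span ℝ (y '' (M : Set V)))ᗮ.starProjection g)) = 0) ∨
        ∀ᵐ y ∂μ, f (Function.update y v (gramDet y M •
          (Submodule.span ℝ (y '' (M : Set V)))ᗮ.starProjection g)) ≠ 0 := fun g =>
      ih (hf.comp_update hvM g)
    by_cases hall : ∀ g, ∀ᵐ y ∂μ, f (Function.update y v (gramDet y M •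
          (Submodule.span ℝ (y '' (M : Set V)))ᗮ.starProjection g)) = 0
    · left
      rw [ae_iff]
      refine (hstep _ hf.measurableSet.compl).2 ?_
      -- The exceptional null set depends on `g`. A countable dense set of `g` has a common one, and
      -- continuity in `g` does the rest.
      have hdense : ∀ᵐ y ∂μ, ∀ n, f (Function.update y v (gramDet y M •
          (Submodule.span ℝ (y '' (M : Set V)))ᗮ.starProjection
            (TopologicalSpace.denseSeq (Vec d) n))) = 0 :=
        ae_all_iff.2 fun n => hall _
      filter_upwards [hdense, hspan] with y hy hys
      refine ae_of_all _ fun g => ?_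
      simp only [Set.mem_compl_iff, not_not]
      refine (hchoose y hys.1 hys.2 g).2 ?_
      have hcl : IsClosed {g : Vec d | f (Function.update y v (gramDet y M •
          (Submodule.span ℝ (y '' (M : Set V)))ᗮ.starProjection g)) = 0} := by
        refine isClosed_eq (hf.contDiff.continuous.comp (continuous_const.update v ?_))
          continuous_const
        fun_prop
      have hsub : Set.range (TopologicalSpace.denseSeq (Vec d)) ⊆
          {g : Vec d | f (Function.update y v (gramDet y M •
            (Submodule.span ℝ (y '' (M : Set V)))ᗮ.starProjection g)) = 0} := by
        rintro _ ⟨n, rfl⟩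
        exact hy n
      have := hcl.closure_subset_iff.2 hsub
      rw [(TopologicalSpace.denseRange_denseSeq (Vec d)).closure_range] at this
      exact this (Set.mem_univ g)
    · right
      -- By the induction hypothesis one good `a` is good for almost every `y`; for such `y` the
      -- function of `g` is analytic and not identically zero.
      obtain ⟨a, ha⟩ := not_forall.1 hall
      have ha' := (key a).resolve_left ha
      change seqMeasure G P (l ++ [v]) x {y | f y ≠ 0}ᶜ = 0
      rw [show {y | f y ≠ 0}ᶜ = {y | f y = 0} by ext; simp, hstep _ hf.measurableSet]
      filter_upwards [ha', hspan] with y hy hys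
      have hc : ContDiff ℝ ω fun g : Vec d => f (Function.update y v (gramDet y M •
          (Submodule.span ℝ (y '' (M : Set V)))ᗮ.starProjection g)) := by
        refine hf.contDiff.comp (contDiff_pi.2 fun w => ?_)
        by_cases h : w = v
        · subst h
          simp only [Function.update_self]
          exact (ContinuousLinearMap.contDiff _).const_smul _
        · simpa [h] using contDiff_const
      have := stdGaussian_absolutelyContinuous.ae_le
        (ae_ne_zero_of_contDiff_of_finiteDimensional hc hy)
      filter_upwards [this] with g hg
      exact fun h => hg ((hchoose y hys.1 hys.2 g).1 h)

theorem linearIndepOn_zero_one (P : Set V) (l : List V) (x : V → Vec d) (W : Finset V) :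
    (∀ᵐ y ∂(seqMeasure G P l x), ¬ LinearIndepOn ℝ y (W : Set V)) ∨
      ∀ᵐ y ∂(seqMeasure G P l x), LinearIndepOn ℝ y (W : Set V) := by
  simp_rw [← gramDet_ne_zero, not_ne_iff]
  exact (isScalable_gramDet W).zero_one P l x

end ZeroOne

section ZeroOneFinite

variable {V : Type*} [Finite V] {d : ℕ} {G : SimpleGraph V}

/-- General position is a finite conjunction of independence conditions, each of which is almost
sure or almost never holds. -/
theorem genPos_zero_one (Q P : Set V) (l : List V) (x : V → Vec d) :
    (∀ᵐ y ∂(seqMeasure G P l x), y ∉ genPos Q) ∨ ∀ᵐ y ∂(seqMeasure G P l x), y ∈ genPos Q := by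
  have := Fintype.ofFinite V
  by_cases h : ∀ W : Finset V, (W : Set V) ⊆ Q → W.card ≤ d →
      ∀ᵐ y ∂(seqMeasure G P l x), LinearIndepOn ℝ y (W : Set V)
  · right
    refine ae_all_iff.2 fun W => ?_
    by_cases hW : (W : Set V) ⊆ Q
    · by_cases hWd : W.card ≤ d
      · filter_upwards [h W hW hWd] with y hy _ _ using hy
      · simp [hWd]
    · simp [hW]
  · left
    push Not at h
    obtain ⟨W, hW, hWd, hne⟩ := h
    filter_upwards [(linearIndepOn_zero_one P l x W).resolve_right (Filter.not_eventually.2 hne)] with y hy hg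
    exact hy (hg W hW hWd)

end ZeroOneFinite

/-! ### Translation of the laws and measures into iterated integrals. -/

section Bridge

variable {V : Type*} [Finite V] {d : ℕ} {G : SimpleGraph V}

/-- The nodes outside `S` in the order `p`. -/
def ordList (p : NodeOrder V) (S : Set V) : List V := by
  classical
  exact ((List.finRange (Nat.card V)).map p.symm).filter (fun v => v ∉ S)

@[simp] theorem mem_ordList {p : NodeOrder V} {S : Set V} {v : V} :
    v ∈ ordList p S ↔ v ∉ S := by
  simp only [ordList, List.mem_filter, List.mem_map, List.mem_finRange, true_and,
    decide_eq_true_eq, and_iff_right_iff_imp]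
  exact fun _ => ⟨p v, p.symm_apply_apply v⟩

theorem nodup_ordList (p : NodeOrder V) (S : Set V) : (ordList p S).Nodup :=
  ((List.nodup_finRange _).map p.symm.injective).filter _

theorem pairwise_ordList (p : NodeOrder V) (S : Set V) :
    (ordList p S).Pairwise fun v w => p v < p w := by
  refine List.Pairwise.filter _ ?_
  rw [List.pairwise_map]
  simpa using List.pairwise_lt_finRange (Nat.card V)

variable (G) in
/-- The nodes in the list are processed in the order `p`. -/
def IsCompat (p : NodeOrder V) : Set V → List V → Prop
  | _, [] => True
  | P, v :: l => earlier G p v = nbrs G P v ∧ IsCompat p (insert v P) l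

theorem isCompat_of_pairwise {p : NodeOrder V} {P : Set V} {l : List V}
    (hl : l.Pairwise fun v w => p v < p w) (hcov : ∀ w, w ∈ P ∨ w ∈ l)
    (hlt : ∀ w ∈ P, ∀ v ∈ l, p w < p v) : IsCompat G p P l := by
  induction l generalizing P with
  | nil => trivial
  | cons v l ih =>
    rw [List.pairwise_cons] at hl
    refine ⟨?_, ih hl.2 (fun w => ?_) fun w hw u hu => ?_⟩
    · ext w
      simp only [earlier, Set.Finite.mem_toFinset, Set.mem_ofPred_eq, mem_nbrs]
      refine and_congr_right fun _ => ⟨fun hw => ?_, fun hw => hlt w hw v (by simp)⟩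
      rcases hcov w with h | h
      · exact h
      · rcases List.mem_cons.1 h with rfl | h
        · exact absurd hw (lt_irrefl _)
        · exact absurd hw (hl.1 w h).not_gt
    · rcases hcov w with h | h
      · exact Or.inl (Or.inr h)
      · rcases List.mem_cons.1 h with rfl | h
        · exact Or.inl (Or.inl rfl)
        · exact Or.inr h
    · rcases hw with rfl | hw
      · exact hl.1 u hu
      · exact hlt w hw u (by simp [hu])

theorem isCompat_ordList {p : NodeOrder V} {S : Set V} (hp : StartsWith p S) :
    IsCompat G p S (ordList p S) :=
  isCompat_of_pairwise (pairwise_ordList p S) (fun w => by simpa using em _)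
    fun w hw v hv => hp w hw v (mem_ordList.1 hv)

theorem startsWith_empty (p : NodeOrder V) : StartsWith p (∅ : Set V) := fun _ h => h.elim

theorem stepLaw_eq (hdeg : ∀ (v : V) (N : Finset V), (∀ w ∈ N, G.Adj v w) → N.card < d)
    (p : NodeOrder V) (v : V) (x : V → Vec d) :
    stepLaw G p v x = (stdGaussian (Vec d)).map (choose x (earlier G p v) v) := by
  classical
  have hL := orthogonal_span_ne_bot x (hdeg v (earlier G p v) fun w hw => by
    simp only [earlier, Set.Finite.mem_toFinset, Set.mem_ofPred_eq] at hw
    exact hw.1)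
  rw [stepLaw, uniformSphere_eq_map hL]
  exact Measure.map_map (measurable_update x) (measurable_nrm.comp (measurable_starProjection _))

theorem foldl_bind_eq (hdeg : ∀ (v : V) (N : Finset V), (∀ w ∈ N, G.Adj v w) → N.card < d)
    {p : NodeOrder V} {P : Set V} {l : List V} (h : IsCompat G p P l)
    (μ : Measure (V → Vec d)) :
    l.foldl (fun μ v => μ.bind (stepLaw G p v)) μ = μ.bind (seqMeasure G P l) := by
  induction l generalizing P μ with
  | nil => exact (Measure.bind_dirac (m := μ)).symm
  | cons v l ih =>
    have e : (stepLaw G p v : (V → Vec d) → Measure (V → Vec d)) =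
        fun x => (stdGaussian (Vec d)).map (choose x (nbrs G P v) v) := by
      funext x
      rw [stepLaw_eq hdeg, h.1]
    rw [List.foldl_cons, ih h.2, e, Measure.bind_bind (measurable_map_choose _ _).aemeasurable
      (measurable_seqMeasure _ _).aemeasurable]
    rfl

theorem seqExtension_eq (hdeg : ∀ (v : V) (N : Finset V), (∀ w ∈ N, G.Adj v w) → N.card < d)
    {p : NodeOrder V} {S : Set V} (hp : StartsWith p S) (z : S → Vec d) :
    seqExtension G p S z = seqMeasure G S (ordList p S) (extendZero S z) := by
  have := foldl_bind_eq hdeg (isCompat_ordList (G := G) hp) (Measure.dirac (extendZero S z))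
  rw [Measure.dirac_bind (measurable_seqMeasure _ _)] at this
  rw [← this]
  rfl

theorem seqWeight_eq_prod {s : (V → Vec d) → Finset V → ℝ≥0∞} {p : NodeOrder V} {P : Set V}
    {l : List V} (h : IsCompat G p P l) (x : V → Vec d) :
    seqWeight G s P l x = (l.map fun v => s x (earlier G p v)).prod := by
  induction l generalizing P with
  | nil => rfl
  | cons v l ih => rw [seqWeight, ih h.2, List.map_cons, List.prod_cons, h.1]

theorem weight_eq {p : NodeOrder V} {S : Set V} (hp : StartsWith p S) (x : V → Vec d) :
    weight G p S x = seqWeight G sWeight S (ordList p S) x := by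
  classical
  rw [seqWeight_eq_prod (isCompat_ordList hp), weight, ← List.prod_toFinset _ (nodup_ordList p S)]
  refine Finset.prod_congr ?_ fun _ _ => rfl
  ext v
  simp

theorem measurable_weight {p : NodeOrder V} {S : Set V} (hp : StartsWith p S) :
    Measurable (weight G p S : (V → Vec d) → ℝ≥0∞) := by
  rw [show (weight G p S : (V → Vec d) → ℝ≥0∞) = seqWeight G sWeight S (ordList p S) from
    funext (weight_eq hp)]
  exact measurable_seqWeight isWeight_sWeight _ _

theorem lintegral_seqExtension_withDensity
    (hdeg : ∀ (v : V) (N : Finset V), (∀ w ∈ N, G.Adj v w) → N.card < d)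
    {p : NodeOrder V} {S : Set V} (hp : StartsWith p S) (z : S → Vec d)
    {F : (V → Vec d) → ℝ≥0∞} (hF : Measurable F) :
    ∫⁻ x, F x ∂((seqExtension G p S z).withDensity (weight G p S)) =
      seqInt G sWeight S (ordList p S) F (extendZero S z) := by
  have hm : Measurable fun x => seqWeight G sWeight S (ordList p S) x * F x :=
    (measurable_seqWeight isWeight_sWeight _ _).mul hF
  rw [lintegral_withDensity_eq_lintegral_mul _ (measurable_weight hp) hF, seqExtension_eq hdeg hp,
    seqInt_eq_seqInt_one isWeight_sWeight (nodup_ordList p S) (fun v hv => mem_ordList.1 hv) hF,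
    ← lintegral_seqMeasure hm]
  refine lintegral_congr fun x => ?_
  rw [Pi.mul_apply, weight_eq hp]

theorem inGeneralPosition_iff {x : V → Vec d} : InGeneralPosition x ↔ x ∈ genPos univ :=
  ⟨fun h W _ hW => h W hW, fun h W hW => h W (Set.subset_univ _) hW⟩

theorem measurableSet_isOrthoHom : MeasurableSet {x : V → Vec d | IsOrthoHom G x} := by
  refine MeasurableSet.inter ?_ ?_
  · change MeasurableSet {x : V → Vec d | ∀ v, ‖x v‖ = 1}
    rw [Set.ofPred_forall]
    exact MeasurableSet.iInter fun v => measurableSet_eq_fun (by fun_prop) measurable_const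
  · change MeasurableSet {x : V → Vec d | ∀ u v, G.Adj u v → ⟪x u, x v⟫_ℝ = 0}
    simp only [Set.ofPred_forall]
    exact MeasurableSet.iInter fun u => MeasurableSet.iInter fun v => MeasurableSet.iInter fun _ =>
      measurableSet_eq_fun ((measurable_pi_apply u).inner (measurable_pi_apply v)) measurable_const

theorem orthoVariety_eq : orthoVariety G d = {x | IsOrthoHom G x} ∩ genPos univ := by
  ext x
  exact and_congr_right fun _ => inGeneralPosition_iff

theorem measurableSet_orthoVariety : MeasurableSet (orthoVariety G d) := by
  rw [orthoVariety_eq]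
  exact measurableSet_isOrthoHom.inter (measurableSet_genPos _)

theorem isSupp_indicator_orthoVariety (F : (V → Vec d) → ℝ≥0∞) :
    IsSupp univ ((orthoVariety G d).indicator F) := by
  have := isSupp_indicator_genPos (univ : Set V)
    (F := {x | IsOrthoHom G x}.indicator F)
  rwa [Set.indicator_indicator, Set.inter_comm, ← orthoVariety_eq] at this

theorem measurable_extendZero (S : Set V) :
    Measurable (extendZero S : (S → Vec d) → V → Vec d) := by
  refine measurable_pi_iff.2 fun v => ?_
  by_cases h : v ∈ S
  · simp only [extendZero, h, dif_pos]
    exact measurable_pi_apply _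
  · simp only [extendZero, h, dif_neg, not_false_eq_true]
    exact measurable_const

theorem extendZero_of_mem {S : Set V} (z : S → Vec d) {v : V} (h : v ∈ S) :
    extendZero S z v = z ⟨v, h⟩ := by simp [extendZero, h]

theorem extendZero_of_notMem {S : Set V} (z : S → Vec d) {v : V} (h : v ∉ S) :
    extendZero S z v = 0 := by simp [extendZero, h]

theorem measurable_restrict_pi (S : Set V) :
    Measurable fun (x : V → Vec d) (v : S) => x v :=
  measurable_pi_iff.2 fun v => measurable_pi_apply (v : V)

theorem measurable_condIntegrand {S : Set V} {F : (S → Vec d) → ℝ≥0∞} (hF : Measurable F) :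
    Measurable ((orthoVariety G d).indicator fun x : V → Vec d => F fun v : S => x v) :=
  (hF.comp (measurable_restrict_pi S)).indicator measurableSet_orthoVariety

/-- The right-hand side no longer mentions the ordering and allows any enumeration of the complement
of `S`. The restriction to Σ_G built into φ_z supplies the vanishing off general position that order
independence requires, for every `z`. -/
theorem lintegral_condMeasureOrd
    (hdeg : ∀ (v : V) (N : Finset V), (∀ w ∈ N, G.Adj v w) → N.card < d)
    {p : NodeOrder V} {S : Set V} (hp : StartsWith p S) (z : S → Vec d)
    {F : (↥Sᶜ → Vec d) → ℝ≥0∞} (hF : Measurable F) {l : List V} (hl : l.Nodup)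
    (hlS : ∀ v, v ∈ l ↔ v ∉ S) :
    ∫⁻ y, F y ∂(condMeasureOrd G d p S z) = seqInt G sWeight S l
      ((orthoVariety G d).indicator fun x => F fun v : ↥Sᶜ => x v) (extendZero S z) := by
  have hm := measurable_condIntegrand (G := G) hF
  rw [condMeasureOrd, lintegral_map hF (measurable_restrict_pi _),
    ← lintegral_indicator measurableSet_orthoVariety,
    lintegral_seqExtension_withDensity hdeg hp z hm]
  refine seqInt_perm hdeg hm (isSupp_indicator_orthoVariety _) ?_ (Set.subset_univ _)
    (nodup_ordList p S) (fun _ _ => Set.mem_univ _) (fun v hv => mem_ordList.1 hv) _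
  rw [List.perm_ext_iff_of_nodup (nodup_ordList p S) hl]
  intro v
  rw [mem_ordList, hlS]

theorem lintegral_condMeasure
    (hdeg : ∀ (v : V) (N : Finset V), (∀ w ∈ N, G.Adj v w) → N.card < d)
    {S : Set V} (z : S → Vec d)
    {F : (↥Sᶜ → Vec d) → ℝ≥0∞} (hF : Measurable F) {l : List V} (hl : l.Nodup)
    (hlS : ∀ v, v ∈ l ↔ v ∉ S) :
    ∫⁻ y, F y ∂(condMeasure G d S z) = seqInt G sWeight S l
      ((orthoVariety G d).indicator fun x => F fun v : ↥Sᶜ => x v) (extendZero S z) :=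
  lintegral_condMeasureOrd hdeg (exists_startsWith S).choose_spec z hF hl hlS

theorem condMeasureOrd_eq
    (hdeg : ∀ (v : V) (N : Finset V), (∀ w ∈ N, G.Adj v w) → N.card < d)
    {p : NodeOrder V} {S : Set V} (hp : StartsWith p S) (z : S → Vec d) :
    condMeasureOrd G d p S z = condMeasure G d S z := by
  refine Measure.ext_of_lintegral _ fun F hF => ?_
  rw [lintegral_condMeasureOrd hdeg hp z hF (nodup_ordList p S) fun v => mem_ordList,
    lintegral_condMeasure hdeg z hF (nodup_ordList p S) fun v => mem_ordList]

/-! ### The random map is an ortho-homomorphism -/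

theorem ae_seqMeasure_append_singleton {P : Set V} {l : List V} {v : V} {x : V → Vec d}
    {S : Set (V → Vec d)} (hS : MeasurableSet S)
    (h : ∀ᵐ y ∂(seqMeasure G P l x), ∀ᵐ g ∂(stdGaussian (Vec d)),
      choose y (nbrs G (P ∪ {w | w ∈ l}) v) v g ∈ S) :
    ∀ᵐ y ∂(seqMeasure G P (l ++ [v]) x), y ∈ S := by
  change seqMeasure G P (l ++ [v]) x Sᶜ = 0
  rw [seqMeasure_append, bind_apply_eq_zero_iff (measurable_seqMeasure _ _) hS.compl]
  filter_upwards [h] with y hy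
  rw [seqMeasure_apply hS.compl]
  simp only [seqInt, one_mul]
  have hm : Measurable fun g => (Sᶜ.indicator 1
      (choose y (nbrs G (P ∪ {w | w ∈ l}) v) v g) : ℝ≥0∞) :=
    (measurable_one.indicator hS.compl).comp (measurable_choose_right _ _ _)
  rw [lintegral_eq_zero_iff hm]
  filter_upwards [hy] with g hg
  simp [hg]

theorem ae_pick {x : V → Vec d} {N : Finset V} (hN : N.card < d) :
    ∀ᵐ g ∂(stdGaussian (Vec d)), ‖pick x N g‖ = 1 ∧ ∀ w ∈ N, ⟪pick x N g, x w⟫_ℝ = 0 := by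
  set L := (Submodule.span ℝ (x '' (N : Set V)))ᗮ with hL
  have hbot := orthogonal_span_ne_bot x hN
  -- The projection of `g` vanishes only on the complement of `L`, which is a proper subspace.
  have hK : Lᗮ ≠ ⊤ := fun h => hbot ((Submodule.orthogonal_eq_top_iff _).1 h)
  filter_upwards [measure_eq_zero_iff_ae_notMem.1 (stdGaussian_submodule hK)] with g hg
  refine ⟨norm_nrm fun h => hg ((Submodule.starProjection_apply_eq_zero_iff _).1 h), fun w hw => ?_⟩
  have h1 : pick x N g ∈ L := L.smul_mem _ (L.starProjection_apply_mem g)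
  exact (Submodule.mem_orthogonal' _ _).1 h1 _
    (Submodule.subset_span (Set.mem_image_of_mem x hw))

theorem ae_isOrthoHom_on (hdeg : ∀ (v : V) (N : Finset V), (∀ w ∈ N, G.Adj v w) → N.card < d)
    {P : Set V} {l : List V} (hl : l.Nodup) (hP : ∀ v ∈ l, v ∉ P) (x : V → Vec d) :
    ∀ᵐ y ∂(seqMeasure G P l x), (∀ v ∈ l, ‖y v‖ = 1) ∧
      ∀ v ∈ l, ∀ w, w ∈ P ∪ {w | w ∈ l} → G.Adj v w → ⟪y v, y w⟫_ℝ = 0 := by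
  induction l using List.reverseRecOn with
  | nil => simp
  | append_singleton l v ih =>
    rw [List.nodup_append] at hl
    have hv : v ∉ l := fun h => hl.2.2 v h v (by simp) rfl
    have hvP : v ∉ P := hP v (by simp)
    refine ae_seqMeasure_append_singleton (S := {y | (∀ w ∈ l ++ [v], ‖y w‖ = 1) ∧
      ∀ u ∈ l ++ [v], ∀ w, w ∈ P ∪ {w | w ∈ l ++ [v]} → G.Adj u w → ⟪y u, y w⟫_ℝ = 0}) ?_ ?_
    · refine MeasurableSet.inter ?_ ?_
      · change MeasurableSet {y : V → Vec d | ∀ w ∈ l ++ [v], ‖y w‖ = 1}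
        simp only [Set.ofPred_forall]
        exact MeasurableSet.iInter fun v => MeasurableSet.iInter fun _ =>
          measurableSet_eq_fun (by fun_prop) measurable_const
      · change MeasurableSet {y : V → Vec d | ∀ u ∈ l ++ [v], ∀ w, w ∈ P ∪ {w | w ∈ l ++ [v]} →
          G.Adj u w → ⟪y u, y w⟫_ℝ = 0}
        simp only [Set.ofPred_forall]
        exact MeasurableSet.iInter fun u => MeasurableSet.iInter fun _ => MeasurableSet.iInter
          fun w => MeasurableSet.iInter fun _ => MeasurableSet.iInter fun _ =>
          measurableSet_eq_fun ((measurable_pi_apply u).inner (measurable_pi_apply w))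
            measurable_const
    · filter_upwards [ih hl.1 fun w hw => hP w (by simp [hw])] with y hy
      set N := nbrs G (P ∪ {w | w ∈ l}) v with hN
      filter_upwards [ae_pick (x := y) (hdeg v N fun w hw => (mem_nbrs.1 hw).1)] with g hg
      have hne : ∀ w, w ≠ v → choose y N v g w = y w := fun w hw => choose_of_ne _ _ hw _
      have hmem : ∀ w, w ∈ P ∪ {w | w ∈ l ++ [v]} → w ≠ v → w ∈ P ∪ {w | w ∈ l} := by
        intro w hw hwv
        simp only [Set.mem_union, Set.mem_ofPred_eq, List.mem_append, List.mem_singleton] at hw ⊢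
        tauto
      have hvw : ∀ w, w ∈ P ∪ {w | w ∈ l ++ [v]} → G.Adj v w →
          ⟪choose y N v g v, choose y N v g w⟫_ℝ = 0 := by
        intro w hw hadj
        rw [choose_self, hne w hadj.ne']
        exact hg.2 w (mem_nbrs.2 ⟨hadj, hmem w hw hadj.ne'⟩)
      refine ⟨fun w hw => ?_, fun u hu w hw hadj => ?_⟩
      · by_cases h : w = v
        · subst h
          rw [choose_self]
          exact hg.1
        · rw [hne w h]
          exact hy.1 w (by simpa [h] using hw)
      · by_cases h : u = v
        · subst h
          exact hvw w hw hadj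
        · have hul : u ∈ l := by simpa [h] using hu
          by_cases hwv : w = v
          · subst hwv
            rw [real_inner_comm]
            exact hvw u (by simp [hul]) hadj.symm
          · rw [hne u h, hne w hwv]
            exact hy.2 u hul w (hmem w hw hwv) hadj

theorem ae_isOrthoHom (hdeg : ∀ (v : V) (N : Finset V), (∀ w ∈ N, G.Adj v w) → N.card < d)
    {S : Set V} {z : S → Vec d} (hz : IsOrthoHom (G.induce S) z) {l : List V} (hl : l.Nodup)
    (hlS : ∀ v, v ∈ l ↔ v ∉ S) :
    ∀ᵐ y ∂(seqMeasure G S l (extendZero S z)), IsOrthoHom G y := by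
  filter_upwards [ae_isOrthoHom_on hdeg hl (fun v hv => (hlS v).1 hv) (extendZero S z),
    ae_eq_of_notMem S l (extendZero S z)] with y hy hy'
  have hcov : ∀ w, w ∈ S ∪ {w | w ∈ l} := fun w => by
    simp only [Set.mem_union, Set.mem_ofPred_eq, hlS]
    exact em _
  have hS : ∀ w, ∀ h : w ∈ S, y w = z ⟨w, h⟩ := fun w h => by
    rw [hy' w fun h' => (hlS w).1 h' h, extendZero_of_mem z h]
  refine ⟨fun v => ?_, fun u v huv => ?_⟩
  · by_cases h : v ∈ S
    · rw [hS v h]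
      exact hz.1 _
    · exact hy.1 v ((hlS v).2 h)
  · by_cases hu : u ∈ S
    · by_cases hv : v ∈ S
      · rw [hS u hu, hS v hv]
        exact hz.2 ⟨u, hu⟩ ⟨v, hv⟩ huv
      · rw [real_inner_comm]
        exact hy.2 v ((hlS v).2 hv) u (hcov u) huv.symm
    · exact hy.2 u ((hlS u).2 hu) v (hcov v) huv

theorem IsSparse.ae_orthoVariety (hG : IsSparse d G) (hd : 0 < d) {l : List V} (hl : l.Nodup)
    (hcov : ∀ v, v ∈ l) (x : V → Vec d) :
    ∀ᵐ y ∂(seqMeasure G ∅ l x), y ∈ orthoVariety G d := by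
  filter_upwards [ae_isOrthoHom_on (fun v N => hG.card_lt hd) hl (by simp) x,
    hG.ae_genPos hd hl x] with y hy hy'
  refine ⟨⟨fun v => hy.1 v (hcov v), fun u v huv => hy.2 u (hcov u) v (Or.inr (hcov v)) huv⟩, ?_⟩
  rw [inGeneralPosition_iff]
  convert hy'
  ext v
  simp [hcov]

theorem seqLaw_eq (hdeg : ∀ (v : V) (N : Finset V), (∀ w ∈ N, G.Adj v w) → N.card < d)
    (p : NodeOrder V) : seqLaw G d p = seqMeasure G ∅ (ordList p ∅) 0 := by
  rw [seqLaw, seqExtension_eq hdeg (startsWith_empty p)]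
  congr 1
  funext v
  simp [extendZero]

theorem IsSparse.ae_seqLaw (hG : IsSparse d G) (hd : 0 < d) (p : NodeOrder V) :
    ∀ᵐ x ∂(seqLaw G d p), x ∈ orthoVariety G d := by
  rw [seqLaw_eq fun v N => hG.card_lt hd]
  exact hG.ae_orthoVariety hd (nodup_ordList p ∅) (by simp) 0

theorem IsSparse.isProbabilityMeasure_seqLaw (hG : IsSparse d G) (hd : 0 < d) (p : NodeOrder V) :
    IsProbabilityMeasure (seqLaw G d p) := by
  rw [seqLaw_eq fun v N => hG.card_lt hd]
  infer_instance

theorem IsSparse.ae_orthoMeasure (hG : IsSparse d G) (hd : 0 < d) (p : NodeOrder V) :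
    ∀ᵐ x ∂(orthoMeasure G d p), x ∈ orthoVariety G d :=
  (withDensity_absolutelyContinuous _ _).ae_le (hG.ae_seqLaw hd p)

/-- Here φ_p is not restricted to Σ_G by definition; sparsity makes the indicator free of charge,
after which the order can be changed. -/
theorem IsSparse.lintegral_orthoMeasure (hG : IsSparse d G) (hd : 0 < d) (p : NodeOrder V)
    {F : (V → Vec d) → ℝ≥0∞} (hF : Measurable F) {l : List V} (hl : l.Nodup)
    (hcov : ∀ v, v ∈ l) :
    ∫⁻ x, F x ∂(orthoMeasure G d p) =
      seqInt G sWeight ∅ l ((orthoVariety G d).indicator F) 0 := by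
  have hdeg : ∀ (v : V) (N : Finset V), (∀ w ∈ N, G.Adj v w) → N.card < d :=
    fun v N => hG.card_lt hd
  have hm : Measurable ((orthoVariety G d).indicator F) := hF.indicator measurableSet_orthoVariety
  have h0 : extendZero (∅ : Set V) (fun v => isEmptyElim v) = (0 : V → Vec d) := by
    funext v
    simp [extendZero]
  calc ∫⁻ x, F x ∂(orthoMeasure G d p)
      = ∫⁻ x, (orthoVariety G d).indicator F x ∂(orthoMeasure G d p) := by
        refine lintegral_congr_ae ?_
        filter_upwards [hG.ae_orthoMeasure hd p] with x hx
        rw [Set.indicator_of_mem hx]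
    _ = seqInt G sWeight ∅ (ordList p ∅) ((orthoVariety G d).indicator F) 0 := by
        rw [orthoMeasure, seqLaw, lintegral_seqExtension_withDensity hdeg (startsWith_empty p) _ hm,
          h0]
    _ = _ := by
        refine seqInt_perm hdeg hm (isSupp_indicator_orthoVariety _) ?_ (Set.subset_univ _)
          (nodup_ordList p ∅) (fun _ _ => Set.mem_univ _) (by simp) _
        rw [List.perm_ext_iff_of_nodup (nodup_ordList p ∅) hl]
        simp [hcov]

theorem IsSparse.orthoMeasure_eq (hG : IsSparse d G) (hd : 0 < d) (p q : NodeOrder V) :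
    orthoMeasure G d p = orthoMeasure G d q := by
  refine Measure.ext_of_lintegral _ fun F hF => ?_
  rw [hG.lintegral_orthoMeasure hd p hF (nodup_ordList p ∅) (by simp),
    hG.lintegral_orthoMeasure hd q hF (nodup_ordList p ∅) (by simp)]

end Bridge

/-! ### Choices in induced subgraphs seen in the whole graph. -/

section Transfer

variable {V W : Type*} [Finite V] [Finite W] {d : ℕ} {G : SimpleGraph V} (f : W ↪ V)

theorem nbrs_map (P : Set W) (w : W) : nbrs G (f '' P) (f w) = (nbrs (G.comap f) P w).map f := by
  ext v
  simp only [mem_nbrs, Finset.mem_map, SimpleGraph.comap_adj, Set.mem_image]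
  constructor
  · rintro ⟨h, a, ha, rfl⟩
    exact ⟨a, ⟨h, ha⟩, rfl⟩
  · rintro ⟨a, ⟨h, ha⟩, rfl⟩
    exact ⟨h, a, ha, rfl⟩

theorem genDet_map (x : V → Vec d) (N : Finset W) :
    genDet x (N.map f) = genDet (x ∘ f) N := by
  classical
  rw [genDet_eq, genDet_eq]
  congr 1
  let e : N ≃ N.map f := Equiv.ofBijective
    (fun a => ⟨f a, Finset.mem_map_of_mem f a.2⟩)
    ⟨fun a b h => Subtype.ext (f.injective (Subtype.ext_iff.1 h)), fun b => by
      obtain ⟨a, ha, hab⟩ := Finset.mem_map.1 b.2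
      exact ⟨⟨a, ha⟩, Subtype.ext hab⟩⟩
  rw [← Matrix.det_submatrix_equiv_self e]
  rfl

theorem sWeight_map (x : V → Vec d) (N : Finset W) :
    sWeight x (N.map f) = sWeight (x ∘ f) N := by
  simp only [sWeight, sDensity, genDet_map, Finset.card_map]

theorem pick_map (x : V → Vec d) (N : Finset W) (g : Vec d) :
    pick x (N.map f) g = pick (x ∘ f) N g := by
  have e : x '' ((N.map f : Finset V) : Set V) = (x ∘ f) '' (N : Set W) := by
    rw [Finset.coe_map, Set.image_comp]
  simp only [pick, e]

theorem choose_map_comp (x : V → Vec d) (N : Finset W) (w : W) (g : Vec d) :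
    choose x (N.map f) (f w) g ∘ f = choose (x ∘ f) N w g := by
  funext a
  by_cases h : a = w
  · subst h
    rw [Function.comp_apply, choose_self, choose_self, pick_map]
  · rw [Function.comp_apply, choose_of_ne _ _ (fun e => h (f.injective e)), choose_of_ne _ _ h,
      Function.comp_apply]

theorem extend_choose (y : W → Vec d) (x : V → Vec d) (N : Finset V) (w : W) (g : Vec d) :
    Function.extend f y (choose x N (f w) g) = Function.extend f y x := by
  funext v
  by_cases h : ∃ a, f a = v
  · obtain ⟨a, rfl⟩ := h
    rw [f.injective.extend_apply, f.injective.extend_apply]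
  · rw [Function.extend_apply' _ _ _ h, Function.extend_apply' _ _ _ h, choose_of_ne]
    rintro rfl
    exact h ⟨w, rfl⟩

/-- The iterated integral over choices in a subgraph. -/
theorem seqInt_map {s : (V → Vec d) → Finset V → ℝ≥0∞} {s' : (W → Vec d) → Finset W → ℝ≥0∞}
    (hs : ∀ x N, s x (N.map f) = s' (x ∘ f) N) (P : Set W) (l : List W)
    (F : (V → Vec d) → ℝ≥0∞) (x : V → Vec d) :
    seqInt G s (f '' P) (l.map f) F x =
      seqInt (G.comap f) s' P l (fun y => F (Function.extend f y x)) (x ∘ f) := by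
  induction l generalizing P x with
  | nil =>
    simp only [List.map_nil, seqInt]
    congr 1
    funext v
    by_cases h : ∃ a, f a = v
    · obtain ⟨a, rfl⟩ := h
      rw [f.injective.extend_apply, Function.comp_apply]
    · rw [Function.extend_apply' _ _ _ h]
  | cons w l ih =>
    simp only [List.map_cons, seqInt]
    rw [nbrs_map, hs, ← Set.image_insert_eq]
    congr 1
    refine lintegral_congr fun g => ?_
    rw [ih, choose_map_comp]
    simp_rw [extend_choose]

theorem extend_val_zero (S : Set V) (y : S → Vec d) :
    Function.extend (Function.Embedding.subtype (· ∈ S)) y 0 = extendZero S y := by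
  funext v
  by_cases h : v ∈ S
  · rw [extendZero_of_mem y h]
    exact (Function.Embedding.subtype (· ∈ S)).injective.extend_apply y 0 ⟨v, h⟩
  · rw [extendZero_of_notMem y h, Function.extend_apply']
    · rfl
    · rintro ⟨a, rfl⟩
      exact h a.2

theorem IsSparse.induce (hG : IsSparse d G) (S : Set V) : IsSparse d (G.induce S) :=
  hG.comap _

theorem IsSparse.ae_seqExtension (hG : IsSparse d G) (hd : 0 < d) (S : Set V) (q : NodeOrder S) :
    ∀ᵐ z ∂(orthoMeasure (G.induce S) d q), ∀ p : NodeOrder V, StartsWith p S →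
      ∀ᵐ x ∂(seqExtension G p S z), x ∈ orthoVariety G d := by
  classical
  have hdeg : ∀ (v : V) (N : Finset V), (∀ w ∈ N, G.Adj v w) → N.card < d :=
    fun v N => hG.card_lt hd
  refine (withDensity_absolutelyContinuous (seqLaw (G.induce S) d q) _).ae_le ?_
  have : Countable (NodeOrder V) := Finite.to_countable
  refine ae_all_iff.2 fun p => ?_
  by_cases hp : StartsWith p S
  swap
  · simp [hp]
  set f := Function.Embedding.subtype (· ∈ S) with hf
  have hS := (measurableSet_orthoVariety (G := G) (d := d)).compl
  have hm : Measurable ((orthoVariety G d)ᶜ.indicator (1 : (V → Vec d) → ℝ≥0∞)) :=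
    measurable_one.indicator hS
  set K := seqInt G (fun (_ : V → Vec d) _ => 1) S (ordList p S) ((orthoVariety G d)ᶜ.indicator 1)
    with hK
  -- Processing `S` in the order `q` and then the rest in the order `p` is a sequential choice on
  -- all of `G`, so it almost surely ends in Σ_G.
  have hl : ((ordList q ∅).map f ++ ordList p S).Nodup := by
    refine List.nodup_append.2 ⟨(nodup_ordList q ∅).map f.injective, nodup_ordList p S, ?_⟩
    rintro a ha b hb rfl
    obtain ⟨c, -, rfl⟩ := List.mem_map.1 ha
    exact mem_ordList.1 hb c.2
  have h0 := hG.ae_orthoVariety hd hl (fun v => by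
    rw [List.mem_append, mem_ordList]
    by_cases h : v ∈ S
    · exact Or.inl (List.mem_map.2 ⟨⟨v, h⟩, by simp, rfl⟩)
    · exact Or.inr h) (0 : V → Vec d)
  change seqMeasure G ∅ _ 0 (orthoVariety G d)ᶜ = 0 at h0
  rw [seqMeasure_apply hS, seqInt_append] at h0
  have e : (∅ ∪ {v | v ∈ (ordList q ∅).map f} : Set V) = S := by
    ext v
    simp [hf]
  rw [e, ← hK, ← Set.image_empty f, seqInt_map f (s' := fun _ _ => 1) (fun _ _ => rfl)] at h0
  simp_rw [hf, extend_val_zero] at h0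
  have hKm : Measurable fun y : S → Vec d => K (extendZero S y) :=
    (measurable_seqInt isWeight_one hm _ _).comp (measurable_extendZero S)
  -- `K` is the probability of failure given the first stage; its mean is 0, so it vanishes almost
  -- surely.
  have h1 : ∫⁻ y, K (extendZero S y) ∂(seqLaw (G.induce S) d q) = 0 := by
    rw [seqLaw_eq fun v N => (hG.induce S).card_lt hd, lintegral_seqMeasure hKm]
    exact h0
  rw [lintegral_eq_zero_iff hKm] at h1
  filter_upwards [h1] with z hz _
  change seqExtension G p S z (orthoVariety G d)ᶜ = 0
  rw [seqExtension_eq hdeg hp, seqMeasure_apply hS]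
  exact hz

end Transfer

/-! ### Flipping two consecutive nodes of an ordering. -/

section Flip

variable {V : Type*} [Finite V] {d : ℕ} {G : SimpleGraph V} {p : NodeOrder V} {u v : V}

theorem mem_earlier {p : NodeOrder V} {v w : V} :
    w ∈ earlier G p v ↔ G.Adj v w ∧ p w < p v := by
  simp [earlier]

theorem flipOrder_left (p : NodeOrder V) (u v : V) : flipOrder p u v u = p v := by
  simp [flipOrder]

theorem flipOrder_right (p : NodeOrder V) (u v : V) : flipOrder p u v v = p u := by
  simp [flipOrder]

theorem flipOrder_of_ne (p : NodeOrder V) {u v w : V} (hu : w ≠ u) (hv : w ≠ v) :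
    flipOrder p u v w = p w := by
  rw [flipOrder, Equiv.trans_apply, Equiv.swap_apply_of_ne_of_ne]
  · exact fun h => hu (p.injective h)
  · exact fun h => hv (p.injective h)

theorem val_ne_of_ne (p : NodeOrder V) {u v : V} (h : u ≠ v) : (p u : ℕ) ≠ p v :=
  fun e => h (p.injective (Fin.ext e))

theorem flipOrder_lt_iff (h : (p v : ℕ) = (p u : ℕ) + 1) {a w : V} (hu : w ≠ u) (hv : w ≠ v) :
    flipOrder p u v a < flipOrder p u v w ↔ p a < p w := by
  have h1 := val_ne_of_ne p hu
  have h2 := val_ne_of_ne p hv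
  rw [flipOrder_of_ne p hu hv]
  by_cases hau : a = u
  · subst hau
    rw [flipOrder_left, Fin.lt_def, Fin.lt_def]
    omega
  · by_cases hav : a = v
    · subst hav
      rw [flipOrder_right, Fin.lt_def, Fin.lt_def]
      omega
    · rw [flipOrder_of_ne p hau hav]

theorem earlier_flipOrder_of_ne (h : (p v : ℕ) = (p u : ℕ) + 1) {w : V} (hu : w ≠ u)
    (hv : w ≠ v) : earlier G (flipOrder p u v) w = earlier G p w := by
  ext a
  rw [mem_earlier, mem_earlier, flipOrder_lt_iff h hu hv]

open scoped Classical in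
theorem earlier_right (hadj : G.Adj u v) (h : (p v : ℕ) = (p u : ℕ) + 1) :
    earlier G p v = insert u (earlier G (flipOrder p u v) v) := by
  ext a
  rw [Finset.mem_insert, mem_earlier, mem_earlier, flipOrder_right]
  by_cases hau : a = u
  · subst hau
    exact ⟨fun _ => Or.inl rfl, fun _ => ⟨hadj.symm, by rw [Fin.lt_def]; omega⟩⟩
  · by_cases hav : a = v
    · subst hav
      simp [hau]
    · have h1 := val_ne_of_ne p hau
      rw [flipOrder_of_ne p hau hav, Fin.lt_def, Fin.lt_def]
      simp only [hau, false_or]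
      exact and_congr_right fun _ => by omega

open scoped Classical in
theorem earlier_flipOrder_left (hadj : G.Adj u v) (h : (p v : ℕ) = (p u : ℕ) + 1) :
    earlier G (flipOrder p u v) u = insert v (earlier G p u) := by
  ext a
  rw [Finset.mem_insert, mem_earlier, mem_earlier, flipOrder_left]
  by_cases hav : a = v
  · subst hav
    exact ⟨fun _ => Or.inl rfl, fun _ => ⟨hadj, by rw [flipOrder_right, Fin.lt_def]; omega⟩⟩
  · by_cases hau : a = u
    · subst hau
      simp [hav]
    · have h1 := val_ne_of_ne p hau
      rw [flipOrder_of_ne p hau hav, Fin.lt_def, Fin.lt_def]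
      simp only [hav, false_or]
      exact and_congr_right fun _ => by omega

theorem card_earlier_right (hadj : G.Adj u v) (h : (p v : ℕ) = (p u : ℕ) + 1) :
    (earlier G p v).card = (earlier G (flipOrder p u v) v).card + 1 := by
  classical
  rw [earlier_right hadj h, Finset.card_insert_of_notMem]
  rw [mem_earlier, flipOrder_left, flipOrder_right, Fin.lt_def]
  omega

theorem card_earlier_flipOrder_left (hadj : G.Adj u v) (h : (p v : ℕ) = (p u : ℕ) + 1) :
    (earlier G (flipOrder p u v) u).card = (earlier G p u).card + 1 := by
  classical
  rw [earlier_flipOrder_left hadj h, Finset.card_insert_of_notMem]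
  rw [mem_earlier, Fin.lt_def]
  omega

theorem linearIndepOn_of_mem_orthoVariety
    (hdeg : ∀ (v : V) (N : Finset V), (∀ w ∈ N, G.Adj v w) → N.card < d) {x : V → Vec d}
    (hx : x ∈ orthoVariety G d) (p : NodeOrder V) (v : V) :
    LinearIndepOn ℝ x (earlier G p v : Set V) :=
  hx.2 _ (hdeg v _ fun _ hw => (mem_earlier.1 hw).1).le

theorem sDensity_flipOrder
    (hdeg : ∀ (v : V) (N : Finset V), (∀ w ∈ N, G.Adj v w) → N.card < d)
    (hadj : G.Adj u v) (h : (p v : ℕ) = (p u : ℕ) + 1)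
    {x : V → Vec d} (hx : x ∈ orthoVariety G d) :
    ENNReal.ofReal (sDensity x (earlier G p u)) * ENNReal.ofReal (sDensity x (earlier G p v)) =
      swapDensity G p (flipOrder p u v) u v x *
        (ENNReal.ofReal (sDensity x (earlier G (flipOrder p u v) u)) *
          ENNReal.ofReal (sDensity x (earlier G (flipOrder p u v) v))) := by
  have li := linearIndepOn_of_mem_orthoVariety hdeg hx
  have pos : ∀ (p : NodeOrder V) w, 0 < sDensity x (earlier G p w) := fun p w =>
    sDensity_pos (li p w)
  have g1 := genDet_pos (li p u)
  have g2 := genDet_pos (li p v)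
  have g3 := genDet_pos (li (flipOrder p u v) u)
  have g4 := genDet_pos (li (flipOrder p u v) v)
  have c1 := card_earlier_right hadj h
  have c2 := card_earlier_flipOrder_left hadj h
  have A := fun k => sphereArea_pos k
  rw [swapDensity, ← ENNReal.ofReal_mul (pos _ _).le, ← ENNReal.ofReal_mul (pos _ _).le,
    ← ENNReal.ofReal_mul]
  · congr 1
    rw [sDensity, sDensity, sDensity, sDensity, c1, c2]
    generalize (earlier G p u).card = n
    generalize (earlier G (flipOrder p u v) v).card = m
    have h0 := A (d - 1)
    have h1 := A (d - 2)
    have h2 := A (d - n - 1)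
    have h3 := A (d - m - 1)
    have h4 := A (d - (n + 1) - 1)
    have h5 := A (d - (m + 1) - 1)
    rw [zpow_sub_one₀ h0.ne', zpow_sub_one₀ h0.ne', zpow_sub_one₀ h0.ne', zpow_sub_one₀ h0.ne',
      zpow_natCast, zpow_natCast, zpow_natCast, zpow_natCast, pow_succ, pow_succ, pow_succ,
      pow_succ]
    field_simp
  · exact mul_nonneg (div_nonneg (mul_nonneg (A _).le (A _).le) (mul_nonneg (A _).le (A _).le))
      (div_nonneg (mul_nonneg g3.le g4.le) (mul_nonneg g1.le g2.le))

theorem weight_flipOrder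
    (hdeg : ∀ (v : V) (N : Finset V), (∀ w ∈ N, G.Adj v w) → N.card < d)
    (hadj : G.Adj u v) (h : (p v : ℕ) = (p u : ℕ) + 1)
    {x : V → Vec d} (hx : x ∈ orthoVariety G d) :
    weight G p ∅ x = swapDensity G p (flipOrder p u v) u v x * weight G (flipOrder p u v) ∅ x := by
  classical
  have hu : u ∈ (Set.toFinite (∅ : Set V)ᶜ).toFinset := by simp
  have hv : v ∈ (Set.toFinite (∅ : Set V)ᶜ).toFinset.erase u := by simp [hadj.ne']
  rw [weight, weight, ← Finset.mul_prod_erase _ _ hu, ← Finset.mul_prod_erase _ _ hv,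
    ← Finset.mul_prod_erase _ _ hu, ← Finset.mul_prod_erase _ _ hv, ← mul_assoc, ← mul_assoc,
    sDensity_flipOrder hdeg hadj h hx]
  have hprod : ∏ w ∈ ((Set.toFinite (∅ : Set V)ᶜ).toFinset.erase u).erase v,
      ENNReal.ofReal (sDensity x (earlier G p w)) =
      ∏ w ∈ ((Set.toFinite (∅ : Set V)ᶜ).toFinset.erase u).erase v,
        ENNReal.ofReal (sDensity x (earlier G (flipOrder p u v) w)) := by
    refine Finset.prod_congr rfl fun w hw => ?_
    simp only [Finset.mem_erase] at hw
    rw [earlier_flipOrder_of_ne h hw.2.1 hw.1]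
  rw [hprod]
  ring

theorem weight_ne_zero
    (hdeg : ∀ (v : V) (N : Finset V), (∀ w ∈ N, G.Adj v w) → N.card < d) (p : NodeOrder V)
    (S : Set V) {x : V → Vec d} (hx : x ∈ orthoVariety G d) : weight G p S x ≠ 0 := by
  rw [weight]
  refine Finset.prod_ne_zero_iff.2 fun v _ => ?_
  exact (ENNReal.ofReal_pos.2
    (sDensity_pos (linearIndepOn_of_mem_orthoVariety hdeg hx p v))).ne'

theorem weight_ne_top (p : NodeOrder V) (S : Set V) (x : V → Vec d) : weight G p S x ≠ ∞ := by
  rw [weight]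
  exact ENNReal.prod_ne_top fun _ _ => ENNReal.ofReal_ne_top

theorem measurable_genDet (N : Finset V) : Measurable fun x : V → Vec d => genDet x N :=
  (continuous_genDet N).measurable

theorem measurable_swapDensity (p r : NodeOrder V) (u v : V) :
    Measurable (swapDensity G p r u v : (V → Vec d) → ℝ≥0∞) :=
  ((((measurable_genDet _).mul (measurable_genDet _)).div
    ((measurable_genDet _).mul (measurable_genDet _))).const_mul _).ennreal_ofReal

/-- Both laws are recovered from the same φ by dividing by their weights, which are positive and
finite on Σ_G. The density is therefore the ratio of the weights, in which only the factors of `u`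
and `v` differ. -/
theorem IsSparse.seqLaw_flipOrder (hG : IsSparse d G) (hd : 0 < d)
    (hadj : G.Adj u v) (h : (p v : ℕ) = (p u : ℕ) + 1) :
    seqLaw G d (flipOrder p u v) =
      (seqLaw G d p).withDensity (swapDensity G p (flipOrder p u v) u v) := by
  have hdeg : ∀ (v : V) (N : Finset V), (∀ w ∈ N, G.Adj v w) → N.card < d :=
    fun v N => hG.card_lt hd
  set r := flipOrder p u v with hr
  have hwp := measurable_weight (G := G) (d := d) (startsWith_empty p)
  have hwr := measurable_weight (G := G) (d := d) (startsWith_empty r)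
  refine Measure.ext_of_lintegral _ fun F hF => ?_
  have hm : Measurable fun x => (weight G r ∅ x)⁻¹ * F x := hwr.inv.mul hF
  calc ∫⁻ x, F x ∂(seqLaw G d r)
      = ∫⁻ x, weight G r ∅ x * ((weight G r ∅ x)⁻¹ * F x) ∂(seqLaw G d r) := by
        refine lintegral_congr_ae ?_
        filter_upwards [hG.ae_seqLaw hd r] with x hx
        rw [← mul_assoc,
          ENNReal.mul_inv_cancel (weight_ne_zero hdeg r ∅ hx) (weight_ne_top r ∅ x), one_mul]
    _ = ∫⁻ x, (weight G r ∅ x)⁻¹ * F x ∂(orthoMeasure G d r) :=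
        (lintegral_withDensity_eq_lintegral_mul _ hwr hm).symm
    _ = ∫⁻ x, (weight G r ∅ x)⁻¹ * F x ∂(orthoMeasure G d p) := by
        rw [hG.orthoMeasure_eq hd r p]
    _ = ∫⁻ x, weight G p ∅ x * ((weight G r ∅ x)⁻¹ * F x) ∂(seqLaw G d p) :=
        lintegral_withDensity_eq_lintegral_mul _ hwp hm
    _ = ∫⁻ x, swapDensity G p r u v x * F x ∂(seqLaw G d p) := by
        refine lintegral_congr_ae ?_
        filter_upwards [hG.ae_seqLaw hd p] with x hx
        rw [weight_flipOrder hdeg hadj h hx, mul_assoc,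
          ← mul_assoc (weight G (flipOrder p u v) ∅ x),
          ENNReal.mul_inv_cancel (weight_ne_zero hdeg _ ∅ hx) (weight_ne_top _ ∅ x), one_mul]
    _ = _ := (lintegral_withDensity_eq_lintegral_mul _ (measurable_swapDensity p r u v) hF).symm

theorem IsSparse.seqLaw_absolutelyContinuous_flipOrder (hG : IsSparse d G) (hd : 0 < d)
    (hadj : G.Adj u v) (h : (p v : ℕ) = (p u : ℕ) + 1) :
    seqLaw G d p ≪ seqLaw G d (flipOrder p u v) := by
  rw [hG.seqLaw_flipOrder hd hadj h]
  refine withDensity_absolutelyContinuous' (measurable_swapDensity _ _ _ _).aemeasurable ?_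
  filter_upwards [hG.ae_seqLaw hd p] with x hx h0
  have := weight_flipOrder (fun v N => hG.card_lt hd) hadj h hx
  rw [h0, zero_mul] at this
  exact weight_ne_zero (fun v N => hG.card_lt hd) p ∅ hx this

/-! ### The measure is Radon -/

theorem IsSparse.orthoMeasure_ne_zero (hG : IsSparse d G) (hd : 0 < d) (p : NodeOrder V) :
    orthoMeasure G d p ≠ 0 := by
  have := hG.isProbabilityMeasure_seqLaw hd p
  have hw := measurable_weight (G := G) (d := d) (startsWith_empty p)
  intro h0
  rw [orthoMeasure, withDensity_eq_zero_iff hw.aemeasurable] at h0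
  obtain ⟨x, hx0, hx⟩ := (h0.and (hG.ae_seqLaw hd p)).exists
  exact weight_ne_zero (fun v N => hG.card_lt hd) p ∅ hx hx0

/-- Norm and orthogonality conditions are closed, independence is open. This makes Σ_G locally
compact, so that local finiteness is enough for the Radon property. -/
theorem isLocallyClosed_orthoVariety : IsLocallyClosed (orthoVariety G d) := by
  have hc : IsClosed {x : V → Vec d | IsOrthoHom G x} := by
    have h1 : IsClosed {x : V → Vec d | ∀ v, ‖x v‖ = 1} := by
      rw [Set.ofPred_forall]
      exact isClosed_iInter fun v => isClosed_eq (by fun_prop) continuous_const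
    have h2 : IsClosed {x : V → Vec d | ∀ u v, G.Adj u v → ⟪x u, x v⟫_ℝ = 0} := by
      simp only [Set.ofPred_forall]
      exact isClosed_iInter fun u => isClosed_iInter fun v => isClosed_iInter fun _ =>
        isClosed_eq ((continuous_apply u).inner (continuous_apply v)) continuous_const
    exact h1.inter h2
  have ho : IsOpen (genPos univ : Set (V → Vec d)) := by
    simp only [genPos, Set.ofPred_forall]
    exact isOpen_iInter_of_finite fun W => isOpen_iInter_of_finite fun _ =>
      isOpen_iInter_of_finite fun _ => isOpen_linearIndepOn W
  rw [orthoVariety_eq]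
  exact hc.isLocallyClosed.inter ho.isLocallyClosed

theorem continuousAt_sDensity {x : V → Vec d} {N : Finset V} (h : LinearIndepOn ℝ x N) :
    ContinuousAt (fun y => sDensity y N) x :=
  continuousAt_const.mul (continuousAt_const.div (continuous_genDet N).continuousAt
    (genDet_pos h).ne')

/-- The weights are unbounded in general, but they are continuous at points of Σ_G, hence bounded
nearby, and ρ_p is a probability measure. -/
theorem IsSparse.exists_isOpen_orthoMeasure_lt_top (hG : IsSparse d G) (hd : 0 < d)
    (p : NodeOrder V) {x : V → Vec d} (hx : x ∈ orthoVariety G d) :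
    ∃ U, IsOpen U ∧ x ∈ U ∧ orthoMeasure G d p U < ∞ := by
  have := hG.isProbabilityMeasure_seqLaw hd p
  have hev : ∀ᶠ y in nhds x, ∀ v, sDensity y (earlier G p v) < sDensity x (earlier G p v) + 1 :=
    Filter.eventually_all.2 fun v => (continuousAt_sDensity
      (linearIndepOn_of_mem_orthoVariety (fun v N => hG.card_lt hd) hx p v)).eventually
        (gt_mem_nhds (lt_add_one _))
  obtain ⟨U, hU, hUo, hxU⟩ := mem_nhds_iff.1 hev
  refine ⟨U, hUo, hxU, ?_⟩
  set c : ℝ≥0∞ := ∏ v ∈ (Set.toFinite (∅ : Set V)ᶜ).toFinset,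
    ENNReal.ofReal (sDensity x (earlier G p v) + 1) with hc
  have hct : c < ∞ := (ENNReal.prod_ne_top fun _ _ => ENNReal.ofReal_ne_top).lt_top
  rw [orthoMeasure, withDensity_apply _ hUo.measurableSet]
  calc ∫⁻ y in U, weight G p ∅ y ∂(seqLaw G d p) ≤ ∫⁻ y in U, c ∂(seqLaw G d p) :=
        setLIntegral_mono measurable_const fun y hy =>
          Finset.prod_le_prod' fun v _ => ENNReal.ofReal_le_ofReal (hU hy v).le
    _ = c * seqLaw G d p U := by rw [setLIntegral_const]
    _ < ∞ := ENNReal.mul_lt_top hct (measure_lt_top _ _)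

theorem IsSparse.regular_orthoMeasure (hG : IsSparse d G) (hd : 0 < d) (p : NodeOrder V) :
    ((orthoMeasure G d p).comap (Subtype.val : orthoVariety G d → V → Vec d)).Regular := by
  have : LocallyCompactSpace (orthoVariety G d) := isLocallyClosed_orthoVariety.locallyCompactSpace
  have : IsLocallyFiniteMeasure
      ((orthoMeasure G d p).comap (Subtype.val : orthoVariety G d → V → Vec d)) := by
    refine ⟨fun x => ?_⟩
    obtain ⟨U, hU, hxU, hlt⟩ := hG.exists_isOpen_orthoMeasure_lt_top hd p x.2
    refine ⟨Subtype.val ⁻¹' U, (hU.preimage continuous_subtype_val).mem_nhds hxU, ?_⟩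
    rw [(MeasurableEmbedding.subtype_coe measurableSet_orthoVariety).comap_apply]
    exact (measure_mono (Set.image_preimage_subset _ _)).trans_lt hlt
  infer_instance

end Flip

/-! ### The disintegration identity and its normalized version. -/

section Conditioning

variable {V : Type*} [Finite V] {d : ℕ} {G : SimpleGraph V}

/-- The elements of a set, as a list. -/
def nodeList (A : Set V) : List V := (Set.toFinite A).toFinset.toList

@[simp] theorem mem_nodeList {A : Set V} {v : V} : v ∈ nodeList A ↔ v ∈ A := by
  simp [nodeList]

theorem nodup_nodeList (A : Set V) : (nodeList A).Nodup := Finset.nodup_toList _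

theorem linearIndepOn_map {W : Type*} (f : W ↪ V) {x : V → Vec d} {N : Finset W} :
    LinearIndepOn ℝ x (N.map f : Finset V) ↔ LinearIndepOn ℝ (x ∘ f) (N : Set W) := by
  rw [Finset.coe_map]
  exact ⟨fun h => h.comp_of_image f.injective.injOn, fun h => h.image_of_comp⟩

theorem restrict_mem_orthoVariety {x : V → Vec d} (hx : x ∈ orthoVariety G d) (S : Set V) :
    (fun v : S => x v) ∈ orthoVariety (G.induce S) d := by
  refine ⟨⟨fun v => hx.1.1 v, fun u v h => hx.1.2 u v h⟩, fun W hW => ?_⟩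
  have h1 : LinearIndepOn ℝ x ((W.map (Function.Embedding.subtype (· ∈ S)) : Finset V) : Set V) :=
    hx.2 _ (by rwa [Finset.card_map])
  have h2 := (linearIndepOn_map (Function.Embedding.subtype (· ∈ S))).1 h1
  exact h2

theorem extendZero_mem_genPos {S : Set V} {z : S → Vec d} (hz : InGeneralPosition z) :
    extendZero S z ∈ genPos S := by
  classical
  intro W hW hWd
  have e : W = (W.subtype (· ∈ S)).map (Function.Embedding.subtype (· ∈ S)) := by
    rw [Finset.subtype_map, Finset.filter_true_of_mem fun v hv => hW hv]
  rw [e, linearIndepOn_map]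
  have h1 : extendZero S z ∘ Function.Embedding.subtype (· ∈ S) = z := by
    funext v
    exact extendZero_of_mem z v.2
  rw [h1]
  refine hz _ ((Finset.card_map (Function.Embedding.subtype (· ∈ S))).symm.trans_le ?_)
  rwa [← e]

/-- The measure of the induced subgraph is rewritten as an integral over choices in `G`, so that it
can be composed with φ_{zy} in one iterated integral. -/
theorem lintegral_inducedMeasure
    (hdeg : ∀ (v : V) (N : Finset V), (∀ w ∈ N, G.Adj v w) → N.card < d)
    {S T : Set V} (hTS : T ⊆ S) (z : T → Vec d) {F : (↥(S \ T) → Vec d) → ℝ≥0∞}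
    (hF : Measurable F) {l : List V} (hl : l.Nodup) (hlS : ∀ v, v ∈ l ↔ v ∈ S \ T) :
    ∫⁻ y, F y ∂(inducedMeasure G d S T z) = seqInt G sWeight T l
      ({x | (fun v : S => x v) ∈ orthoVariety (G.induce S) d}.indicator
        fun x => F fun v : ↥(S \ T) => x v) (extendZero T z) := by
  set f := Function.Embedding.subtype (· ∈ S) with hf
  have hdeg' : ∀ (v : S) (N : Finset S), (∀ w ∈ N, (G.induce S).Adj v w) → N.card < d := by
    intro v N hN
    rw [← Finset.card_map f]
    refine hdeg v _ fun w hw => ?_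
    obtain ⟨a, ha, rfl⟩ := Finset.mem_map.1 hw
    exact hN a ha
  set l' : List S := l.pmap Subtype.mk fun v hv => ((hlS v).1 hv).1 with hl'
  have hmap : l'.map f = l := by
    rw [hl', List.map_pmap]
    simp [hf]
  have hnd : l'.Nodup := List.Nodup.of_map f (hmap ▸ hl)
  have hψ : Measurable fun (y : ↥({s : S | (s : V) ∈ T}ᶜ : Set S) → Vec d) (v : ↥(S \ T)) =>
      y ⟨⟨v.1, v.2.1⟩, v.2.2⟩ := measurable_pi_iff.2 fun v => measurable_pi_apply _
  have hT : f '' {s : S | (s : V) ∈ T} = T := by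
    ext v
    simp only [hf, Set.mem_image, Set.mem_ofPred_eq, Function.Embedding.subtype_apply,
      Subtype.exists, exists_and_left, exists_prop, exists_eq_right_right]
    exact ⟨fun h => h.1, fun h => ⟨h, hTS h⟩⟩
  have hFψ := hF.comp hψ
  rw [inducedMeasure, lintegral_map hF hψ]
  refine (lintegral_condMeasure hdeg' _ hFψ hnd fun s => ?_).trans ?_
  · rw [← List.mem_map_of_injective f.injective, hmap, hlS]
    exact ⟨fun h => h.2, fun h => ⟨s.2, h⟩⟩
  have key := seqInt_map (G := G) f (fun x N => sWeight_map f x N) {s : S | (s : V) ∈ T} l'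
    ({x | (fun v : S => x v) ∈ orthoVariety (G.induce S) d}.indicator
        fun x => F fun v : ↥(S \ T) => x v) (extendZero T z)
  rw [hT, hmap] at key
  rw [key]
  have hx0 : extendZero T z ∘ f = extendZero {s : S | (s : V) ∈ T} fun t => z ⟨t.1.1, t.2⟩ := by
    funext s
    by_cases h : (s : V) ∈ T
    · rw [Function.comp_apply, extendZero_of_mem (S := {s : S | (s : V) ∈ T}) _ h]
      exact extendZero_of_mem z h
    · rw [Function.comp_apply, extendZero_of_notMem (S := {s : S | (s : V) ∈ T}) _ h]
      exact extendZero_of_notMem z h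
  rw [hx0]
  refine seqInt_congr_fun fun y _ => ?_
  have hext : ∀ v : S, Function.extend f y (extendZero T z) v = y v := fun v =>
    f.injective.extend_apply y _ v
  have hres : (fun v : S => Function.extend f y (extendZero T z) v) = y := funext hext
  have hiff : Function.extend f y (extendZero T z) ∈
      {x : V → Vec d | (fun v : S => x v) ∈ orthoVariety (G.induce S) d} ↔
      y ∈ orthoVariety (G.induce S) d := by
    rw [Set.mem_ofPred_eq, hres]
  by_cases hy : y ∈ orthoVariety (G.induce S) d
  · rw [Set.indicator_of_mem hy, Set.indicator_of_mem (hiff.2 hy)]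
    simp only [Function.comp_apply]
    congr 1
    funext v
    exact (hext ⟨v.1, v.2.1⟩).symm
  · rw [Set.indicator_of_notMem hy, Set.indicator_of_notMem fun h => hy (hiff.1 h)]

theorem measurable_glue {V Ω : Type*} [MeasurableSpace Ω] {S T : Set V} (z : T → Ω) :
    Measurable (glue z : (↥(S \ T) → Ω) → S → Ω) := by
  refine measurable_pi_iff.2 fun s => ?_
  by_cases h : (s : V) ∈ T
  · simp only [glue, h, dif_pos]
    exact measurable_const
  · simp only [glue, h, dif_neg, not_false_eq_true]
    exact measurable_pi_apply _

theorem condMeasure_apply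
    (hdeg : ∀ (v : V) (N : Finset V), (∀ w ∈ N, G.Adj v w) → N.card < d)
    {S : Set V} (z : S → Vec d) {B : Set (↥Sᶜ → Vec d)} (hB : MeasurableSet B) {l : List V}
    (hl : l.Nodup) (hlS : ∀ v, v ∈ l ↔ v ∉ S) :
    condMeasure G d S z B = seqInt G sWeight S l ((orthoVariety G d).indicator
      fun x => B.indicator 1 fun v : ↥Sᶜ => x v) (extendZero S z) := by
  rw [← lintegral_indicator_one hB,
    lintegral_condMeasure hdeg z (measurable_one.indicator hB) hl hlS]

theorem measurable_condMeasure_apply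
    (hdeg : ∀ (v : V) (N : Finset V), (∀ w ∈ N, G.Adj v w) → N.card < d)
    (S : Set V) {B : Set (↥Sᶜ → Vec d)} (hB : MeasurableSet B) :
    Measurable fun z : S → Vec d => condMeasure G d S z B := by
  simp_rw [condMeasure_apply hdeg _ hB (nodup_nodeList Sᶜ) fun v => mem_nodeList]
  exact (measurable_seqInt isWeight_sWeight
    (measurable_condIntegrand (measurable_one.indicator hB)) _ _).comp (measurable_extendZero S)

theorem condMeasure_disintegration
    (hdeg : ∀ (v : V) (N : Finset V), (∀ w ∈ N, G.Adj v w) → N.card < d)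
    {T S : Set V} (hTS : T ⊆ S) (z : T → Vec d) {B : Set (↥(S \ T) → Vec d)}
    {C : Set (↥Sᶜ → Vec d)} (hB : MeasurableSet B) (hC : MeasurableSet C) :
    condMeasure G d T z {w | (fun v : ↥(S \ T) => w ⟨v.1, v.2.2⟩) ∈ B ∧
        (fun v : ↥Sᶜ => w ⟨v.1, fun h => v.2 (hTS h)⟩) ∈ C}
      = ∫⁻ y in B, condMeasure G d S (glue z y) C ∂(inducedMeasure G d S T z) := by
  set E : Set (↥Tᶜ → Vec d) := {w | (fun v : ↥(S \ T) => w ⟨v.1, v.2.2⟩) ∈ B ∧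
        (fun v : ↥Sᶜ => w ⟨v.1, fun h => v.2 (hTS h)⟩) ∈ C} with hE
  have hEm : MeasurableSet E := by
    have m1 : Measurable fun (w : ↥Tᶜ → Vec d) (v : ↥(S \ T)) => w ⟨v.1, v.2.2⟩ :=
      measurable_pi_iff.2 fun v => measurable_pi_apply _
    have m2 : Measurable fun (w : ↥Tᶜ → Vec d) (v : ↥Sᶜ) => w ⟨v.1, fun h => v.2 (hTS h)⟩ :=
      measurable_pi_iff.2 fun v => measurable_pi_apply _
    exact (m1 hB).inter (m2 hC)
  have hl : (nodeList (S \ T) ++ nodeList Sᶜ).Nodup := by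
    refine List.nodup_append.2 ⟨nodup_nodeList _, nodup_nodeList _, ?_⟩
    rintro a ha b hb rfl
    exact (mem_nodeList.1 hb) (mem_nodeList.1 ha).1
  have hlT : ∀ v, v ∈ nodeList (S \ T) ++ nodeList Sᶜ ↔ v ∉ T := by
    intro v
    rw [List.mem_append, mem_nodeList, mem_nodeList]
    refine ⟨?_, fun h => ?_⟩
    · rintro (h | h)
      · exact h.2
      · exact fun h' => h (hTS h')
    · by_cases hv : v ∈ S
      · exact Or.inl ⟨hv, h⟩
      · exact Or.inr hv
  have hU : T ∪ {v | v ∈ nodeList (S \ T)} = S := by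
    ext v
    simp only [Set.mem_union, Set.mem_ofPred_eq, mem_nodeList]
    refine ⟨?_, fun h => ?_⟩
    · rintro (h | h)
      · exact hTS h
      · exact h.1
    · by_cases hv : v ∈ T
      · exact Or.inl hv
      · exact Or.inr ⟨h, hv⟩
  have hκ : Measurable fun y : ↥(S \ T) → Vec d => condMeasure G d S (glue z y) C :=
    (measurable_condMeasure_apply hdeg S hC).comp (measurable_glue z)
  rw [condMeasure_apply hdeg z hEm hl hlT, seqInt_append, hU, ← lintegral_indicator hB,
    lintegral_inducedMeasure hdeg hTS z (hκ.indicator hB) (nodup_nodeList _)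
      fun v => mem_nodeList]
  refine seqInt_congr_fun fun y hy => ?_
  set D : Set (V → Vec d) := {x | (fun v : S => x v) ∈ orthoVariety (G.induce S) d} with hD
  set K : (V → Vec d) → ℝ≥0∞ := D.indicator fun x => B.indicator 1 fun v : ↥(S \ T) => x v with hK
  have hFm := measurable_condIntegrand (G := G) (measurable_one.indicator hC :
    Measurable (C.indicator (1 : (↥Sᶜ → Vec d) → ℝ≥0∞)))
  -- A map in Σ_G restricts to one in Σ_{G[S]}, so the indicator of the latter can be inserted. The
  -- first factor `K` depends only on the values in `S` and comes out of the second-stage integral.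
  have hmul : ((orthoVariety G d).indicator fun x : V → Vec d =>
      E.indicator (1 : (↥Tᶜ → Vec d) → ℝ≥0∞) fun v : ↥Tᶜ => x v) = fun x => K x *
        (orthoVariety G d).indicator
          (fun x : V → Vec d => C.indicator (1 : (↥Sᶜ → Vec d) → ℝ≥0∞) fun v : ↥Sᶜ => x v) x := by
    funext x
    by_cases hx : x ∈ orthoVariety G d
    · rw [Set.indicator_of_mem hx, Set.indicator_of_mem hx, hK,
        Set.indicator_of_mem (show x ∈ D from restrict_mem_orthoVariety hx S)]
      by_cases h1 : (fun v : ↥(S \ T) => x v) ∈ B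
      · by_cases h2 : (fun v : ↥Sᶜ => x v) ∈ C
        · rw [Set.indicator_of_mem h1, Set.indicator_of_mem h2, Set.indicator_of_mem]
          · simp
          · exact ⟨h1, h2⟩
        · rw [Set.indicator_of_notMem h2, Set.indicator_of_notMem, mul_zero]
          exact fun h => h2 h.2
      · rw [Set.indicator_of_notMem h1, Set.indicator_of_notMem, zero_mul]
        exact fun h => h1 h.1
    · rw [Set.indicator_of_notMem hx, Set.indicator_of_notMem hx, mul_zero]
  have hKc : ∀ y', (∀ v, v ∉ nodeList Sᶜ → y' v = y v) → K y' = K y := by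
    intro y' h
    have h' : ∀ v ∈ S, y' v = y v := fun v hv => h v fun h => (mem_nodeList.1 h) hv
    have e1 : (fun v : S => y' v) = fun v : S => y v := funext fun v => h' v v.2
    have e2 : (fun v : ↥(S \ T) => y' v) = fun v : ↥(S \ T) => y v :=
      funext fun v => h' v v.2.1
    have e3 : y' ∈ D ↔ y ∈ D := by rw [hD, Set.mem_ofPred_eq, Set.mem_ofPred_eq, e1]
    by_cases hyD : y ∈ D
    · rw [hK, Set.indicator_of_mem hyD, Set.indicator_of_mem (e3.2 hyD), e2]
    · rw [hK, Set.indicator_of_notMem hyD, Set.indicator_of_notMem fun h => hyD (e3.1 h)]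
  have hyS : extendZero S (glue z fun v : ↥(S \ T) => y v) = y := by
    funext v
    by_cases hv : v ∈ S
    · rw [extendZero_of_mem _ hv]
      by_cases hvT : v ∈ T
      · rw [hy v fun h => (mem_nodeList.1 h).2 hvT, extendZero_of_mem z hvT]
        simp [glue, hvT]
      · simp [glue, hvT]
    · rw [extendZero_of_notMem _ hv, hy v fun h => hv (mem_nodeList.1 h).1,
        extendZero_of_notMem z fun h => hv (hTS h)]
  rw [hmul, seqInt_mul_left isWeight_sWeight hFm hKc]
  have hc := condMeasure_apply hdeg (glue z fun v : ↥(S \ T) => y v) hC (nodup_nodeList Sᶜ)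
    fun v => mem_nodeList
  rw [hyS] at hc
  rw [← hc, hK]
  by_cases hyD : y ∈ D
  · rw [Set.indicator_of_mem hyD, Set.indicator_of_mem hyD]
    by_cases hyB : (fun v : ↥(S \ T) => y v) ∈ B
    · rw [Set.indicator_of_mem hyB, Set.indicator_of_mem hyB, Pi.one_apply, one_mul]
    · rw [Set.indicator_of_notMem hyB, Set.indicator_of_notMem hyB, zero_mul]
  · rw [Set.indicator_of_notMem hyD, Set.indicator_of_notMem hyD, zero_mul]

theorem IsSparse.isConditioning (hG : IsSparse d G) (hd : 0 < d) (p : NodeOrder V) :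
    IsConditioning (orthoMeasure G d p) (condMeasure G d) (inducedMeasure G d) where
  empty z := by
    have hdeg : ∀ (v : V) (N : Finset V), (∀ w ∈ N, G.Adj v w) → N.card < d :=
      fun v N => hG.card_lt hd
    refine Measure.ext_of_lintegral _ fun F hF => ?_
    have hm := measurable_restrict_pi (V := V) (d := d) (∅ᶜ : Set V)
    rw [lintegral_condMeasure hdeg z hF (nodup_nodeList univ) (by simp), lintegral_map hF hm]
    refine Eq.trans ?_ (hG.lintegral_orthoMeasure hd p (hF.comp hm) (nodup_nodeList univ)
      (by simp)).symm
    congr 1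
    funext v
    simp [extendZero]
  measurable S B hB := measurable_condMeasure_apply (fun v N => hG.card_lt hd) S hB
  disintegration T S hTS z B C hB hC :=
    condMeasure_disintegration (fun v N => hG.card_lt hd) hTS z hB hC

/-- The marginal of κ_T(z) has density κ_S(zy)(Ω_S) with respect to the base measure, and this
density cancels the normalization of κ_S(zy). -/
theorem IsConditioning.normalized {V Ω : Type*} [MeasurableSpace Ω] {φ : Measure (V → Ω)}
    {κ : ∀ S : Set V, (S → Ω) → Measure (↥Sᶜ → Ω)}
    {base : ∀ S T : Set V, (T → Ω) → Measure (↥(S \ T) → Ω)} (h : IsConditioning φ κ base) :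
    IsConditioning ((φ univ)⁻¹ • φ) (OrthoHom.normalized κ) (marginal (OrthoHom.normalized κ)) where
  empty z := by
    have hm : Measurable fun (x : V → Ω) (v : ↥(∅ : Set V)ᶜ) => x v :=
      measurable_pi_iff.2 fun v => measurable_pi_apply _
    rw [OrthoHom.normalized, h.empty, Measure.map_smul, Measure.map_apply hm MeasurableSet.univ,
      Set.preimage_univ]
  measurable S B hB := by
    simp only [OrthoHom.normalized, Measure.smul_apply, smul_eq_mul]
    exact (h.measurable S univ MeasurableSet.univ).inv.mul (h.measurable S B hB)
  disintegration T S hTS z B C hB hC := by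
    have m1 : Measurable fun (w : ↥Tᶜ → Ω) (v : ↥(S \ T)) => w ⟨v.1, v.2.2⟩ :=
      measurable_pi_iff.2 fun v => measurable_pi_apply _
    have hM : Measurable fun y : ↥(S \ T) → Ω => κ S (glue z y) univ :=
      (h.measurable S univ MeasurableSet.univ).comp (measurable_glue z)
    have hκC : Measurable fun y : ↥(S \ T) → Ω => κ S (glue z y) C :=
      (h.measurable S C hC).comp (measurable_glue z)
    have hmarg : (κ T z).map (fun w (v : ↥(S \ T)) => w ⟨v.1, v.2.2⟩) =
        (base S T z).withDensity fun y => κ S (glue z y) univ := by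
      ext A hA
      rw [Measure.map_apply m1 hA, withDensity_apply _ hA,
        ← h.disintegration T S hTS z A univ hA MeasurableSet.univ]
      congr 1
      ext w
      simp
    simp only [OrthoHom.normalized, marginal, Measure.smul_apply, smul_eq_mul, Measure.map_smul]
    rw [hmarg, Measure.restrict_smul, lintegral_smul_measure, smul_eq_mul,
      h.disintegration T S hTS z B C hB hC]
    -- The normalizing factor is then 0 and both sides vanish. Otherwise the inner total masses are
    -- finite almost everywhere, which permits the cancellation.
    by_cases htop : κ T z univ = ∞
    · rw [htop]
      simp
    congr 1
    have hfin : ∀ᵐ y ∂(base S T z), κ S (glue z y) univ < ∞ := by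
      refine ae_lt_top hM ?_
      have := h.disintegration T S hTS z univ univ MeasurableSet.univ MeasurableSet.univ
      rw [Measure.restrict_univ] at this
      rw [← this]
      exact ne_top_of_le_ne_top htop (measure_mono (Set.subset_univ _))
    have hg : Measurable fun y : ↥(S \ T) → Ω =>
        (κ S (glue z y) univ)⁻¹ * κ S (glue z y) C := hM.inv.mul hκC
    rw [setLIntegral_withDensity_eq_setLIntegral_mul _ hM hg hB]
    refine lintegral_congr_ae (ae_restrict_of_ae ?_)
    filter_upwards [hfin] with y hy
    rw [Pi.mul_apply, ← mul_assoc]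
    -- Where the inner measure is zero, its normalization is zero too, consistent with the value of
    -- `C`.
    by_cases h0 : κ S (glue z y) univ = 0
    · rw [h0, zero_mul, zero_mul]
      exact le_antisymm ((measure_mono (Set.subset_univ _)).trans h0.le) zero_le
    · rw [ENNReal.mul_inv_cancel h0 hy.ne, one_mul]

end Conditioning

/-! ### Independence over the components of G \ S. -/

section Markov

variable {V : Type*} [Finite V] {d : ℕ} {G : SimpleGraph V}

theorem nbrs_union_of_not_adj {P Q : Set V} {v : V} (h : ∀ w ∈ Q, ¬ G.Adj v w) :
    nbrs G (P ∪ Q) v = nbrs G P v := by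
  ext w
  rw [mem_nbrs, mem_nbrs]
  refine and_congr_right fun hw => ⟨fun h' => h'.resolve_right fun hQ => h w hQ hw, Or.inl⟩

theorem seqInt_union_of_not_adj {s : (V → Vec d) → Finset V → ℝ≥0∞} {P Q : Set V} {l : List V}
    (h : ∀ v ∈ l, ∀ w ∈ Q, ¬ G.Adj v w) (F : (V → Vec d) → ℝ≥0∞) (x : V → Vec d) :
    seqInt G s (P ∪ Q) l F x = seqInt G s P l F x := by
  induction l generalizing P x with
  | nil => rfl
  | cons v l ih =>
    simp only [seqInt]
    rw [nbrs_union_of_not_adj (h v (by simp)), ← Set.insert_union]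
    simp_rw [ih fun w hw => h w (List.mem_cons_of_mem _ hw)]

/-- The integral only depends on the nodes which are relevant for the choices and the integrand. -/
theorem seqInt_congr_on {s : (V → Vec d) → Finset V → ℝ≥0∞} (hs : IsWeight s) {A P : Set V}
    {l : List V} {F : (V → Vec d) → ℝ≥0∞} (hF : ∀ y y', (∀ v ∈ A, y v = y' v) → F y = F y')
    (hP : P ⊆ A) (hl : ∀ v ∈ l, v ∈ A) {x y : V → Vec d} (h : ∀ v ∈ A, x v = y v) :
    seqInt G s P l F x = seqInt G s P l F y := by
  induction l generalizing P x y with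
  | nil => exact hF _ _ h
  | cons v l ih =>
    have hN : ∀ w ∈ nbrs G P v, x w = y w := fun w hw => h w (hP (mem_nbrs.1 hw).2)
    simp only [seqInt]
    rw [hs.congr x y _ hN]
    congr 1
    refine lintegral_congr fun g => ih (Set.insert_subset (hl v (by simp)) hP)
      (fun w hw => hl w (List.mem_cons_of_mem _ hw)) fun w hw => ?_
    by_cases hwv : w = v
    · subst hwv
      rw [choose_self, choose_self, pick_congr hN]
    · rw [choose_of_ne _ _ hwv, choose_of_ne _ _ hwv, h w hw]

/-- Choices in blocks with no edges between them are independent. -/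
theorem seqInt_flatMap {ι : Type*} {s : (V → Vec d) → Finset V → ℝ≥0∞} (hs : IsWeight s)
    {S : Set V} {L : ι → List V} {cs : List ι} (hcs : cs.Nodup)
    (hdisj : ∀ c c', c ≠ c' → ∀ v ∈ L c, ∀ w ∈ L c', v ≠ w ∧ ¬ G.Adj v w)
    (hS : ∀ c, ∀ v ∈ L c, v ∉ S) {f : ι → (V → Vec d) → ℝ≥0∞} (hfm : ∀ c, Measurable (f c))
    (hf : ∀ c y y', (∀ v, v ∈ S ∨ v ∈ L c → y v = y' v) → f c y = f c y') (x : V → Vec d) :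
    seqInt G s S (cs.flatMap L) (fun y => (cs.map fun c => f c y).prod) x =
      (cs.map fun c => seqInt G s S (L c) (f c) x).prod := by
  induction cs with
  | nil => simp [seqInt]
  | cons c cs ih =>
    rw [List.nodup_cons] at hcs
    have hne : ∀ c' ∈ cs, c' ≠ c := fun c' hc' e => hcs.1 (e ▸ hc')
    set K : (V → Vec d) → ℝ≥0∞ := fun y => (cs.map fun c => f c y).prod with hK
    have hKm : Measurable K := by
      rw [hK]
      clear ih hne hcs hK K
      induction cs with
      | nil => exact measurable_const
      | cons c cs ih =>
        simp only [List.map_cons, List.prod_cons]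
        exact (hfm c).mul ih
    have hrest : ∀ v ∈ cs.flatMap L, ∃ c' ∈ cs, v ∈ L c' := fun v hv => List.mem_flatMap.1 hv
    have hKc : ∀ y y' : V → Vec d, (∀ v ∈ {v | v ∉ L c}, y v = y' v) → K y = K y' := by
      intro y y' hyy
      simp only [hK]
      congr 1
      refine List.map_congr_left fun c' hc' => hf c' y y' ?_
      rintro v (hv | hv)
      · exact hyy v fun h => hS c v h hv
      · exact hyy v fun h => (hdisj c' c (hne c' hc') v hv v h).1 rfl
    -- Once block c has been processed, its factor is constant for the remaining choices. The
    -- remaining blocks have no neighbor in block c, so their integral is the same as from `x`.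
    have hstep : ∀ y : V → Vec d, (∀ v, v ∉ L c → y v = x v) →
        seqInt G s (S ∪ {v | v ∈ L c}) (cs.flatMap L) (fun y => f c y * K y) y =
          seqInt G s S (cs.flatMap L) K x * f c y := by
      intro y hy
      rw [seqInt_mul_left hs hKm, seqInt_union_of_not_adj, mul_comm]
      · congr 1
        refine seqInt_congr_on hs hKc (fun v hv h => hS c v h hv) (fun v hv h => ?_) hy
        obtain ⟨c', hc', hv'⟩ := hrest v hv
        exact (hdisj c' c (hne c' hc') v hv' v h).1 rfl
      · intro v hv w hw
        obtain ⟨c', hc', hv'⟩ := hrest v hv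
        exact (hdisj c' c (hne c' hc') v hv' w hw).2
      · intro y' hy'
        refine hf c y' y fun v hv => hy' v fun hvr => ?_
        obtain ⟨c', hc', hv'⟩ := hrest v hvr
        rcases hv with hv | hv
        · exact hS c' v hv' hv
        · exact (hdisj c' c (hne c' hc') v hv' v hv).1 rfl
    simp only [List.flatMap_cons, List.map_cons, List.prod_cons, seqInt_append]
    rw [seqInt_congr_fun (F' := fun y => seqInt G s S (cs.flatMap L) K x * f c y) hstep,
      seqInt_const_mul hs (hfm c), ih hcs.2, mul_comm]

theorem seqInt_indicator_of_ae {s : (V → Vec d) → Finset V → ℝ≥0∞} (hs : IsWeight s)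
    {P : Set V} {l : List V} (hl : l.Nodup) (hP : ∀ v ∈ l, v ∉ P) {x : V → Vec d}
    {A : Set (V → Vec d)} (hA : MeasurableSet A) (h : ∀ᵐ y ∂(seqMeasure G P l x), y ∈ A)
    {F : (V → Vec d) → ℝ≥0∞} (hF : Measurable F) :
    seqInt G s P l (A.indicator F) x = seqInt G s P l F x := by
  have hm : ∀ F : (V → Vec d) → ℝ≥0∞, Measurable F →
      Measurable fun y => seqWeight G s P l y * F y := fun F hF =>
    (measurable_seqWeight hs P l).mul hF
  rw [seqInt_eq_seqInt_one hs hl hP (hF.indicator hA), seqInt_eq_seqInt_one hs hl hP hF,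
    ← lintegral_seqMeasure (hm _ (hF.indicator hA)), ← lintegral_seqMeasure (hm _ hF)]
  refine lintegral_congr_ae ?_
  filter_upwards [h] with y hy
  rw [Set.indicator_of_mem hy]

theorem seqInt_indicator_of_ae_notMem {s : (V → Vec d) → Finset V → ℝ≥0∞} (hs : IsWeight s)
    {P : Set V} {l : List V} (hl : l.Nodup) (hP : ∀ v ∈ l, v ∉ P) {x : V → Vec d}
    {A : Set (V → Vec d)} (hA : MeasurableSet A) (h : ∀ᵐ y ∂(seqMeasure G P l x), y ∉ A)
    {F : (V → Vec d) → ℝ≥0∞} (hF : Measurable F) :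
    seqInt G s P l (A.indicator F) x = 0 := by
  have hm : Measurable fun y => seqWeight G s P l y * A.indicator F y :=
    (measurable_seqWeight hs P l).mul (hF.indicator hA)
  rw [seqInt_eq_seqInt_one hs hl hP (hF.indicator hA), ← lintegral_seqMeasure hm,
    lintegral_congr_ae (g := fun _ => 0), lintegral_zero]
  filter_upwards [h] with y hy
  rw [Set.indicator_of_notMem hy, mul_zero]

theorem pi_zero_measure {ι : Type*} [Fintype ι] [Nonempty ι] {α : ι → Type*}
    [∀ i, MeasurableSpace (α i)] : Measure.pi (fun i => (0 : Measure (α i))) = 0 :=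
  Measure.pi_eq fun s _ => by
    obtain ⟨i⟩ := ‹Nonempty ι›
    rw [Measure.coe_zero, Pi.zero_apply, Finset.prod_eq_zero (Finset.mem_univ i)]
    rfl

theorem seqWeight_ne_top {P : Set V} {l : List V} {y : V → Vec d} :
    seqWeight G sWeight P l y ≠ ∞ := by
  induction l generalizing P with
  | nil => simp [seqWeight]
  | cons v l ih => exact ENNReal.mul_ne_top ENNReal.ofReal_ne_top ih

/-- The nodes of a component of `G \ S`, as nodes of `G`. -/
def blockList {S : Set V} (c : (G.induce Sᶜ).ConnectedComponent) : List V :=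
  nodeList (Subtype.val '' c.supp)

theorem nodup_blockList {S : Set V} (c : (G.induce Sᶜ).ConnectedComponent) :
    (blockList c).Nodup := nodup_nodeList _

theorem mem_blockList {S : Set V} {c : (G.induce Sᶜ).ConnectedComponent} {v : V} :
    v ∈ blockList c ↔ ∃ h : v ∈ Sᶜ, (G.induce Sᶜ).connectedComponentMk ⟨v, h⟩ = c := by
  rw [blockList, mem_nodeList]
  constructor
  · rintro ⟨a, ha, rfl⟩
    exact ⟨a.2, ha⟩
  · rintro ⟨h, hc⟩
    exact ⟨⟨v, h⟩, hc, rfl⟩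

theorem blockList_disjoint {S : Set V} {c c' : (G.induce Sᶜ).ConnectedComponent} (h : c ≠ c')
    {v w : V} (hv : v ∈ blockList c) (hw : w ∈ blockList c') : v ≠ w ∧ ¬ G.Adj v w := by
  obtain ⟨h1, rfl⟩ := mem_blockList.1 hv
  obtain ⟨h2, rfl⟩ := mem_blockList.1 hw
  constructor
  · rintro rfl
    exact h rfl
  · intro hadj
    apply h
    rw [SimpleGraph.ConnectedComponent.eq]
    exact SimpleGraph.Adj.reachable (G := G.induce Sᶜ) hadj

open scoped Classical in
/-- The map which agrees with `w` on a component of `G \ S` and with `x` elsewhere. -/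
def blockExtend {S : Set V} (c : (G.induce Sᶜ).ConnectedComponent) (x : V → Vec d)
    (w : c.supp → Vec d) : V → Vec d := fun v =>
  if h : ∃ h : v ∈ Sᶜ, (⟨v, h⟩ : ↥Sᶜ) ∈ c.supp then w ⟨⟨v, h.1⟩, h.2⟩ else x v

theorem measurable_blockExtend {S : Set V} (c : (G.induce Sᶜ).ConnectedComponent)
    (x : V → Vec d) : Measurable (blockExtend c x) := by
  refine measurable_pi_iff.2 fun v => ?_
  by_cases h : ∃ h : v ∈ Sᶜ, (⟨v, h⟩ : ↥Sᶜ) ∈ c.supp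
  · simp only [blockExtend, h, dif_pos]
    exact measurable_pi_apply _
  · simp only [blockExtend, h, dif_neg, not_false_eq_true]
    exact measurable_const

theorem blockExtend_restrict {S : Set V} (c : (G.induce Sᶜ).ConnectedComponent)
    {x y : V → Vec d} (h : ∀ v, v ∉ blockList c → y v = x v) :
    blockExtend c x (fun v : c.supp => y v.1.1) = y := by
  funext v
  by_cases hv : ∃ h : v ∈ Sᶜ, (⟨v, h⟩ : ↥Sᶜ) ∈ c.supp
  · rw [blockExtend, dif_pos hv]
  · rw [blockExtend, dif_neg hv]
    exact (h v fun h' => hv (mem_blockList.1 h')).symm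

theorem measurable_restrict_supp {S : Set V} (c : (G.induce Sᶜ).ConnectedComponent) :
    Measurable fun (y : V → Vec d) (v : c.supp) => y v.1.1 :=
  measurable_pi_iff.2 fun _ => measurable_pi_apply _

/-- The factor of the conditional measure that belongs to a component of `G \ S`. -/
def blockMeasure {S : Set V} (c : (G.induce Sᶜ).ConnectedComponent) (x : V → Vec d) :
    Measure (c.supp → Vec d) :=
  ((seqMeasure G S (blockList c) x).map fun y (v : c.supp) => y v.1.1).withDensity
    fun w => seqWeight G sWeight S (blockList c) (blockExtend c x w)

theorem sigmaFinite_blockMeasure {S : Set V} (c : (G.induce Sᶜ).ConnectedComponent)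
    (x : V → Vec d) : SigmaFinite (blockMeasure c x) := by
  have := Measure.isProbabilityMeasure_map (μ := seqMeasure G S (blockList c) x)
    (measurable_restrict_supp c).aemeasurable
  refine SigmaFinite.withDensity_of_ne_top ?_
  exact ae_of_all _ fun w => seqWeight_ne_top

theorem notMem_of_mem_blockList {S : Set V} {c : (G.induce Sᶜ).ConnectedComponent} {v : V}
    (hv : v ∈ blockList c) : v ∉ S := (mem_blockList.1 hv).1

/-- Starting from `x` only the block changes, so `blockExtend` recovers the whole map from its
values on the block, and the weight becomes a density there. -/
theorem lintegral_blockMeasure {S : Set V} (c : (G.induce Sᶜ).ConnectedComponent)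
    (x : V → Vec d) {F : (c.supp → Vec d) → ℝ≥0∞} (hF : Measurable F) :
    ∫⁻ w, F w ∂(blockMeasure c x) =
      seqInt G sWeight S (blockList c) (fun y => F fun v : c.supp => y v.1.1) x := by
  have hr := measurable_restrict_supp (d := d) c
  have hw : Measurable fun w => seqWeight G sWeight S (blockList c) (blockExtend c x w) :=
    (measurable_seqWeight isWeight_sWeight S _).comp (measurable_blockExtend c x)
  have hFr : Measurable fun y : V → Vec d => F fun v : c.supp => y v.1.1 := hF.comp hr
  have hm : Measurable fun y : V → Vec d =>
      seqWeight G sWeight S (blockList c) (blockExtend c x fun v : c.supp => y v.1.1) *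
        F fun v : c.supp => y v.1.1 := (hw.comp hr).mul hFr
  rw [blockMeasure, lintegral_withDensity_eq_lintegral_mul _ hw hF, lintegral_map (hw.mul hF) hr]
  simp only [Pi.mul_apply]
  rw [lintegral_seqMeasure hm, seqInt_eq_seqInt_one isWeight_sWeight (nodup_blockList c)
    (fun v hv => notMem_of_mem_blockList hv) hFr]
  refine seqInt_congr_fun fun y hy => ?_
  rw [blockExtend_restrict c hy]

/-- The restriction to Σ_G couples the components, but by the zero-one law it either removes only a
null set or removes everything. In the first case φ_z is the product of the block measures, in the
second it is 0. -/
theorem IsSparse.exists_pi (hG : IsSparse d G) (hd : 0 < d) (S : Set V) {z : S → Vec d}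
    (hz : z ∈ orthoVariety (G.induce S) d) [Fintype (G.induce Sᶜ).ConnectedComponent] :
    ∃ μ : ∀ c : (G.induce Sᶜ).ConnectedComponent, Measure (c.supp → Vec d),
      (∀ c, SigmaFinite (μ c)) ∧
      (condMeasure G d S z).map
        (fun w (c : (G.induce Sᶜ).ConnectedComponent) (v : c.supp) => w v) = Measure.pi μ := by
  have hdeg : ∀ (v : V) (N : Finset V), (∀ w ∈ N, G.Adj v w) → N.card < d :=
    fun v N => hG.card_lt hd
  set cs := (Finset.univ : Finset (G.induce Sᶜ).ConnectedComponent).toList with hcs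
  have hcsn : cs.Nodup := Finset.nodup_toList _
  set l := cs.flatMap blockList with hl
  have hnd : l.Nodup := by
    rw [hl, List.nodup_flatMap]
    refine ⟨fun c _ => nodup_blockList c, hcsn.imp fun {c c'} hcc => ?_⟩
    intro v hv hv'
    exact (blockList_disjoint hcc hv hv').1 rfl
  have hlS : ∀ v, v ∈ l ↔ v ∉ S := by
    intro v
    rw [hl, List.mem_flatMap]
    constructor
    · rintro ⟨c, -, hv⟩
      exact notMem_of_mem_blockList hv
    · exact fun h => ⟨_, by simp [hcs], mem_blockList.2 ⟨h, rfl⟩⟩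
  set x := extendZero S z with hx
  have hlP : ∀ v ∈ l, v ∉ S := fun v hv => (hlS v).1 hv
  have hmap : Measurable fun (w : ↥Sᶜ → Vec d) (c : (G.induce Sᶜ).ConnectedComponent)
      (v : c.supp) => w v :=
    measurable_pi_iff.2 fun c => measurable_pi_iff.2 fun v => measurable_pi_apply _
  have hhom := ae_isOrthoHom hdeg hz.1 hnd hlS
  rcases genPos_zero_one (G := G) univ S l x with hgp | hgp
  · have h0 : condMeasure G d S z = 0 := by
      rw [← Measure.measure_univ_eq_zero, condMeasure_apply hdeg z MeasurableSet.univ hnd hlS]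
      refine seqInt_indicator_of_ae_notMem isWeight_sWeight hnd hlP measurableSet_orthoVariety ?_
        ((measurable_one.indicator MeasurableSet.univ).comp (measurable_restrict_pi _))
      filter_upwards [hgp] with y hy hy'
      exact hy (inGeneralPosition_iff.1 hy'.2)
    -- The zero measure is a product only over a nonempty index set. Without components, S is all of
    -- V and the process returns `z` itself, which is in general position by assumption.
    have : Nonempty (G.induce Sᶜ).ConnectedComponent := by
      by_contra hempty
      rw [not_nonempty_iff] at hempty
      have hS : S = univ := by
        refine Set.eq_univ_of_forall fun v => ?_
        by_contra hv
        exact hempty.elim ((G.induce Sᶜ).connectedComponentMk ⟨v, hv⟩)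
      have hlnil : l = [] := List.eq_nil_iff_forall_not_mem.2 fun v hv =>
        hlP v hv (hS ▸ Set.mem_univ v)
      rw [hlnil, seqMeasure, ae_dirac_iff (measurableSet_genPos univ).compl] at hgp
      exact hgp fun W _ hWd => extendZero_mem_genPos hz.2 W (by rw [hS]; exact subset_univ _) hWd
    refine ⟨fun _ => 0, fun _ => inferInstance, ?_⟩
    rw [h0, Measure.map_zero, pi_zero_measure]
  · have hgood : ∀ᵐ y ∂(seqMeasure G S l x), y ∈ orthoVariety G d := by
      filter_upwards [hhom, hgp] with y hy hy'
      exact ⟨hy, inGeneralPosition_iff.2 hy'⟩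
    have hσ : ∀ c : (G.induce Sᶜ).ConnectedComponent, SigmaFinite (blockMeasure c x) :=
      fun c => sigmaFinite_blockMeasure c x
    refine ⟨fun c => blockMeasure c x, hσ, ?_⟩
    symm
    refine Measure.pi_eq fun s hs => ?_
    have hB : MeasurableSet ((fun (w : ↥Sᶜ → Vec d) (c : (G.induce Sᶜ).ConnectedComponent)
      (v : c.supp) => w v) ⁻¹' Set.pi univ s) := hmap (MeasurableSet.univ_pi hs)
    set f : (G.induce Sᶜ).ConnectedComponent → (V → Vec d) → ℝ≥0∞ := fun c y =>
      (s c).indicator 1 fun v : c.supp => y v.1.1 with hf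
    have hind : (fun y : V → Vec d => ((fun (w : ↥Sᶜ → Vec d)
        (c : (G.induce Sᶜ).ConnectedComponent) (v : c.supp) => w v) ⁻¹' Set.pi univ s).indicator
          (1 : (↥Sᶜ → Vec d) → ℝ≥0∞) fun v : ↥Sᶜ => y v) =
        fun y => (cs.map fun c => f c y).prod := by
      funext y
      rw [hcs, Finset.prod_map_toList]
      by_cases hy : ∀ c : (G.induce Sᶜ).ConnectedComponent, (fun v : c.supp => y v.1.1) ∈ s c
      · rw [Set.indicator_of_mem (by simpa using hy), Pi.one_apply]
        refine (Finset.prod_eq_one fun c _ => ?_).symm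
        simp only [hf]
        rw [Set.indicator_of_mem (hy c), Pi.one_apply]
      · rw [Set.indicator_of_notMem (by simpa using hy)]
        obtain ⟨c, hc⟩ := not_forall.1 hy
        refine (Finset.prod_eq_zero (Finset.mem_univ c) ?_).symm
        simp only [hf]
        rw [Set.indicator_of_notMem hc]
    have hBm : Measurable fun y : V → Vec d => ((fun (w : ↥Sᶜ → Vec d)
        (c : (G.induce Sᶜ).ConnectedComponent) (v : c.supp) => w v) ⁻¹' Set.pi univ s).indicator
          (1 : (↥Sᶜ → Vec d) → ℝ≥0∞) fun v : ↥Sᶜ => y v :=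
      (measurable_one.indicator hB).comp (measurable_restrict_pi _)
    rw [Measure.map_apply hmap (MeasurableSet.univ_pi hs), condMeasure_apply hdeg z hB hnd hlS,
      seqInt_indicator_of_ae isWeight_sWeight hnd hlP measurableSet_orthoVariety hgood hBm, hind]
    have hfm : ∀ c, Measurable (f c) := fun c =>
      (measurable_one.indicator (hs c)).comp (measurable_restrict_supp c)
    rw [hl, seqInt_flatMap isWeight_sWeight hcsn
      (fun c c' hcc v hv w hw => blockList_disjoint hcc hv hw)
      (fun c v hv => notMem_of_mem_blockList hv) hfm, hcs,
      Finset.prod_map_toList]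
    · refine Finset.prod_congr rfl fun c _ => ?_
      rw [← lintegral_indicator_one (hs c),
        lintegral_blockMeasure c x (measurable_one.indicator (hs c))]
    · intro c y y' hyy
      simp only [hf]
      congr 1
      funext v
      exact hyy v.1.1 (Or.inr (mem_blockList.2 ⟨v.1.2, v.2⟩))

theorem IsSparse.isMarkovian (hG : IsSparse d G) (hd : 0 < d) :
    IsMarkovian G (condMeasure G d) fun S => orthoVariety (G.induce S) d := by
  intro S z hz
  exact @IsSparse.exists_pi V _ d G hG hd S z hz (Fintype.ofFinite _)

/-- With finite nonzero total mass every factor is finite and nonzero and is normalized separately.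
Total mass 0 leaves the zero measure as it is. Infinite mass gives 0, a product of zeros; the index
set is then nonempty because an empty product has mass 1. -/
theorem exists_pi_eq_smul {ι : Type*} [Fintype ι] {α : ι → Type*} [∀ i, MeasurableSpace (α i)]
    (μ : ∀ i, Measure (α i)) [∀ i, SigmaFinite (μ i)] :
    ∃ ν : ∀ i, Measure (α i), (∀ i, SigmaFinite (ν i)) ∧
      (Measure.pi μ univ)⁻¹ • Measure.pi μ = Measure.pi ν := by
  by_cases h0 : Measure.pi μ univ = 0
  · refine ⟨μ, inferInstance, ?_⟩
    rw [Measure.measure_univ_eq_zero.1 h0, smul_zero]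
  by_cases htop : Measure.pi μ univ = ∞
  · have : Nonempty ι := by
      by_contra hempty
      rw [not_nonempty_iff] at hempty
      rw [Measure.pi_univ, Finset.univ_eq_empty, Finset.prod_empty] at htop
      exact ENNReal.one_ne_top htop
    refine ⟨fun _ => 0, fun _ => inferInstance, ?_⟩
    rw [htop, ENNReal.inv_top, zero_smul, pi_zero_measure]
  rw [Measure.pi_univ] at h0 htop
  have hne : ∀ i, μ i univ ≠ 0 := fun i => Finset.prod_ne_zero_iff.1 h0 i (Finset.mem_univ i)
  have hfin : ∀ i, IsFiniteMeasure (μ i) := fun i => ⟨by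
    classical
    rw [lt_top_iff_ne_top]
    intro hi
    rw [← Finset.mul_prod_erase _ _ (Finset.mem_univ i), hi] at htop
    exact htop (ENNReal.top_mul (Finset.prod_ne_zero_iff.2 fun j _ => hne j))⟩
  have hσ : ∀ i, SigmaFinite ((μ i univ)⁻¹ • μ i) := fun i => by
    have := (μ i).smul_finite (ENNReal.inv_ne_top.2 (hne i))
    infer_instance
  refine ⟨fun i => (μ i univ)⁻¹ • μ i, hσ, ?_⟩
  symm
  refine Measure.pi_eq fun s _ => ?_
  rw [Measure.smul_apply, Measure.pi_pi, Measure.pi_univ, smul_eq_mul,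
    ENNReal.prod_inv_distrib fun i _ j _ _ => Or.inl (hne i), ← Finset.prod_mul_distrib]
  rfl

theorem IsMarkovian.normalized {V Ω : Type*} [Finite V] [MeasurableSpace Ω] {G : SimpleGraph V}
    {κ : ∀ S : Set V, (S → Ω) → Measure (↥Sᶜ → Ω)} {D : ∀ S : Set V, Set (S → Ω)}
    (h : IsMarkovian G κ D) : IsMarkovian G (OrthoHom.normalized κ) D := by
  intro S z hz
  obtain ⟨μ, hσ, hμ⟩ := h S z hz
  have hmap : Measurable fun (w : ↥Sᶜ → Ω) (c : (G.induce Sᶜ).ConnectedComponent)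
      (v : c.supp) => w v :=
    measurable_pi_iff.2 fun c => measurable_pi_iff.2 fun v => measurable_pi_apply _
  let _ : Fintype (G.induce Sᶜ).ConnectedComponent := Fintype.ofFinite _
  obtain ⟨ν, hν, he⟩ := exists_pi_eq_smul μ
  refine ⟨ν, hν, ?_⟩
  rw [← he, ← hμ, Measure.map_apply hmap MeasurableSet.univ, OrthoHom.normalized,
    Measure.map_smul, Set.preimage_univ]

end Markov

end OrthoHom

end

theorem theorem2 {V : Type*} [Finite V] (G : SimpleGraph V) (d : ℕ) (hd : 3 ≤ d)
    (hG : IsSparse d G) :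
    -- swapping two choices in linear subspaces
    (∀ L₁ L₂ : Submodule ℝ (Vec d), 2 ≤ Module.finrank ℝ L₁ → 2 ≤ Module.finrank ℝ L₂ →
      let ρ₁ := (pairLaw L₁ L₂).restrict (swapDomain L₁ L₂)
      let ρ₂ := ((pairLaw L₂ L₁).map Prod.swap).restrict (swapDomain L₁ L₂)
      let d₁ := Module.finrank ℝ L₁
      let d₂ := Module.finrank ℝ L₂
      ρ₁ ≪ ρ₂ ∧ ρ₂ ≪ ρ₁ ∧
      ρ₂ = ρ₁.withDensity (fun q => ENNReal.ofReal
        ((sphereArea (d₁ - 1) * sphereArea (d₂ - 2)) /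
          (sphereArea (d₂ - 1) * sphereArea (d₁ - 2)) *
          (‖L₁.starProjection q.2‖ / ‖L₂.starProjection q.1‖)))) ∧
    -- flipping two consecutive adjacent nodes of an ordering
    (∀ (p : NodeOrder V) (u v : V), G.Adj u v → (p v : ℕ) = (p u : ℕ) + 1 →
      let r := flipOrder p u v
      seqLaw G d p ≪ seqLaw G d r ∧ seqLaw G d r ≪ seqLaw G d p ∧
      seqLaw G d r = (seqLaw G d p).withDensity (swapDensity G p r u v)) ∧
    -- the random sequential ortho-homomorphism is a random point of `Σ_G`
    (∀ p : NodeOrder V, IsProbabilityMeasure (seqLaw G d p) ∧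
      ∀ᵐ x ∂(seqLaw G d p), x ∈ orthoVariety G d) ∧
    -- for almost all `z` its random extension is also in general position
    (∀ (S : Set V) (q : NodeOrder S), ∀ᵐ z ∂(orthoMeasure (G.induce S) d q),
      ∀ p : NodeOrder V, StartsWith p S → ∀ᵐ x ∂(seqExtension G p S z), x ∈ orthoVariety G d) ∧
    -- the measures `φ_z` do not depend on the ordering
    (∀ (S : Set V) (z : S → Vec d) (p : NodeOrder V), StartsWith p S →
      condMeasureOrd G d p S z = condMeasure G d S z) ∧
    ∃ φ : Measure (V → Vec d),
      -- `φ = φ_p` for every ordering `p`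
      (∀ p : NodeOrder V, orthoMeasure G d p = φ) ∧
      -- `φ` is a nonzero Radon measure on `Σ_G`
      φ ≠ 0 ∧ φ (orthoVariety G d)ᶜ = 0 ∧
      (φ.comap (Subtype.val : orthoVariety G d → V → Vec d)).Regular ∧
      -- the family `φ_z` is a Markovian conditioning of `φ`
      IsConditioning φ (condMeasure G d) (inducedMeasure G d) ∧
      IsMarkovian G (condMeasure G d) (fun S => orthoVariety (G.induce S) d) ∧
      -- if `φ` is finite, normalizing gives a probability measure with a Markovian conditioning
      -- with respect to its marginals
      (φ univ < ∞ →
        IsProbabilityMeasure ((φ univ)⁻¹ • φ) ∧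
        IsConditioning ((φ univ)⁻¹ • φ) (normalized (condMeasure G d))
          (marginal (normalized (condMeasure G d))) ∧
        IsMarkovian G (normalized (condMeasure G d))
          (fun S => orthoVariety (G.induce S) d)) := by
  have hd0 : 0 < d := by omega
  have hdeg : ∀ (v : V) (N : Finset V), (∀ w ∈ N, G.Adj v w) → N.card < d :=
    fun v N => hG.card_lt hd0
  refine ⟨fun L₁ L₂ h₁ h₂ => ?_, fun p u v hadj h => ?_, fun p => ?_, fun S q => ?_,
    fun S z p hp => condMeasureOrd_eq hdeg hp z, ?_⟩
  · have e := pairLaw_swap_eq_withDensity h₁ h₂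
    refine ⟨pairLaw_swap_absolutelyContinuous h₁ h₂, ?_, e⟩
    rw [e]
    exact withDensity_absolutelyContinuous _ _
  · have e := hG.seqLaw_flipOrder hd0 hadj h
    refine ⟨hG.seqLaw_absolutelyContinuous_flipOrder hd0 hadj h, ?_, e⟩
    rw [e]
    exact withDensity_absolutelyContinuous _ _
  · exact ⟨hG.isProbabilityMeasure_seqLaw hd0 p, hG.ae_seqLaw hd0 p⟩
  · exact hG.ae_seqExtension hd0 S q
  -- Any ordering may be used to define φ, by `IsSparse.orthoMeasure_eq`.
  · have p : NodeOrder V := Finite.equivFin V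
    have h0 : orthoMeasure G d p univ ≠ 0 := fun h =>
      hG.orthoMeasure_ne_zero hd0 p (Measure.measure_univ_eq_zero.1 h)
    refine ⟨orthoMeasure G d p, fun q => hG.orthoMeasure_eq hd0 q p, hG.orthoMeasure_ne_zero hd0 p,
      hG.ae_orthoMeasure hd0 p, hG.regular_orthoMeasure hd0 p, hG.isConditioning hd0 p,
      hG.isMarkovian hd0, fun hfin => ⟨⟨?_⟩, (hG.isConditioning hd0 p).normalized,
        (hG.isMarkovian hd0).normalized⟩⟩
    rw [Measure.smul_apply, smul_eq_mul, ENNReal.inv_mul_cancel h0 hfin.ne]
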